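/- Let $\pi$ be the Lévy density of a subordinator $X$ with characteristic triple $(0,0,\pi)_{h\equiv 0}$ (no drift, no Gaussian part, jumps of finite variation) and completely monotone jumps, i.e. $\pi(x)=\mathbf 1_{\{x>0\}}\int_{(0,\infty)}e^{-ux}\mu(du)$ for a positive Radon measure $\mu\neq 0$ on $(0,\infty)$, and assume that $\rho:=\sup\{u\ge 0:\mu((0,u))=0\}>0$. Let $$\psi(z)=\ln\mathbb E[e^{zX_1}]=\int_0^\infty (e^{zx}-1)\,\pi(x)\,dx,\qquad \Re z<\rho,$$ and let $\mu^*$ be the image of $\mu$ under $v\mapsto 1/v$. Fix $k\in\{0,1,2\}$. The $[m/n]$ Padé approximant $\psi^{[m/n]}=P/Q$ is the rational function with $\deg P\le m$, $\deg Q\le n$, $Q(0)\ne0$ and $P(z)/Q(z)=\psi(z)+O(z^{m+n+1})$ as $z\to0$. Here $(a,\sigma^2,\pi)_h$ denotes the triple for which $\psi(z)=\sigma^2z^2/2+az+\int(e^{zx}-1-zh(x))\pi(x)\,dx$. Let $n\ge1$ be smaller than the number of points of $\operatorname{supp}\mu$ (so every $n\ge 1$ is allowed if $\operatorname{supp}\mu$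 is infinite). (i) The Gaussian quadrature of order $n$ with respect to $v^{2+k}\mu^*(dv)$ (distinct nodes $x_1,\dots,x_n$ and weights $w_1,\dots,w_n$ matching the moments of order $0,\dots,2n-1$) and $\psi^{[n+k/n]}$ exist, and $$\psi^{[n+k/n]}(z)=\sum_{j=1}^k\psi^{(j)}(0)\frac{z^j}{j!}+z^{k+1}\sum_{i=1}^n\frac{w_i}{1-zx_i}.$$ (ii) $\psi^{[n+k/n]}$ is the Laplace exponent of a Lévy process $X^{(n)}$ with hyperexponential jumps, whose Lévy density is $\pi_n(x)=\mathbf 1_{\{x>0\}}\sum_{i=1}^n w_ix_i^{-2-k}e^{-x/x_i}$ and whose characteristic triple is $(0,0,\pi_n)_{h\equiv0}$ if $k=0$; $\bigl(\psi'(0)-\sum_{i} w_i/x_i,\,0,\,\pi_n\bigr)_{h\equiv0}$ if $k=1$; $\bigl(\psi'(0),\,\psi''(0)-2\sum_{i} w_i/x_i,\,\pi_n\bigr)_{h\equiv x}$ if $k=2$. The process $X^{(n)}$ is a subordinator with zero linear drift if $k=0$, a subordinator with linear drift $\psi'(0)-\sum_i w_i/x_i>0$ if $k=1$, and a spectrally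 positive process (no negative jumps, not a subordinator) with Gaussian coefficient $\psi''(0)-2\sum_i w_i/x_i>0$ if $k=2$. (iii) $\psi$ extends analytically to $\mathbb C\setminus[\rho,\infty)$, and for every compact $A\subset\mathbb C\setminus[\rho,\infty)$ there are $c_1,c_2>0$ such that for all $n$ as above and all $z\in A$ the approximant $\psi^{[n+k/n]}$ has no pole at $z$ and $|\psi^{[n+k/n]}(z)-\psi(z)|<c_1e^{-c_2n}$. -/

import Mathlib

open MeasureTheory ProbabilityTheory Set Filter Topology
open scoped NNReal ENNReal

noncomputable section

namespace LevyPade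

/-! ### Lévy processes -/

/-- A real-valued Lévy process: it starts at `0`, has independent and stationary increments, and
almost all of its paths are right-continuous with left limits. -/
structure IsLevyProcess {Ω : Type*} [MeasurableSpace Ω] (X : ℝ≥0 → Ω → ℝ) (P : Measure Ω) :
    Prop where
  measurable : ∀ t, Measurable (X t)
  zero : ∀ᵐ ω ∂P, X 0 ω = 0
  indep : HasIndepIncrements X P
  stationary : ∀ s t, IdentDistrib (fun ω => X (s + t) ω - X s ω) (X t) P P
  cadlag : ∀ᵐ ω ∂P, ∀ t, ContinuousWithinAt (fun s => X s ω) (Ici t) t ∧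
    ∃ l, Tendsto (fun s => X s ω) (𝓝[<] t) (𝓝 l)

/-- A subordinator: a Lévy process with almost surely nondecreasing paths. -/
structure IsSubordinator {Ω : Type*} [MeasurableSpace Ω] (X : ℝ≥0 → Ω → ℝ) (P : Measure Ω) :
    Prop where
  levy : IsLevyProcess X P
  monotone : ∀ᵐ ω ∂P, Monotone fun t => X t ω

/-- A spectrally positive process: a Lévy process without negative jumps which is not a
subordinator. -/
structure IsSpectrallyPositive {Ω : Type*} [MeasurableSpace Ω] (X : ℝ≥0 → Ω → ℝ)
    (P : Measure Ω) : Prop where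
  levy : IsLevyProcess X P
  no_negative_jumps : ∀ᵐ ω ∂P, ∀ t, 0 < t → ∀ l,
    Tendsto (fun s => X s ω) (𝓝[<] t) (𝓝 l) → l ≤ X t ω
  not_subordinator : ¬ IsSubordinator X P

/-- `φ` is the Laplace exponent `ln E[exp (z X₁)]` of `X` on the imaginary axis; the logarithm is
the continuous branch that vanishes at `0`. -/
structure IsLaplaceExponent {Ω : Type*} [MeasurableSpace Ω] (X : ℝ≥0 → Ω → ℝ) (P : Measure Ω)
    (φ : ℂ → ℂ) : Prop where
  continuousOn : ContinuousOn φ {z | z.re = 0}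
  zero : φ 0 = 0
  exp_eq : ∀ z : ℂ, z.re = 0 → ∫ ω, Complex.exp (z * (X 1 ω : ℂ)) ∂P = Complex.exp (φ z)

/-- The density `π` of a Lévy measure. -/
structure IsLevyDensity (π : ℝ → ℝ) : Prop where
  measurable : Measurable π
  nonneg : ∀ x, 0 ≤ π x
  integrable : Integrable fun x => min 1 (x ^ 2) * π x

/-- The right-hand side of the Lévy–Khintchine formula for the Gaussian coefficient `s = σ²`, the
linear coefficient `a`, the Lévy density `π` and the cutoff function `h`. -/
def levyExponent (a s : ℝ) (π h : ℝ → ℝ) (z : ℂ) : ℂ :=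
  (s : ℂ) * z ^ 2 / 2 + (a : ℂ) * z +
    ∫ x : ℝ, (Complex.exp (z * (x : ℂ)) - 1 - z * (h x : ℂ)) * (π x : ℂ)

/-- `X` has the characteristic triple `(a, s, π)` with respect to the cutoff function `h`, where
`s = σ²`. The cutoff is admissible: it differs from the classical cutoff `x 1_{|x| < 1}` by a
function that is integrable with respect to the Lévy measure. For `h = 0` this says that the jumps
have finite variation. -/
structure HasTriple {Ω : Type*} [MeasurableSpace Ω] (X : ℝ≥0 → Ω → ℝ) (P : Measure Ω)
    (a s : ℝ) (π h : ℝ → ℝ) : Prop where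
  levy : IsLevyProcess X P
  gaussian_nonneg : 0 ≤ s
  density : IsLevyDensity π
  cutoff_measurable : Measurable h
  cutoff : Integrable fun x => |(if |x| < 1 then x else 0) - h x| * π x
  exponent : IsLaplaceExponent X P (levyExponent a s π h)

/-! ### Completely monotone and hyperexponential jumps -/

/-- `μ` is the positive measure on `ℝ ∖ {0}` that represents the density `π` with completely
monotone `π x` and `π (-x)`, `x > 0`:
`π x = 1_{x > 0} ∫_{(0,∞)} e^{-ux} μ(du) + 1_{x < 0} ∫_{(-∞,0)} e^{-ux} μ(du)`. -/
structure IsMixingMeasure (π : ℝ → ℝ) (μ : Measure ℝ) : Prop where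
  zero : μ {0} = 0
  integrable_pos : ∀ x, 0 < x → IntegrableOn (fun u => Real.exp (-(u * x))) (Ioi 0) μ
  integrable_neg : ∀ x, x < 0 → IntegrableOn (fun u => Real.exp (-(u * x))) (Iio 0) μ
  eq_pos : ∀ x, 0 < x → π x = ∫ u in Ioi 0, Real.exp (-(u * x)) ∂μ
  eq_neg : ∀ x, x < 0 → π x = ∫ u in Iio 0, Real.exp (-(u * x)) ∂μ

/-- Completely monotone jumps of the class `CM(+∞, ρ)`: `π` is represented by `μ`, there are no
negative jumps, and `0 < ρ = sup {u ≥ 0 : μ (0,u) = 0} < ∞`. -/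
structure IsCMOneSided (π : ℝ → ℝ) (μ : Measure ℝ) (ρ : ℝ) : Prop where
  mixing : IsMixingMeasure π μ
  no_negative : μ (Iio 0) = 0
  pos : 0 < ρ
  isLUB : IsLUB {u : ℝ | 0 ≤ u ∧ μ (Ioo 0 u) = 0} ρ

/-- The density of hyperexponential jumps: the representing measure has finite support. -/
def IsHyperexponential (π : ℝ → ℝ) : Prop :=
  ∃ μ : Measure ℝ, IsMixingMeasure π μ ∧ μ.support.Finite

/-- The image `μ*` of `μ` under `v ↦ 1/v`. -/
def mustar (μ : Measure ℝ) : Measure ℝ := μ.map fun v => v⁻¹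

/-- The measure `v^m μ*(dv)` (used only for `μ*` carried by `(0,∞)`). -/
def powMustar (μ : Measure ℝ) (m : ℕ) : Measure ℝ :=
  (mustar μ).withDensity fun v => ENNReal.ofReal (v ^ m)

/-- The Laplace exponent of a driftless subordinator with Lévy density `π`. -/
def subordinatorExponent (π : ℝ → ℝ) (z : ℂ) : ℂ :=
  ∫ x in Ioi (0 : ℝ), (Complex.exp (z * (x : ℂ)) - 1) * (π x : ℂ)

/-! ### Gaussian quadrature and Padé approximants -/

/-- `x` and `w` are the nodes and the weights of the Gaussian quadrature of order `n` with respect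
to `ν`: the nodes are distinct and the moments of order `0, …, 2n - 1` are matched. -/
structure IsGaussianQuadrature (ν : Measure ℝ) (n : ℕ) (x w : Fin n → ℝ) : Prop where
  injective : Function.Injective x
  moments : ∀ j, j < 2 * n → ∫ v, v ^ j ∂ν = ∑ i, x i ^ j * w i

/-- `R / S` is the `[m/n]` Padé approximant of `f` at `a`. -/
structure IsPade (f : ℂ → ℂ) (a : ℂ) (m n : ℕ) (R S : Polynomial ℂ) : Prop where
  analyticAt : AnalyticAt ℂ f a
  natDegree_num : R.natDegree ≤ m
  natDegree_den : S.natDegree ≤ n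
  den_ne_zero : S.eval a ≠ 0
  isBigO : (fun z => R.eval z / S.eval z - f z) =O[𝓝 a] fun z => (z - a) ^ (m + n + 1)

/-- Taylor terms of `ψ` of order `1, …, k` plus `z^{k+1} ∑ wᵢ / (1 - z xᵢ)`. -/
def quadratureFormula (ψ : ℂ → ℂ) (k n : ℕ) (x w : Fin n → ℝ) (z : ℂ) : ℂ :=
  ∑ j ∈ Finset.Icc 1 k, iteratedDeriv j ψ 0 * z ^ j / (j.factorial : ℂ) +
    z ^ (k + 1) * ∑ i, (w i : ℂ) / (1 - z * (x i : ℂ))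

/-- The Lévy density `1_{y > 0} ∑ wᵢ xᵢ^{-2-k} e^{-y/xᵢ}`. -/
def quadratureDensity (k n : ℕ) (x w : Fin n → ℝ) (y : ℝ) : ℝ :=
  if 0 < y then ∑ i, w i / x i ^ (2 + k) * Real.exp (-(y / x i)) else 0

end LevyPade

end

namespace LevyPade

/-! Write ν_m for the measure v^m μ*(dv). It is carried by (0, b] with b = 1/ρ, and it is finite for
m ≥ 2 because the jumps have finite variation. Integrating (e^{zx} - 1) e^{-ux} over x and then over
μ gives ψ(z) = z ∫ ν_2(dv) / (1 - zv) (`IsCMOneSided.subordinatorExponent_eq`). The right-hand side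
is analytic off [ρ, ∞) and is the continuation of ψ. The identity 1/(1 - zv) = 1 + zv/(1 - zv), used
k times, splits off the Taylor terms and leaves the remainder z^{k+1} ∫ ν_{2+k}(dv) / (1 - zv)
(`IsCMOneSided.extendedExponent_eq`).

Everything then reduces to Gaussian quadrature for ν = ν_{2+k}. A measure with more than n points in
its support has no nonzero polynomial of degree at most n vanishing almost everywhere. Hence squares
have positive integrals, and the orthogonal polynomial of degree n exists and has simple real roots,
which serve as nodes. Testing the rule on squares shows that the weights are positive and the nodes
lie in (0, b] (`IsGaussianQuadrature.weight_mul_pos`). Since 2n moments agree, replacing the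
integral by the rule costs O(z^{2n}), so the total error is O(z^{2n+k+1}). This is the Padé order,
and cross-multiplication shows that every Padé approximant equals the quadrature formula
(`IsPade.eq_formula`).

The formula is a finite sum of simple fractions, that is, the exponent of a drift, a Gaussian part
and a compound Poisson part with exponential mixtures as jumps. Its drift (k = 1) or half its
Gaussian coefficient (k = 2) is ∫ v⁻¹ dν - ∑ wᵢ/xᵢ. This is positive because Gaussian quadrature
underestimates the integral of 1/v (`IsGaussianQuadrature.sum_div_lt`). The process itself is built
as Brownian motion plus compound Poisson process plus drift, and its law is controlled by the joint
characteristic function of its increments.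

For the rate, 1/(1 - zv) is expanded in powers of v - c around a complex centre c depending on z,
chosen so that the ratio |v - c||z|/|1 - cz| is below 1 on all of [0, b] (`exists_center`). The rule
is exact for the first 2n terms, which leaves an error of order r^{2n}, and compactness makes r < 1
uniform (`exists_uniform_center`). -/

open Polynomial in
/-- A functional that is positive on squares has a monic orthogonal polynomial of degree `n`. -/
lemma exists_monic_orthogonal (L : ℝ[X] →ₗ[ℝ] ℝ) (n : ℕ)
    (hL : ∀ p : ℝ[X], p ≠ 0 → p.degree < n → L (p * p) ≠ 0) :
    ∃ N : ℝ[X], N.Monic ∧ N.natDegree = n ∧ ∀ q : ℝ[X], q.degree < n → L (N * q) = 0 := by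
  let B : degreeLT ℝ n →ₗ[ℝ] Module.Dual ℝ (degreeLT ℝ n) :=
    ((LinearMap.mul ℝ ℝ[X]).compr₂ L).compl₁₂ (degreeLT ℝ n).subtype (degreeLT ℝ n).subtype
  have hB : ∀ p q : degreeLT ℝ n, B p q = L (p.1 * q.1) := fun p q => rfl
  have hfin : Module.Finite ℝ (degreeLT ℝ n) :=
    Module.Finite.equiv (degreeLTEquiv ℝ n).symm
  have hinj : Function.Injective B := by
    rw [injective_iff_map_eq_zero]
    intro p hp
    by_contra hne
    have h1 := hB p p
    rw [hp, LinearMap.zero_apply] at h1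
    exact hL p.1 (fun h => hne (Subtype.ext h)) (mem_degreeLT.1 p.2) h1.symm
  have hsurj : Function.Surjective B :=
    (LinearMap.injective_iff_surjective_of_finrank_eq_finrank
      (Subspace.dual_finrank_eq).symm).1 hinj
  -- The nondegenerate form represents the functional `q ↦ L (X ^ n * q)` by some `p`; then `X ^ n -
  -- p` is orthogonal to all lower degrees.
  let f : Module.Dual ℝ (degreeLT ℝ n) :=
    (L ∘ₗ LinearMap.mulLeft ℝ (X ^ n : ℝ[X])) ∘ₗ (degreeLT ℝ n).subtype
  obtain ⟨p, hp⟩ := hsurj f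
  have hdeg : p.1.degree < n := mem_degreeLT.1 p.2
  have hdeg' : p.1.degree < (X ^ n : ℝ[X]).degree := by rwa [degree_X_pow]
  have hmon : (X ^ n - p.1).Monic := (monic_X_pow n).sub_of_left hdeg'
  refine ⟨X ^ n - p.1, hmon, ?_, fun q hq => ?_⟩
  · have : (X ^ n - p.1).degree = (n : WithBot ℕ) := by
      rw [degree_sub_eq_left_of_degree_lt hdeg', degree_X_pow]
    exact natDegree_eq_of_degree_eq_some this
  · have h2 := LinearMap.congr_fun hp ⟨q, mem_degreeLT.2 hq⟩
    rw [hB] at h2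
    have h3 : f ⟨q, mem_degreeLT.2 hq⟩ = L (X ^ n * q) := rfl
    rw [sub_mul, map_sub, ← h3, ← h2, sub_self]

/-! ### Orthogonal polynomials of a finite measure carried by `(0, b]` -/

section Measure

variable {ν : Measure ℝ} [IsFiniteMeasure ν] {b : ℝ}

lemma integrable_of_continuousOn_Icc {E : Type*} [NormedAddCommGroup E]
    (hb : ∀ᵐ v ∂ν, v ∈ Ioc 0 b)
    {f : ℝ → E} (hf : ContinuousOn f (Icc 0 b)) : Integrable f ν := by
  have h1 : ν.restrict (Icc 0 b) = ν :=
    Measure.restrict_eq_self_of_ae_mem (hb.mono fun v hv => Ioc_subset_Icc_self hv)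
  rw [← h1]
  exact hf.integrableOn_compact isCompact_Icc

lemma integrable_polynomial (hb : ∀ᵐ v ∂ν, v ∈ Ioc 0 b) (p : Polynomial ℝ) :
    Integrable (fun v => p.eval v) ν :=
  integrable_of_continuousOn_Icc hb p.continuous.continuousOn

/-- The source of all positivity below. A vanishing integral of a nonnegative function would force
`q * r` to vanish almost everywhere. Only the degree of `q * r` matters, so the integrand `q * r ^
2` itself may have degree beyond `n`. -/
lemma integral_mul_sq_pos (hb : ∀ᵐ v ∂ν, v ∈ Ioc 0 b) {n : ℕ}
    (hn : ∀ p : Polynomial ℝ, p ≠ 0 → p.natDegree ≤ n → ¬ ∀ᵐ v ∂ν, p.eval v = 0)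
    {q r : Polynomial ℝ} (hq : ∀ᵐ v ∂ν, 0 ≤ q.eval v) (hne : q * r ≠ 0)
    (hdeg : (q * r).natDegree ≤ n) : 0 < ∫ v, (q * (r * r)).eval v ∂ν := by
  have hnn : 0 ≤ᵐ[ν] fun v => (q * (r * r)).eval v := by
    filter_upwards [hq] with v hv
    simp only [Polynomial.eval_mul, Pi.zero_apply]
    exact mul_nonneg hv (mul_self_nonneg _)
  refine lt_of_le_of_ne (integral_nonneg_of_ae hnn) fun h0 => hn _ hne hdeg ?_
  have h1 := (integral_eq_zero_iff_of_nonneg_ae hnn (integrable_polynomial hb _)).1 h0.symm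
  filter_upwards [h1] with v hv
  simp only [Polynomial.eval_mul, Pi.zero_apply] at hv ⊢
  rcases mul_eq_zero.1 hv with h | h
  · simp [h]
  · simp [mul_self_eq_zero.1 h]

lemma exists_orthogonal_polynomial (hb : ∀ᵐ v ∂ν, v ∈ Ioc 0 b) {n : ℕ}
    (hn : ∀ p : Polynomial ℝ, p ≠ 0 → p.natDegree ≤ n → ¬ ∀ᵐ v ∂ν, p.eval v = 0) :
    ∃ N : Polynomial ℝ, N.Monic ∧ N.natDegree = n ∧
      ∀ q : Polynomial ℝ, q.degree < n → ∫ v, (N * q).eval v ∂ν = 0 := by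
  let L : Polynomial ℝ →ₗ[ℝ] ℝ :=
    { toFun := fun p => ∫ v, p.eval v ∂ν
      map_add' := fun p q => by
        simp only [Polynomial.eval_add]
        exact integral_add (integrable_polynomial hb p) (integrable_polynomial hb q)
      map_smul' := fun c p => by
        simp only [Polynomial.eval_smul, RingHom.id_apply]
        exact integral_smul c _ }
  obtain ⟨N, h1, h2, h3⟩ := exists_monic_orthogonal L n (fun p hp hd => by
    have h := integral_mul_sq_pos hb hn (q := 1) (r := p) (by simp) (by simpa using hp)
      (by rw [one_mul]; exact Polynomial.natDegree_le_of_degree_le hd.le)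
    rw [one_mul] at h
    exact h.ne')
  exact ⟨N, h1, h2, h3⟩

/-- A nonnegative quadratic does not divide an orthogonal polynomial. -/
lemma not_quadratic_dvd_orthogonal (hb : ∀ᵐ v ∂ν, v ∈ Ioc 0 b) {n : ℕ}
    (hn : ∀ p : Polynomial ℝ, p ≠ 0 → p.natDegree ≤ n → ¬ ∀ᵐ v ∂ν, p.eval v = 0)
    {N : Polynomial ℝ} (hN : N ≠ 0) (hd : N.natDegree = n)
    (horth : ∀ q : Polynomial ℝ, q.degree < n → ∫ v, (N * q).eval v ∂ν = 0)
    {q : Polynomial ℝ} (hq : ∀ v, 0 ≤ q.eval v) (hq1 : 0 < q.natDegree) : ¬ q ∣ N := by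
  rintro ⟨M, rfl⟩
  have hM : M ≠ 0 := right_ne_zero_of_mul hN
  have hq0 : q ≠ 0 := left_ne_zero_of_mul hN
  -- With `N = q * M` the integral of `N * M = q * M ^ 2` is positive, yet orthogonality makes it
  -- zero, as `M` has smaller degree than `N`.
  have h1 := integral_mul_sq_pos hb hn (q := q) (r := M) (by simp [hq]) hN hd.le
  have h2 := horth M (by
    rw [Polynomial.degree_eq_natDegree hM]
    rw [Polynomial.natDegree_mul hq0 hM] at hd
    exact_mod_cast (by omega : M.natDegree < n))
  rw [mul_assoc] at h2
  exact h1.ne' h2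

open Polynomial in
/-- An orthogonal polynomial has simple real roots. -/
lemma card_roots_orthogonal (hb : ∀ᵐ v ∂ν, v ∈ Ioc 0 b) {n : ℕ}
    (hn : ∀ p : Polynomial ℝ, p ≠ 0 → p.natDegree ≤ n → ¬ ∀ᵐ v ∂ν, p.eval v = 0)
    {N : Polynomial ℝ} (hN : N.Monic) (hd : N.natDegree = n)
    (horth : ∀ q : Polynomial ℝ, q.degree < n → ∫ v, (N * q).eval v ∂ν = 0) :
    N.roots.toFinset.card = n := by
  have hnd : N.roots.Nodup := by
    rw [Multiset.nodup_iff_count_le_one]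
    intro r
    rw [count_roots]
    by_contra! h
    refine not_quadratic_dvd_orthogonal hb hn hN.ne_zero hd horth (q := (X - C r) ^ 2)
      (fun v => ?_) ?_ ((le_rootMultiplicity_iff hN.ne_zero).1 h)
    · simp only [eval_pow]; positivity
    · simp
  have hs : N.Splits := by
    rw [splits_iff_card_roots]
    by_contra hne
    have hlt : N.roots.card < N.natDegree := lt_of_le_of_ne (card_roots' N) hne
    -- Since `r` collects all real roots with multiplicity, the cofactor `q` has none. If it is not
    -- constant it has a nonreal root, and the real quadratic of that conjugate pair is nonnegative
    -- and divides `N`.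
    let r : ℝ[X] := (N.roots.map fun a => X - C a).prod
    obtain ⟨q, hq⟩ : r ∣ N := prod_multiset_X_sub_C_dvd N
    have hr : r.Monic := monic_multiset_prod_of_monic _ _ fun a _ => monic_X_sub_C a
    have hrdeg : r.natDegree = N.roots.card := natDegree_multiset_prod_X_sub_C_eq_card _
    have hq0 : q ≠ 0 := fun h => hN.ne_zero (by rw [hq, h, mul_zero])
    have hqdeg : 0 < q.natDegree := by
      have := congrArg natDegree hq
      rw [natDegree_mul hr.ne_zero hq0] at this
      omega
    have hdegC : (q.map (algebraMap ℝ ℂ)).degree ≠ 0 := by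
      rw [degree_map]
      exact (natDegree_pos_iff_degree_pos.1 hqdeg).ne'
    obtain ⟨z, hz⟩ := Complex.exists_root (f := q.map (algebraMap ℝ ℂ))
      (by rw [degree_map]; exact natDegree_pos_iff_degree_pos.1 hqdeg)
    have hz' : aeval z q = 0 := by rwa [IsRoot, eval_map_algebraMap] at hz
    by_cases him : z.im = 0
    · have hzr : q.IsRoot z.re := by
        have hz2 : z = (algebraMap ℝ ℂ) z.re := by
          apply Complex.ext <;> simp [him]
        rw [hz2, aeval_algebraMap_apply] at hz'
        simpa using hz'
      have : (X - C z.re) ∣ q := dvd_iff_isRoot.2 hzr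
      have h2 : r.roots = N.roots := roots_multiset_prod_X_sub_C _
      have h3 : N.roots = N.roots + q.roots := by
        conv_lhs => rw [hq, roots_mul (hq ▸ hN.ne_zero), h2]
      have h4 : q.roots = 0 := by simpa using h3.symm
      have h5 : z.re ∈ q.roots := (mem_roots hq0).2 hzr
      simp [h4] at h5
    · have h6 := q.mul_star_dvd_of_aeval_eq_zero_im_ne_zero hz' him
      have h7 := q.quadratic_dvd_of_aeval_eq_zero_im_ne_zero hz' him
      refine not_quadratic_dvd_orthogonal hb hn hN.ne_zero hd horth (fun v => ?_) ?_
        (h7.trans (Dvd.intro_left r hq.symm))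
      · have hnorm : ‖z‖ ^ 2 = z.re ^ 2 + z.im ^ 2 := by
          rw [Complex.sq_norm, Complex.normSq_apply]; ring
        simp only [eval_add, eval_sub, eval_pow, eval_X, eval_mul, eval_C, hnorm]
        nlinarith [sq_nonneg (v - z.re), sq_nonneg z.im]
      · have : (X ^ 2 - C (2 * z.re) * X + C (‖z‖ ^ 2) : ℝ[X]).natDegree = 2 := by
          compute_degree!
        omega
  rw [Multiset.toFinset_card_of_nodup hnd, splits_iff_card_roots.1 hs, hd]

end Measure

/-! ### Gaussian quadrature: existence, positivity, one-sided error -/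

section Quadrature

variable {ν : Measure ℝ} [IsFiniteMeasure ν] {b : ℝ} {n : ℕ} {x w : Fin n → ℝ}

/-- Linearity in the moments. Real coefficients serve the positivity arguments, complex ones the
expansion of the resolvent. -/
lemma IsGaussianQuadrature.integral_eval (hb : ∀ᵐ v ∂ν, v ∈ Ioc 0 b)
    (hq : IsGaussianQuadrature ν n x w) {𝕜 : Type*} [RCLike 𝕜] (p : Polynomial 𝕜)
    (hp : p.natDegree < 2 * n) :
    ∫ v, p.eval ((v : ℝ) : 𝕜) ∂ν = ∑ i, p.eval ((x i : ℝ) : 𝕜) * ((w i : ℝ) : 𝕜) := by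
  simp_rw [Polynomial.eval_eq_sum_range' hp, Finset.sum_mul]
  rw [integral_finsetSum, Finset.sum_comm]
  · refine Finset.sum_congr rfl fun j hj => ?_
    rw [integral_const_mul]
    have h := hq.moments j (Finset.mem_range.1 hj)
    simp_rw [← RCLike.ofReal_pow, integral_ofReal, h, mul_assoc, ← Finset.mul_sum]
    push_cast
    rfl
  · intro j _
    refine integrable_of_continuousOn_Icc hb (Continuous.continuousOn ?_)
    have := RCLike.continuous_ofReal (K := 𝕜)
    fun_prop

lemma IsGaussianQuadrature.integral_eval_real (hb : ∀ᵐ v ∂ν, v ∈ Ioc 0 b)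
    (hq : IsGaussianQuadrature ν n x w) (p : Polynomial ℝ) (hp : p.natDegree < 2 * n) :
    ∫ v, p.eval v ∂ν = ∑ i, p.eval (x i) * w i := hq.integral_eval hb (𝕜 := ℝ) p hp

/-- The nodes are the roots of the orthogonal polynomial `N` and the weights are the integrals of
the Lagrange basis. Divide a monomial of degree below `2n` by `N`: the quotient has degree below `n`
and its contribution dies by orthogonality, while the remainder agrees with the monomial at the
nodes and is recovered by interpolation. -/
lemma exists_gaussianQuadrature (hb : ∀ᵐ v ∂ν, v ∈ Ioc 0 b)
    (hn : ∀ p : Polynomial ℝ, p ≠ 0 → p.natDegree ≤ n → ¬ ∀ᵐ v ∂ν, p.eval v = 0) :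
    ∃ x w : Fin n → ℝ, IsGaussianQuadrature ν n x w := by
  obtain ⟨N, hN, hd, horth⟩ := exists_orthogonal_polynomial hb hn
  have hcard := card_roots_orthogonal hb hn hN hd horth
  let e := Finset.equivFinOfCardEq hcard
  let x : Fin n → ℝ := fun i => (e.symm i).1
  have hx : Function.Injective x := fun i j h => e.symm.injective (Subtype.ext h)
  have hroot : ∀ i, N.eval (x i) = 0 := fun i => by
    have := (e.symm i).2
    rw [Multiset.mem_toFinset] at this
    exact (Polynomial.mem_roots'.1 this).2
  refine ⟨x, fun i => ∫ v, (Lagrange.basis Finset.univ x i).eval v ∂ν, hx, fun j hj => ?_⟩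
  set p : Polynomial ℝ := Polynomial.X ^ j with hp
  have hdiv := Polynomial.modByMonic_add_div p N
  have hr : (p %ₘ N).degree < n := by
    have := Polynomial.degree_modByMonic_lt p hN
    rwa [Polynomial.degree_eq_natDegree hN.ne_zero, hd] at this
  have hqd : (p /ₘ N).degree < n := by
    refine Polynomial.degree_lt_degree (q := Polynomial.X ^ n) ?_ |>.trans_le ?_
    · rw [Polynomial.natDegree_divByMonic p hN, hp, Polynomial.natDegree_X_pow,
        Polynomial.natDegree_X_pow, hd]
      omega
    · rw [Polynomial.degree_X_pow]
  have hlag := Lagrange.eq_interpolate (s := Finset.univ) (v := x) (f := p %ₘ N) hx.injOn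
    (by simpa using hr)
  have hval : ∀ i, (p %ₘ N).eval (x i) = x i ^ j := fun i => by
    have := congrArg (Polynomial.eval (x i)) hdiv
    rw [Polynomial.eval_add, Polynomial.eval_mul, hroot, zero_mul, add_zero] at this
    rw [this, hp]; simp
  calc ∫ v, v ^ j ∂ν = ∫ v, ((p %ₘ N).eval v + (N * (p /ₘ N)).eval v) ∂ν := by
        congr 1; ext v
        rw [← Polynomial.eval_add, hdiv, hp]; simp
    _ = ∫ v, (p %ₘ N).eval v ∂ν := by
        rw [integral_add (integrable_polynomial hb _) (integrable_polynomial hb _),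
          horth _ hqd, add_zero]
    _ = ∫ v, ∑ i, x i ^ j * (Lagrange.basis Finset.univ x i).eval v ∂ν := by
        congr 1; ext v
        rw [hlag, Lagrange.interpolate_apply, Polynomial.eval_finsetSum]
        refine Finset.sum_congr rfl fun i _ => ?_
        rw [Polynomial.eval_mul, Polynomial.eval_C, hval]
    _ = _ := by
        rw [integral_finsetSum _ fun i _ => (integrable_polynomial hb _).const_mul _]
        simp_rw [integral_const_mul]

/-- The polynomial that vanishes at all nodes but one. -/
lemma eval_nodal_erase_sum {f : ℝ → ℝ} (i : Fin n) :
    ∑ j, f (x j) * ((Lagrange.nodal (Finset.univ.erase i) x).eval (x j)) ^ 2 * w j =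
      f (x i) * ((Lagrange.nodal (Finset.univ.erase i) x).eval (x i)) ^ 2 * w i := by
  refine Finset.sum_eq_single i (fun j _ hj => ?_) (fun h => absurd (Finset.mem_univ i) h)
  rw [Lagrange.eval_nodal_at_node (Finset.mem_erase.2 ⟨hj, Finset.mem_univ j⟩)]
  ring

lemma natDegree_nodal_erase (i : Fin n) :
    (Lagrange.nodal (Finset.univ.erase i) x).natDegree = n - 1 := by
  rw [Lagrange.natDegree_nodal, Finset.card_erase_of_mem (Finset.mem_univ i), Finset.card_univ,
    Fintype.card_fin]

section

variable (hb : ∀ᵐ v ∂ν, v ∈ Ioc 0 b)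
  (hn : ∀ p : Polynomial ℝ, p ≠ 0 → p.natDegree ≤ n → ¬ ∀ᵐ v ∂ν, p.eval v = 0)
  (hq : IsGaussianQuadrature ν n x w)

include hb hn hq

/-- Apply the rule to `q * M ^ 2`, where `M` vanishes at every node except `x i`. The degree is at
most `2n - 1`, so the positive integral equals the single surviving term. The choices `1`, `X` and
`b - X` of `q` locate weights and nodes. -/
lemma IsGaussianQuadrature.weight_mul_pos (q : Polynomial ℝ) (hq0 : q ≠ 0)
    (hqd : q.natDegree ≤ 1)
    (hqv : ∀ᵐ v ∂ν, 0 ≤ q.eval v) (i : Fin n) :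
    0 < q.eval (x i) * w i := by
  have hi : 0 < n := i.pos
  set M := Lagrange.nodal (Finset.univ.erase i) x with hM
  have hM0 : M ≠ 0 := Lagrange.nodal_ne_zero
  have h1 := integral_mul_sq_pos hb hn hqv (r := M) (mul_ne_zero hq0 hM0)
    (by rw [Polynomial.natDegree_mul hq0 hM0, natDegree_nodal_erase]; omega)
  have h2 := hq.integral_eval_real hb (q * (M * M)) (by
    rw [Polynomial.natDegree_mul hq0 (mul_ne_zero hM0 hM0), Polynomial.natDegree_mul hM0 hM0,
      natDegree_nodal_erase]; omega)
  have h3 := eval_nodal_erase_sum (x := x) (w := w) (f := fun v => q.eval v) i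
  rw [h2] at h1
  have h4 : ∑ j, (q * (M * M)).eval (x j) * w j = q.eval (x i) * M.eval (x i) ^ 2 * w i := by
    rw [← h3]
    refine Finset.sum_congr rfl fun j _ => ?_
    simp only [Polynomial.eval_mul]; ring
  rw [h4] at h1
  by_contra hcon
  push Not at hcon
  nlinarith [sq_nonneg (M.eval (x i))]

lemma IsGaussianQuadrature.weight_pos (i : Fin n) : 0 < w i := by
  simpa using hq.weight_mul_pos hb hn 1 one_ne_zero (by simp) (by simp) i

lemma IsGaussianQuadrature.node_pos (i : Fin n) : 0 < x i := by
  have h := hq.weight_mul_pos hb hn Polynomial.X Polynomial.X_ne_zero (by simp)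
    (by simpa using hb.mono fun v hv => hv.1.le) i
  rw [Polynomial.eval_X] at h
  exact pos_of_mul_pos_left h (hq.weight_pos hb hn i).le

lemma IsGaussianQuadrature.node_le (i : Fin n) : x i ≤ b := by
  have hX : (Polynomial.C b - Polynomial.X : Polynomial ℝ) ≠ 0 := by
    rw [← neg_ne_zero, neg_sub]; exact Polynomial.X_sub_C_ne_zero b
  have h := hq.weight_mul_pos hb hn (Polynomial.C b - Polynomial.X) hX
    (by compute_degree) (by simpa using hb.mono fun v hv => hv.2) i
  have := pos_of_mul_pos_left h (hq.weight_pos hb hn i).le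
  simp at this
  exact this.le

/-- The quadrature underestimates the integral of `1 / v`. -/
lemma IsGaussianQuadrature.sum_div_lt (hi : Integrable (fun v => v⁻¹) ν) :
    ∑ i, w i / x i < ∫ v, v⁻¹ ∂ν := by
  -- For `n = 0` no polynomial has degree below `2n`, so exactness is unavailable and the claim is
  -- just positivity of the integral.
  rcases Nat.eq_zero_or_pos n with rfl | hnpos
  · have h1 : 0 ≤ᵐ[ν] fun v => v⁻¹ := hb.mono fun v hv => inv_nonneg.2 hv.1.le
    simp only [Finset.univ_eq_empty, Finset.sum_empty]
    refine lt_of_le_of_ne (integral_nonneg_of_ae h1) fun h0 => hn 1 one_ne_zero (by simp) ?_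
    filter_upwards [(integral_eq_zero_iff_of_nonneg_ae h1 hi).1 h0.symm, hb] with v hv hv'
    exact absurd hv (inv_pos.2 hv'.1).ne'
  set N := Lagrange.nodal Finset.univ x with hN
  have hN0 : N ≠ 0 := Lagrange.nodal_ne_zero
  have hNd : N.natDegree = n := by rw [hN, Lagrange.natDegree_nodal]; simp
  have hx := hq.node_pos hb hn
  have hc : N.eval 0 ≠ 0 := by
    rw [hN, Lagrange.eval_nodal]
    exact Finset.prod_ne_zero_iff.2 fun i _ => by have := hx i; simp [this.ne']
  set c := (N.eval 0) ^ 2 with hcdef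
  have hcpos : 0 < c := by positivity
  -- With `c = N(0)²` one has `c / v = q(v) + N(v)² / v`, where `q` has degree below `2n`. The rule
  -- is exact for `q` and sees nothing of the last term, which vanishes at the nodes but has
  -- positive integral.
  obtain ⟨q, hq'⟩ : Polynomial.X ∣ Polynomial.C c - N * N := by
    rw [Polynomial.X_dvd_iff, Polynomial.coeff_zero_eq_eval_zero]
    simp [hcdef, sq]
  have hqd : q.natDegree < 2 * n := by
    rcases eq_or_ne q 0 with rfl | hq0
    · simp; omega
    have h1 : (Polynomial.C c - N * N).natDegree ≤ 2 * n := by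
      refine (Polynomial.natDegree_sub_le _ _).trans ?_
      rw [Polynomial.natDegree_mul hN0 hN0, hNd]; simp; omega
    rw [hq', Polynomial.natDegree_mul Polynomial.X_ne_zero hq0, Polynomial.natDegree_X] at h1
    omega
  have hid : ∀ v, 0 < v → c * v⁻¹ = q.eval v + (N.eval v) ^ 2 * v⁻¹ := fun v hv => by
    have := congrArg (Polynomial.eval v) hq'
    simp only [Polynomial.eval_sub, Polynomial.eval_C, Polynomial.eval_mul,
      Polynomial.eval_X] at this
    field_simp
    linarith
  have hnode : ∀ i, N.eval (x i) = 0 := fun i => Lagrange.eval_nodal_at_node (Finset.mem_univ i)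
  have hsum : c * ∑ i, w i / x i = ∫ v, q.eval v ∂ν := by
    rw [hq.integral_eval_real hb q hqd, Finset.mul_sum]
    refine Finset.sum_congr rfl fun i _ => ?_
    have := hid (x i) (hx i)
    rw [hnode] at this
    rw [div_eq_mul_inv]
    linear_combination w i * this
  have hint : Integrable (fun v => (N.eval v) ^ 2 * v⁻¹) ν := by
    refine ((hi.const_mul c).sub (integrable_polynomial hb q)).congr ?_
    filter_upwards [hb] with v hv
    simp only [Pi.sub_apply]
    linarith [hid v hv.1]
  have hint2 : c * ∫ v, v⁻¹ ∂ν = ∫ v, q.eval v ∂ν + ∫ v, (N.eval v) ^ 2 * v⁻¹ ∂ν := by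
    rw [← integral_const_mul, ← integral_add (integrable_polynomial hb q) hint]
    exact integral_congr_ae (hb.mono fun v hv => hid v hv.1)
  have hnn : 0 ≤ᵐ[ν] fun v => (N.eval v) ^ 2 * v⁻¹ :=
    hb.mono fun v hv => mul_nonneg (sq_nonneg _) (inv_nonneg.2 hv.1.le)
  have hpos : 0 < ∫ v, (N.eval v) ^ 2 * v⁻¹ ∂ν := by
    refine lt_of_le_of_ne (integral_nonneg_of_ae hnn) fun h0 => hn N hN0 hNd.le ?_
    filter_upwards [(integral_eq_zero_iff_of_nonneg_ae hnn hint).1 h0.symm, hb] with v hv hv'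
    rcases mul_eq_zero.1 hv with h | h
    · exact pow_eq_zero_iff (two_ne_zero) |>.1 h
    · exact absurd h (inv_pos.2 hv'.1).ne'
  have : c * ∑ i, w i / x i < c * ∫ v, v⁻¹ ∂ν := by rw [hsum, hint2]; linarith
  exact lt_of_mul_lt_mul_left this hcpos.le

end

end Quadrature

/-! ### Padé approximants of the form `T + z ^ (k + 1) ∑ wᵢ / (1 - z xᵢ)` -/

section Pade

open Polynomial

/-- A nonzero `p` has a zero at the origin of exact order `m < N`; after division by `z ^ m` the
cofactor would tend both to zero and to a nonzero value. -/
lemma polynomial_eq_zero_of_isBigO {p : ℂ[X]} {N : ℕ} (hp : p.natDegree < N)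
    (h : (fun z => p.eval z) =O[𝓝 0] fun z : ℂ => z ^ N) : p = 0 := by
  by_contra hne
  obtain ⟨q, hq, hnd⟩ := exists_eq_pow_rootMultiplicity_mul_and_not_dvd p hne 0
  set m := p.rootMultiplicity 0 with hm
  rw [C_0, sub_zero] at hq hnd
  have hq0 : q.eval 0 ≠ 0 := by
    rwa [X_dvd_iff, coeff_zero_eq_eval_zero] at hnd
  have hmN : m < N := by
    have h0 := natDegree_le_of_dvd (Dvd.intro q hq.symm) hne
    rw [natDegree_X_pow] at h0
    omega
  have h1 : (fun z : ℂ => z ^ m * q.eval z) =O[𝓝[≠] 0] fun z : ℂ => z ^ m * z ^ (N - m) := by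
    refine (h.mono nhdsWithin_le_nhds).congr (fun z => ?_) fun z => ?_
    · rw [hq]; simp
    · rw [← pow_add]; congr 1; omega
  have h2 : (fun z : ℂ => q.eval z) =O[𝓝[≠] 0] fun z : ℂ => z ^ (N - m) := by
    have h3 := (Asymptotics.isBigO_refl (fun z : ℂ => (z ^ m)⁻¹) (𝓝[≠] 0)).mul h1
    refine h3.congr' ?_ ?_
    · filter_upwards [self_mem_nhdsWithin] with z hz
      rw [inv_mul_cancel_left₀ (pow_ne_zero _ hz)]
    · filter_upwards [self_mem_nhdsWithin] with z hz
      rw [inv_mul_cancel_left₀ (pow_ne_zero _ hz)]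
  have h4 : Tendsto (fun z : ℂ => z ^ (N - m)) (𝓝[≠] 0) (𝓝 0) := by
    have : ContinuousAt (fun z : ℂ => z ^ (N - m)) 0 := by fun_prop
    have h5 := this.tendsto.mono_left (nhdsWithin_le_nhds (s := {0}ᶜ))
    rwa [zero_pow (by omega)] at h5
  have h6 : Tendsto (fun z : ℂ => q.eval z) (𝓝[≠] 0) (𝓝 (q.eval 0)) :=
    q.continuous.continuousAt.tendsto.mono_left nhdsWithin_le_nhds
  exact hq0 (tendsto_nhds_unique h6 (h2.trans_tendsto h4))

variable {k n : ℕ} {x w : Fin n → ℝ}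

/-- The denominator `∏ (1 - xᵢ z)`. -/
noncomputable def padeDen (s : Finset (Fin n)) (x : Fin n → ℝ) : ℂ[X] := ∏ i ∈ s, (1 - C (x i : ℂ) * X)

/-- The numerator that belongs to the denominator `padeDen`. -/
noncomputable def padeNum (T : ℂ[X]) (k : ℕ) (x w : Fin n → ℝ) : ℂ[X] :=
  T * padeDen Finset.univ x +
    X ^ (k + 1) * ∑ i, C (w i : ℂ) * padeDen (Finset.univ.erase i) x

lemma eval_padeDen (s : Finset (Fin n)) (z : ℂ) :
    (padeDen s x).eval z = ∏ i ∈ s, (1 - z * x i) := by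
  simp only [padeDen, eval_prod, eval_sub, eval_one, eval_mul, eval_C, eval_X, mul_comm]

lemma natDegree_padeDen_le (s : Finset (Fin n)) : (padeDen s x).natDegree ≤ s.card := by
  refine (natDegree_prod_le _ _).trans ?_
  rw [Finset.card_eq_sum_ones]
  exact Finset.sum_le_sum fun i _ => by compute_degree

lemma natDegree_padeNum_le {T : ℂ[X]} (hT : T.natDegree ≤ k) :
    (padeNum T k x w).natDegree ≤ n + k := by
  refine natDegree_add_le_of_degree_le ?_ ?_
  · refine natDegree_mul_le.trans ?_
    have := natDegree_padeDen_le (x := x) Finset.univ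
    simp at this
    omega
  -- The degree count `(k + 1) + (n - 1)` needs `n ≥ 1`; for `n = 0` the sum is empty.
  · rcases n with _ | n
    · simp
    refine natDegree_mul_le.trans ?_
    have : (∑ i, C (w i : ℂ) * padeDen (Finset.univ.erase i) x).natDegree ≤ n := by
      refine natDegree_sum_le_of_forall_le _ _ fun i _ => ?_
      refine (natDegree_C_mul_le _ _).trans ((natDegree_padeDen_le _).trans ?_)
      simp
    simp only [natDegree_X_pow]
    omega

lemma eval_padeNum_eq {T : ℂ[X]} {z : ℂ} (hz : ∀ i, 1 - z * x i ≠ 0) :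
    (padeNum T k x w).eval z = (T.eval z + z ^ (k + 1) * ∑ i, (w i : ℂ) / (1 - z * x i)) *
      (padeDen Finset.univ x).eval z := by
  simp only [padeNum, eval_add, eval_mul, eval_pow, eval_X, eval_finsetSum, eval_C, add_mul,
    Finset.sum_mul, mul_assoc]
  congr 2
  refine Finset.sum_congr rfl fun i hi => ?_
  rw [eval_padeDen, eval_padeDen, ← Finset.mul_prod_erase _ _ hi]
  field_simp [hz i]

lemma eventually_one_sub_ne_zero (x : Fin n → ℝ) : ∀ᶠ z : ℂ in 𝓝 0, ∀ i, 1 - z * x i ≠ 0 := by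
  rw [eventually_all]
  intro i
  have : ContinuousAt (fun z : ℂ => 1 - z * x i) 0 := by fun_prop
  exact this.eventually_ne (by simp)

lemma isPade_padeNum {f : ℂ → ℂ} (hf : AnalyticAt ℂ f 0) {T : ℂ[X]} (hT : T.natDegree ≤ k)
    (hO : (fun z => T.eval z + z ^ (k + 1) * ∑ i, (w i : ℂ) / (1 - z * x i) - f z) =O[𝓝 0]
      fun z : ℂ => z ^ (n + k + n + 1)) :
    IsPade f 0 (n + k) n (padeNum T k x w) (padeDen Finset.univ x) where
  analyticAt := hf
  natDegree_num := natDegree_padeNum_le hT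
  natDegree_den := by simpa using natDegree_padeDen_le (x := x) Finset.univ
  den_ne_zero := by simp [eval_padeDen]
  isBigO := by
    refine hO.congr' ?_ (by simp)
    filter_upwards [eventually_one_sub_ne_zero x] with z hz
    rw [eval_padeNum_eq hz, mul_div_cancel_right₀]
    rw [eval_padeDen]
    exact Finset.prod_ne_zero_iff.2 fun i _ => hz i

/-- Two approximants `R / S` and `P / Q` give `R * Q - P * S` of degree at most `2n + k` vanishing
to order `2n + k + 1`, hence zero. Nonzero weights keep `P` from vanishing at the `n` distinct zeros
of `Q`, so `S` must vanish there. As `S` has degree at most `n`, it has no further zeros, and no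
spurious common factor of `R` and `S` can hide a pole. -/
lemma IsPade.eq_formula {f : ℂ → ℂ} (hx : Function.Injective x) (hx0 : ∀ i, x i ≠ 0)
    (hw : ∀ i, w i ≠ 0) {T : ℂ[X]} (hT : T.natDegree ≤ k)
    (hO : (fun z => T.eval z + z ^ (k + 1) * ∑ i, (w i : ℂ) / (1 - z * x i) - f z) =O[𝓝 0]
      fun z : ℂ => z ^ (n + k + n + 1))
    {R S : ℂ[X]} (h : IsPade f 0 (n + k) n R S) :
    (∀ z, S.eval z = 0 ↔ ∃ i, z = (x i : ℂ)⁻¹) ∧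
    ∀ z, S.eval z ≠ 0 →
      R.eval z / S.eval z = T.eval z + z ^ (k + 1) * ∑ i, (w i : ℂ) / (1 - z * x i) := by
  set Q := padeDen Finset.univ x with hQ
  set P := padeNum T k x w with hP
  have hPQ := isPade_padeNum h.analyticAt hT hO
  rw [← hQ, ← hP] at hPQ
  have hS0 : S ≠ 0 := fun h0 => h.den_ne_zero (by simp [h0])
  have hcross : R * Q = P * S := by
    rw [← sub_eq_zero]
    refine polynomial_eq_zero_of_isBigO (N := n + k + n + 1) ?_ ?_
    · refine (natDegree_sub_le _ _).trans_lt (Nat.lt_succ_of_le (max_le ?_ ?_))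
      · exact natDegree_mul_le.trans (add_le_add h.natDegree_num hPQ.natDegree_den)
      · exact natDegree_mul_le.trans (add_le_add hPQ.natDegree_num h.natDegree_den)
    · have h1 := h.isBigO.sub hPQ.isBigO
      simp only [sub_zero, sub_sub_sub_cancel_right] at h1
      have h2 : (fun z => Q.eval z * S.eval z) =O[𝓝 0] fun _ => (1 : ℂ) :=
        (Q.continuous.mul S.continuous).continuousAt.tendsto.isBigO_one ℂ
      have h3 := h1.mul h2
      refine h3.congr' ?_ (by simp)
      filter_upwards [S.continuous.continuousAt.eventually_ne h.den_ne_zero,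
        Q.continuous.continuousAt.eventually_ne hPQ.den_ne_zero] with z hz1 hz2
      simp only [eval_sub, eval_mul]
      field_simp
  have hroot : ∀ i, S.eval (x i : ℂ)⁻¹ = 0 := fun i => by
    have hxi : (x i : ℂ) ≠ 0 := by exact_mod_cast hx0 i
    have h1 := congrArg (eval (x i : ℂ)⁻¹) hcross
    rw [eval_mul, eval_mul, hQ, eval_padeDen,
      Finset.prod_eq_zero (Finset.mem_univ i) (by simp [hxi]), mul_zero] at h1
    refine (mul_eq_zero.1 h1.symm).resolve_left ?_
    -- At `1 / xᵢ` every term of the numerator contains the factor `1 - xᵢ z` except the one with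
    -- weight `wᵢ`.
    rw [hP, padeNum, eval_add, eval_mul, eval_padeDen,
      Finset.prod_eq_zero (Finset.mem_univ i) (by simp [hxi]), mul_zero, zero_add, eval_mul,
      eval_pow, eval_X, eval_finsetSum, Finset.sum_eq_single i]
    · rw [eval_mul, eval_C, eval_padeDen]
      refine mul_ne_zero (pow_ne_zero _ (inv_ne_zero hxi)) (mul_ne_zero (by exact_mod_cast hw i)
        (Finset.prod_ne_zero_iff.2 fun j hj => ?_))
      rw [sub_ne_zero]
      intro h2
      have h3 : (x i : ℂ) = x j := by
        field_simp at h2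
        exact h2
      exact (Finset.mem_erase.1 hj).1 (hx (by exact_mod_cast h3)).symm
    · intro j _ hj
      rw [eval_mul, eval_padeDen, Finset.prod_eq_zero (i := i)
        (Finset.mem_erase.2 ⟨hj.symm, Finset.mem_univ i⟩) (by simp [hxi]), mul_zero]
    · exact fun h => absurd (Finset.mem_univ i) h
  have hiff : ∀ z, S.eval z = 0 ↔ ∃ i, z = (x i : ℂ)⁻¹ := by
    intro z
    refine ⟨fun hz => ?_, fun ⟨i, hi⟩ => hi ▸ hroot i⟩
    have hinj : Function.Injective fun i => (x i : ℂ)⁻¹ := fun i j hij =>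
      hx (by exact_mod_cast inv_injective hij)
    have hsub : Finset.univ.image (fun i => (x i : ℂ)⁻¹) ⊆ S.roots.toFinset := by
      intro y hy
      obtain ⟨i, -, rfl⟩ := Finset.mem_image.1 hy
      rw [Multiset.mem_toFinset, mem_roots hS0]
      exact hroot i
    have hcard : S.roots.toFinset.card ≤ (Finset.univ.image (fun i => (x i : ℂ)⁻¹)).card := by
      rw [Finset.card_image_of_injective _ hinj, Finset.card_univ, Fintype.card_fin]
      exact (Multiset.toFinset_card_le _).trans ((card_roots' S).trans h.natDegree_den)
    have heq := Finset.eq_of_subset_of_card_le hsub hcard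
    have hzm : z ∈ S.roots.toFinset := by
      rw [Multiset.mem_toFinset, mem_roots hS0]; exact hz
    rw [← heq] at hzm
    obtain ⟨i, -, hi⟩ := Finset.mem_image.1 hzm
    exact ⟨i, hi.symm⟩
  refine ⟨hiff, fun z hz => ?_⟩
  have hz' : ∀ i, 1 - z * x i ≠ 0 := fun i h0 => hz ((hiff z).2 ⟨i, by
    have : z * x i = 1 := by linear_combination -h0
    exact eq_inv_of_mul_eq_one_left this⟩)
  have hQz : Q.eval z ≠ 0 := by
    rw [hQ, eval_padeDen]; exact Finset.prod_ne_zero_iff.2 fun i _ => hz' i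
  have h1 := congrArg (eval z) hcross
  rw [eval_mul, eval_mul, hP, eval_padeNum_eq hz', ← hQ] at h1
  rw [div_eq_iff hz]
  refine mul_right_cancel₀ hQz ?_
  rw [h1]; ring

end Pade

/-! ### Stieltjes transforms -/

/-- The transform `∫ 1 / (1 - z v) ν(dv)`. -/
noncomputable def stieltjes (ν : Measure ℝ) (z : ℂ) : ℂ := ∫ v : ℝ, 1 / (1 - z * (v : ℂ)) ∂ν

section Stieltjes

variable {ν : Measure ℝ} [IsFiniteMeasure ν] {b : ℝ}

lemma one_sub_mul_ne_zero {z : ℂ} (hz : z ∈ (Complex.ofReal '' Ici b⁻¹)ᶜ) {v : ℝ}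
    (hv : v ∈ Icc 0 b) : 1 - z * (v : ℂ) ≠ 0 := by
  intro h0
  have h1 : z * (v : ℂ) = 1 := by linear_combination -h0
  have hv0 : v ≠ 0 := by rintro rfl; simp at h1
  refine hz ⟨v⁻¹, ?_, ?_⟩
  · exact inv_anti₀ (lt_of_le_of_ne hv.1 hv0.symm) hv.2
  · push_cast
    exact (eq_inv_of_mul_eq_one_left h1).symm

lemma isOpen_compl_ofReal_Ici (a : ℝ) : IsOpen (Complex.ofReal '' Ici a)ᶜ :=
  (Complex.isometry_ofReal.isClosedEmbedding.isClosedMap _ isClosed_Ici).isOpen_compl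

lemma integrable_one_div (hb : ∀ᵐ v ∂ν, v ∈ Ioc 0 b) {z : ℂ}
    (hz : z ∈ (Complex.ofReal '' Ici b⁻¹)ᶜ) :
    Integrable (fun v : ℝ => 1 / (1 - z * (v : ℂ))) ν := by
  refine integrable_of_continuousOn_Icc hb ?_
  refine ContinuousOn.div (by fun_prop) (by fun_prop) fun v hv => one_sub_mul_ne_zero hz hv

lemma exists_bound_one_div {A : Set ℂ} (hA : IsCompact A)
    (hsub : A ⊆ (Complex.ofReal '' Ici b⁻¹)ᶜ) :
    ∃ K, 0 < K ∧ ∀ z ∈ A, ∀ v ∈ Icc 0 b, ‖1 / (1 - z * (v : ℂ))‖ ≤ K := by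
  have hc : ContinuousOn (fun p : ℂ × ℝ => 1 / (1 - p.1 * (p.2 : ℂ))) (A ×ˢ Icc 0 b) :=
    ContinuousOn.div (by fun_prop) (by fun_prop) fun p hp =>
      one_sub_mul_ne_zero (hsub hp.1) hp.2
  obtain ⟨K, hK⟩ := (hA.prod isCompact_Icc).exists_bound_of_continuousOn hc
  exact ⟨max K 1, by positivity, fun z hz v hv => (hK (z, v) ⟨hz, hv⟩).trans (le_max_left _ _)⟩

lemma analyticOnNhd_stieltjes (hb : ∀ᵐ v ∂ν, v ∈ Ioc 0 b) :
    AnalyticOnNhd ℂ (stieltjes ν) (Complex.ofReal '' Ici b⁻¹)ᶜ := by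
  refine DifferentiableOn.analyticOnNhd (fun z hz => ?_) (isOpen_compl_ofReal_Ici _)
  refine DifferentiableAt.differentiableWithinAt ?_
  obtain ⟨ε, hε, hball⟩ := Metric.nhds_basis_closedBall.mem_iff.1
    ((isOpen_compl_ofReal_Ici b⁻¹).mem_nhds hz)
  obtain ⟨K, hK, hKb⟩ := exists_bound_one_div (isCompact_closedBall z ε) hball
  have hder := hasDerivAt_integral_of_dominated_loc_of_deriv_le (μ := ν) (𝕜 := ℂ)
    (F := fun (z : ℂ) (v : ℝ) => 1 / (1 - z * (v : ℂ)))
    (F' := fun (z : ℂ) (v : ℝ) => (v : ℂ) * (1 / (1 - z * (v : ℂ))) ^ 2) (x₀ := z)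
    (bound := fun v => b * K ^ 2) (Metric.closedBall_mem_nhds z hε) ?_
    (integrable_one_div hb hz) ?_ ?_ (integrable_const _) ?_
  · exact hder.2.differentiableAt
  · filter_upwards [(isOpen_compl_ofReal_Ici b⁻¹).mem_nhds hz] with y hy
    exact (integrable_one_div hb hy).aestronglyMeasurable
  · refine (integrable_of_continuousOn_Icc hb ?_).aestronglyMeasurable
    refine ContinuousOn.mul (by fun_prop) (ContinuousOn.pow (ContinuousOn.div (by fun_prop)
      (by fun_prop) fun v hv => one_sub_mul_ne_zero hz hv) 2)
  · filter_upwards [hb] with v hv y hy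
    rw [norm_mul, norm_pow, Complex.norm_real, Real.norm_of_nonneg hv.1.le]
    have := hKb y hy v (Ioc_subset_Icc_self hv)
    exact mul_le_mul hv.2 (pow_le_pow_left₀ (norm_nonneg _) this 2) (by positivity)
      (hv.1.le.trans hv.2)
  · filter_upwards [hb] with v hv y hy
    have hne := one_sub_mul_ne_zero (hball hy) (Ioc_subset_Icc_self hv)
    have h1 : HasDerivAt (fun y : ℂ => 1 - y * (v : ℂ)) (-(v : ℂ)) y := by
      simpa using ((hasDerivAt_id y).mul_const (v : ℂ)).const_sub 1
    have h2 := h1.inv hne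
    simp only [one_div]
    convert! h2 using 1
    rw [neg_neg, inv_pow, div_eq_mul_inv]

/-- With `t = (v - c) z / (1 - c z)` one has `1 - z v = (1 - c z) (1 - t)`, so this is the finite
geometric series in `t`. -/
lemma one_div_eq_taylor {z c v : ℂ} (hc : 1 - c * z ≠ 0) (hv : 1 - z * v ≠ 0) (N : ℕ) :
    1 / (1 - z * v) = (∑ j ∈ Finset.range N, z ^ j * (v - c) ^ j / (1 - c * z) ^ (j + 1)) +
      ((v - c) * z / (1 - c * z)) ^ N * (1 / (1 - z * v)) := by
  set t := (v - c) * z / (1 - c * z) with ht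
  have h1 : ∀ j, z ^ j * (v - c) ^ j / (1 - c * z) ^ (j + 1) = t ^ j * (1 - c * z)⁻¹ := by
    intro j
    rw [ht, div_pow, mul_pow, pow_succ]
    field_simp
  simp_rw [h1]
  rw [← Finset.sum_mul]
  have h2 := mul_neg_geom_sum t N
  have h3 : 1 - t = (1 - z * v) * (1 - c * z)⁻¹ := by
    rw [ht]; field_simp; ring
  have h4 : (1 - c * z)⁻¹ = (1 - t) * (1 / (1 - z * v)) := by rw [h3]; field_simp
  rw [h4]
  linear_combination (-(1 / (1 - z * v))) * h2

variable {n : ℕ} {x w : Fin n → ℝ}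

/-- The quadrature error for the resolvent, by expansion at the center `c`. -/
lemma IsGaussianQuadrature.norm_stieltjes_sub_le (hb : ∀ᵐ v ∂ν, v ∈ Ioc 0 b)
    (hq : IsGaussianQuadrature ν n x w) (hn : 1 ≤ n) (hw : ∀ i, 0 ≤ w i)
    (hx : ∀ i, x i ∈ Icc 0 b)
    {z c : ℂ} {r K : ℝ} (hz : z ∈ (Complex.ofReal '' Ici b⁻¹)ᶜ) (hc : 1 - c * z ≠ 0)
    (hK : ∀ v ∈ Icc 0 b, ‖1 / (1 - z * (v : ℂ))‖ ≤ K)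
    (hr : ∀ v ∈ Icc 0 b, ‖((v : ℂ) - c) * z / (1 - c * z)‖ ≤ r) :
    ‖∑ i, (w i : ℂ) / (1 - z * x i) - stieltjes ν z‖ ≤ 2 * ν.real univ * K * r ^ (2 * n) := by
  -- The first `2n` terms form a polynomial in `v` of degree at most `2n - 1`, which the rule
  -- integrates exactly.
  set p : Polynomial ℂ := ∑ j ∈ Finset.range (2 * n),
    Polynomial.C (z ^ j / (1 - c * z) ^ (j + 1)) * (Polynomial.X - Polynomial.C c) ^ j with hp
  have hpd : p.natDegree < 2 * n := by
    refine (Polynomial.natDegree_sum_le_of_forall_le (n := 2 * n - 1) _ _ fun j hj => ?_).trans_lt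
      (by omega)
    refine (Polynomial.natDegree_C_mul_le _ _).trans ?_
    rw [Polynomial.natDegree_pow, Polynomial.natDegree_X_sub_C]
    have := Finset.mem_range.1 hj
    omega
  set E : ℝ → ℂ := fun v => ((v - c) * z / (1 - c * z)) ^ (2 * n) * (1 / (1 - z * (v : ℂ))) with hE
  have hid : ∀ v ∈ Icc 0 b, 1 / (1 - z * (v : ℂ)) = p.eval (v : ℂ) + E v := fun v hv => by
    rw [one_div_eq_taylor hc (one_sub_mul_ne_zero hz hv) (2 * n), hp, Polynomial.eval_finsetSum]
    congr 1
    refine Finset.sum_congr rfl fun j _ => ?_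
    simp only [Polynomial.eval_mul, Polynomial.eval_C, Polynomial.eval_pow, Polynomial.eval_sub,
      Polynomial.eval_X]
    ring
  have hEb : ∀ v ∈ Icc 0 b, ‖E v‖ ≤ K * r ^ (2 * n) := fun v hv => by
    rw [hE, norm_mul, norm_pow, mul_comm]
    have h1 := hr v hv
    have h2 := hK v hv
    have h3 := (norm_nonneg _).trans h2
    gcongr
  have hpi : Integrable (fun v : ℝ => p.eval (v : ℂ)) ν :=
    integrable_of_continuousOn_Icc hb
      (p.continuous.comp Complex.continuous_ofReal).continuousOn
  have hF : stieltjes ν z = ∫ v : ℝ, p.eval (v : ℂ) ∂ν + ∫ v, E v ∂ν := by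
    have hEi : Integrable E ν := by
      refine ((integrable_one_div hb hz).sub hpi).congr ?_
      filter_upwards [hb] with v hv
      simp only [Pi.sub_apply]
      rw [hid v (Ioc_subset_Icc_self hv)]; ring
    rw [← integral_add hpi hEi]
    exact integral_congr_ae (hb.mono fun v hv => hid v (Ioc_subset_Icc_self hv))
  have hQ : ∑ i, (w i : ℂ) / (1 - z * x i) =
      ∫ v : ℝ, p.eval (v : ℂ) ∂ν + ∑ i, E (x i) * (w i : ℂ) := by
    have h1 : ∫ v : ℝ, p.eval (v : ℂ) ∂ν = ∑ i, p.eval (x i : ℂ) * (w i : ℂ) :=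
      hq.integral_eval (𝕜 := ℂ) hb p hpd
    rw [h1, ← Finset.sum_add_distrib]
    refine Finset.sum_congr rfl fun i _ => ?_
    rw [← add_mul, ← hid _ (hx i)]; ring
  -- The moment of order zero. Since the weights are nonnegative with the same total mass as `ν`,
  -- the remainder costs the same under the rule as under `ν`, whence the factor 2.
  have hmass : ∑ i, w i = ν.real univ := by
    have := hq.moments 0 (by omega)
    simpa using this.symm
  rw [hF, hQ, add_sub_add_left_eq_sub]
  refine (norm_sub_le _ _).trans ?_
  have h1 : ‖∑ i, E (x i) * (w i : ℂ)‖ ≤ ν.real univ * (K * r ^ (2 * n)) := by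
    refine (norm_sum_le _ _).trans ?_
    rw [← hmass, Finset.sum_mul]
    refine Finset.sum_le_sum fun i _ => ?_
    rw [norm_mul, Complex.norm_real, Real.norm_of_nonneg (hw i), mul_comm]
    exact mul_le_mul_of_nonneg_left (hEb _ (hx i)) (hw i)
  have h2 : ‖∫ v, E v ∂ν‖ ≤ K * r ^ (2 * n) * ν.real univ :=
    norm_integral_le_of_norm_le_const (hb.mono fun v hv => hEb v (Ioc_subset_Icc_self hv))
  linarith

lemma IsGaussianQuadrature.isBigO_stieltjes_sub (hb : ∀ᵐ v ∂ν, v ∈ Ioc 0 b) (hb0 : 0 < b)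
    (hq : IsGaussianQuadrature ν n x w) (hn : 1 ≤ n) (hw : ∀ i, 0 ≤ w i)
    (hx : ∀ i, x i ∈ Icc 0 b) :
    (fun z : ℂ => ∑ i, (w i : ℂ) / (1 - z * x i) - stieltjes ν z) =O[𝓝 0]
      fun z => z ^ (2 * n) := by
  have h0 : (0 : ℂ) ∈ (Complex.ofReal '' Ici b⁻¹)ᶜ := by
    rintro ⟨y, hy, hy0⟩
    have : y = 0 := by exact_mod_cast hy0
    rw [this, mem_Ici] at hy
    exact absurd hy (not_le.2 (inv_pos.2 hb0))
  obtain ⟨ε, hε, hball⟩ := Metric.nhds_basis_closedBall.mem_iff.1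
    ((isOpen_compl_ofReal_Ici b⁻¹).mem_nhds h0)
  obtain ⟨K, hK, hKb⟩ := exists_bound_one_div (isCompact_closedBall 0 ε) hball
  refine Asymptotics.IsBigO.of_bound (2 * ν.real univ * K * b ^ (2 * n)) ?_
  filter_upwards [Metric.closedBall_mem_nhds (0 : ℂ) hε] with z hz
  -- The centre `c = 0` is the ordinary power series in `z`, with ratio `b * ‖z‖`.
  have := hq.norm_stieltjes_sub_le hb hn hw hx (z := z) (c := 0) (r := b * ‖z‖) (hball hz)
    (by simp) (hKb z hz) (fun v hv => by
      simp only [sub_zero, zero_mul, div_one, norm_mul, Complex.norm_real,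
        Real.norm_of_nonneg hv.1]
      gcongr
      exact hv.2)
  rwa [mul_pow, ← mul_assoc, ← norm_pow] at this

/-- Every point off `[1/b, ∞)` is reached by the expansion at a suitable center. -/
lemma exists_center (hb0 : 0 < b) {z : ℂ} (hz : z ∈ (Complex.ofReal '' Ici b⁻¹)ᶜ) :
    ∃ c : ℂ, ‖c‖ * ‖z‖ < ‖1 - c * z‖ ∧ ‖(b : ℂ) - c‖ * ‖z‖ < ‖1 - c * z‖ := by
  -- Since |1 - cz|² - |cz|² = 1 - 2 Re(cz), the terms in |c|² cancel and both inequalities become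
  -- linear in `c`.
  have key : ∀ c : ℂ, 0 < 1 - 2 * (c * z).re →
      b ^ 2 * Complex.normSq z - 2 * b * c.re * Complex.normSq z < 1 - 2 * (c * z).re →
      ‖c‖ * ‖z‖ < ‖1 - c * z‖ ∧ ‖(b : ℂ) - c‖ * ‖z‖ < ‖1 - c * z‖ := by
    intro c h1 h2
    have h3 : Complex.normSq (1 - c * z) =
        1 - 2 * (c * z).re + Complex.normSq c * Complex.normSq z := by
      simp only [Complex.normSq_apply, Complex.sub_re, Complex.mul_re, Complex.sub_im,
        Complex.mul_im, Complex.one_re, Complex.one_im]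
      ring
    have h4 : Complex.normSq ((b : ℂ) - c) = b ^ 2 - 2 * b * c.re + Complex.normSq c := by
      simp only [Complex.normSq_apply, Complex.sub_re, Complex.sub_im, Complex.ofReal_re,
        Complex.ofReal_im]
      ring
    constructor
    · rw [← norm_mul, ← abs_of_nonneg (norm_nonneg (c * z)),
        ← abs_of_nonneg (norm_nonneg (1 - c * z)), ← sq_lt_sq, Complex.sq_norm, Complex.sq_norm,
        h3, Complex.normSq_mul]
      linarith
    · rw [← norm_mul, ← abs_of_nonneg (norm_nonneg (((b : ℂ) - c) * z)),
        ← abs_of_nonneg (norm_nonneg (1 - c * z)), ← sq_lt_sq, Complex.sq_norm, Complex.sq_norm,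
        h3, Complex.normSq_mul, h4]
      linarith
  by_cases him : z.im = 0
  · have hzr : z = (z.re : ℂ) := by apply Complex.ext <;> simp [him]
    have hlt : z.re < b⁻¹ := by
      by_contra! h
      exact hz ⟨z.re, h, hzr.symm⟩
    have hnorm : Complex.normSq z = z.re ^ 2 := by simp [Complex.normSq_apply, him, sq]
    rcases le_total z.re 0 with hneg | hpos
    · have hbz : b * z.re ≤ 0 := mul_nonpos_of_nonneg_of_nonpos hb0.le hneg
      refine ⟨(b : ℂ), key _ ?_ ?_⟩
      · simp; linarith
      · rw [hnorm]; simp; nlinarith [sq_nonneg (b * z.re)]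
    · have hbz : b * z.re < 1 := by
        rw [← mul_inv_cancel₀ hb0.ne']; exact mul_lt_mul_of_pos_left hlt hb0
      refine ⟨0, key _ (by simp) ?_⟩
      rw [hnorm]; simp
      have : 0 ≤ b * z.re := mul_nonneg hb0.le hpos
      nlinarith
  · have him2 : 0 < z.im ^ 2 := by positivity
    -- For the purely imaginary centre `c = i s Im z` one gets 1 - 2 Re(cz) = 1 + 2s(Im z)², and
    -- this `s` turns it into 1 + b²|z|², which beats b²|z|².
    set s := b ^ 2 * Complex.normSq z / (2 * z.im ^ 2) with hs
    have hs0 : 0 ≤ s := div_nonneg (mul_nonneg (sq_nonneg _) (Complex.normSq_nonneg _))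
      (by positivity)
    have hs1 : 2 * s * z.im ^ 2 = b ^ 2 * Complex.normSq z := by rw [hs]; field_simp
    refine ⟨(⟨0, s * z.im⟩ : ℂ), key _ ?_ ?_⟩
    · simp only [Complex.mul_re]
      nlinarith [mul_nonneg hs0 him2.le]
    · simp only [Complex.mul_re]
      nlinarith

/-- The distance to `c` is convex along `[0, b]`, so the two endpoints suffice. This is why
`exists_center` treats only `0` and `b`. -/
lemma norm_sub_mul_le {c z : ℂ} {v D : ℝ} (hv : v ∈ Icc 0 b) (h0 : ‖c‖ * ‖z‖ ≤ D)
    (h1 : ‖(b : ℂ) - c‖ * ‖z‖ ≤ D) : ‖((v : ℂ) - c) * z‖ ≤ D := by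
  rcases hv.1.trans hv.2 |>.eq_or_lt with hb0 | hb0
  · have : v = 0 := le_antisymm (hv.2.trans hb0.symm.le) hv.1
    simpa [this] using h0
  have h2 : ((v : ℂ) - c) = ((v / b : ℝ) : ℂ) * ((b : ℂ) - c) + ((1 - v / b : ℝ) : ℂ) * (-c) := by
    have : (b : ℂ) ≠ 0 := by exact_mod_cast hb0.ne'
    push_cast; field_simp; ring
  have h3 : 0 ≤ v / b := div_nonneg hv.1 hb0.le
  have h4 : 0 ≤ 1 - v / b := by rw [sub_nonneg, div_le_one hb0]; exact hv.2
  have h5 : ‖(v : ℂ) - c‖ ≤ v / b * ‖(b : ℂ) - c‖ + (1 - v / b) * ‖c‖ := by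
    rw [h2]
    refine (norm_add_le _ _).trans ?_
    rw [norm_mul, norm_mul, Complex.norm_real, Complex.norm_real, Real.norm_of_nonneg h3,
      Real.norm_of_nonneg h4, norm_neg]
  rw [norm_mul]
  have h6 := mul_le_mul_of_nonneg_right h5 (norm_nonneg z)
  have h7 := mul_le_mul_of_nonneg_left h1 h3
  have h8 := mul_le_mul_of_nonneg_left h0 h4
  nlinarith

lemma exists_uniform_center (hb0 : 0 < b) {A : Set ℂ} (hA : IsCompact A)
    (hsub : A ⊆ (Complex.ofReal '' Ici b⁻¹)ᶜ) :
    ∃ r, 0 < r ∧ r < 1 ∧ ∀ z ∈ A, ∃ c : ℂ, 1 - c * z ≠ 0 ∧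
      ∀ v ∈ Icc 0 b, ‖((v : ℂ) - c) * z / (1 - c * z)‖ ≤ r := by
  refine hA.induction_on (p := fun A => ∃ r, 0 < r ∧ r < 1 ∧ ∀ z ∈ A, ∃ c : ℂ, 1 - c * z ≠ 0 ∧
      ∀ v ∈ Icc 0 b, ‖((v : ℂ) - c) * z / (1 - c * z)‖ ≤ r)
    ⟨1 / 2, by norm_num, by norm_num, by simp⟩ ?_ ?_ ?_
  · rintro s t hst ⟨r, h0, h1, h⟩
    exact ⟨r, h0, h1, fun z hz => h z (hst hz)⟩
  · rintro s t ⟨r, h0, h1, h⟩ ⟨r', h0', h1', h'⟩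
    refine ⟨max r r', lt_max_of_lt_left h0, max_lt h1 h1', fun z hz => ?_⟩
    rcases hz with hz | hz
    · obtain ⟨c, hc, hcv⟩ := h z hz
      exact ⟨c, hc, fun v hv => (hcv v hv).trans (le_max_left _ _)⟩
    · obtain ⟨c, hc, hcv⟩ := h' z hz
      exact ⟨c, hc, fun v hv => (hcv v hv).trans (le_max_right _ _)⟩
  · intro z hz
    obtain ⟨c, h1, h2⟩ := exists_center hb0 (hsub hz)
    have hpos : 0 < ‖1 - c * z‖ := (mul_nonneg (norm_nonneg _) (norm_nonneg _)).trans_lt h1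
    -- The centre may vary with the point; only the ratio must be uniform. The extra `0` in the
    -- maximum keeps `r` positive, so that its logarithm can serve as a rate.
    obtain ⟨r, hr1, hr2⟩ := exists_between
      (show max (max (‖c‖ * ‖z‖ / ‖1 - c * z‖) (‖(b : ℂ) - c‖ * ‖z‖ / ‖1 - c * z‖)) 0 < 1 by
        refine max_lt (max_lt ?_ ?_) one_pos <;> rw [div_lt_one hpos] <;> assumption)
    obtain ⟨hr1, hr0⟩ := max_lt_iff.1 hr1
    obtain ⟨hr3, hr4⟩ := max_lt_iff.1 hr1
    rw [div_lt_iff₀ hpos] at hr3 hr4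
    have e1 : ∀ᶠ y in 𝓝 z, ‖c‖ * ‖y‖ < r * ‖1 - c * y‖ :=
      ContinuousAt.eventually_lt (by fun_prop) (by fun_prop) hr3
    have e2 : ∀ᶠ y in 𝓝 z, ‖(b : ℂ) - c‖ * ‖y‖ < r * ‖1 - c * y‖ :=
      ContinuousAt.eventually_lt (by fun_prop) (by fun_prop) hr4
    have e3 : ∀ᶠ y in 𝓝 z, 0 < ‖1 - c * y‖ :=
      ContinuousAt.eventually_lt (by fun_prop) (by fun_prop) hpos
    refine ⟨_, mem_nhdsWithin_of_mem_nhds (e1.and (e2.and e3)), r, hr0, hr2, ?_⟩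
    rintro y ⟨hy1, hy2, hy3⟩
    refine ⟨c, norm_pos_iff.1 hy3, fun v hv => ?_⟩
    rw [norm_div, div_le_iff₀ hy3]
    exact norm_sub_mul_le hv hy1.le hy2.le

end Stieltjes

/-! ### The mixing measure and the integral representation of the exponent -/

section Mixing

variable {π : ℝ → ℝ} {μ : Measure ℝ} {ρ : ℝ}

lemma IsCMOneSided.ae_le (h : IsCMOneSided π μ ρ) : ∀ᵐ u ∂μ, ρ ≤ u := by
  have h1 : μ (Ioo 0 ρ) = 0 := by
    -- The supremum need not be known to be attained: `(0, ρ)` is a countable union of null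
    -- intervals `(0, uₙ)`.
    obtain ⟨u, -, hu, hlim, hmem⟩ := h.isLUB.exists_seq_monotone_tendsto
      (by exact ⟨0, le_rfl, by simp⟩)
    have hsub : Ioo 0 ρ ⊆ ⋃ n, Ioo 0 (u n) := fun y hy => by
      obtain ⟨n, hn⟩ := (hlim.eventually (lt_mem_nhds hy.2)).exists
      exact mem_iUnion.2 ⟨n, hy.1, hn⟩
    exact measure_mono_null hsub (measure_iUnion_null fun n => (hmem n).2)
  have h2 : μ (Iio ρ) = 0 := by
    have : Iio ρ ⊆ Iio 0 ∪ {0} ∪ Ioo 0 ρ := fun y hy => by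
      rcases lt_trichotomy y 0 with h | h | h
      · exact Or.inl (Or.inl h)
      · exact Or.inl (Or.inr h)
      · exact Or.inr ⟨h, hy⟩
    exact measure_mono_null this (measure_union_null
      (measure_union_null h.no_negative h.mixing.zero) h1)
  rw [ae_iff]
  simp only [not_le]
  exact h2

lemma IsCMOneSided.restrict_eq (h : IsCMOneSided π μ ρ) : μ.restrict (Ioi 0) = μ :=
  Measure.restrict_eq_self_of_ae_mem (h.ae_le.mono fun _ hu => h.pos.trans_le hu)

lemma IsCMOneSided.integrable_exp (h : IsCMOneSided π μ ρ) {x : ℝ} (hx : 0 < x) :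
    Integrable (fun u => Real.exp (-(u * x))) μ := by
  have := h.mixing.integrable_pos x hx
  rwa [IntegrableOn, h.restrict_eq] at this

lemma IsCMOneSided.eq_integral (h : IsCMOneSided π μ ρ) {x : ℝ} (hx : 0 < x) :
    π x = ∫ u, Real.exp (-(u * x)) ∂μ := by
  rw [h.mixing.eq_pos x hx, h.restrict_eq]

/-- An integrable function vanishes almost everywhere off a σ-finite set, and a function without
zeros leaves nothing outside. With `e^{-u}` as the function this permits Tonelli and Fubini for `μ`.
-/
lemma sigmaFinite_of_integrable_pos {α : Type*} [MeasurableSpace α] {μ : Measure α} {f : α → ℝ}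
    (hf : StronglyMeasurable f) (hi : Integrable f μ) (hpos : ∀ x, f x ≠ 0) : SigmaFinite μ := by
  have h1 : FinStronglyMeasurable f μ := by
    obtain ⟨t, ht, ht0, hs⟩ := hi.aefinStronglyMeasurable.exists_set_sigmaFinite
    have h2 : ∀ᵐ x ∂μ, x ∈ t := by
      rw [EventuallyEq, ae_restrict_iff' ht.compl] at ht0
      filter_upwards [ht0] with x hx
      by_contra hxt
      exact hpos x (hx hxt)
    rw [Measure.restrict_eq_self_of_ae_mem h2] at hs
    exact hf.finStronglyMeasurable μ
  obtain ⟨t, ht, ht0, hs⟩ := h1.exists_set_sigmaFinite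
  have h3 : t = univ := eq_univ_of_forall fun x => by
    by_contra hxt
    exact hpos x (ht0 x hxt)
  rwa [h3, Measure.restrict_univ] at hs

lemma IsCMOneSided.sigmaFinite (h : IsCMOneSided π μ ρ) : SigmaFinite μ := by
  refine sigmaFinite_of_integrable_pos (f := fun u => Real.exp (-(u * 1))) ?_
    (h.integrable_exp one_pos) fun u => (Real.exp_pos _).ne'
  exact (by fun_prop : Continuous fun u : ℝ => Real.exp (-(u * 1))).stronglyMeasurable

/-- Finite variation of the jumps means that ∫ x π(x) dx over (0, 1) is finite. By Tonelli this is
the `μ`-integral of ∫ x e^{-ux} dx over (0, 1), which for u ≥ ρ is at least a constant times u⁻². -/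
lemma IsCMOneSided.lintegral_inv_sq_lt_top (h : IsCMOneSided π μ ρ)
    (hcut : Integrable fun x => |(if |x| < 1 then x else 0) - 0| * π x) :
    ∫⁻ u, ENNReal.ofReal (u⁻¹ ^ 2) ∂μ < ∞ := by
  have := h.sigmaFinite
  have hint : ∫⁻ x in Ioo (0 : ℝ) 1, ENNReal.ofReal (x * π x) < ∞ := by
    have h1 : IntegrableOn (fun x => x * π x) (Ioo 0 1) := by
      refine hcut.integrableOn.congr_fun (fun x hx => ?_) measurableSet_Ioo
      have : |x| < 1 := by rw [abs_of_pos hx.1]; exact hx.2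
      beta_reduce
      rw [if_pos this, sub_zero, abs_of_pos hx.1]
    exact h1.lintegral_lt_top
  have hswap : ∫⁻ x in Ioo (0 : ℝ) 1, ENNReal.ofReal (x * π x) =
      ∫⁻ u, (∫⁻ x in Ioo (0 : ℝ) 1, ENNReal.ofReal (x * Real.exp (-(u * x)))) ∂μ := by
    rw [lintegral_lintegral_swap]
    · refine setLIntegral_congr_fun measurableSet_Ioo fun x hx => ?_
      rw [h.eq_integral hx.1, ← integral_const_mul, ofReal_integral_eq_lintegral_ofReal
        ((h.integrable_exp hx.1).const_mul x)
        (Eventually.of_forall fun u => mul_nonneg hx.1.le (Real.exp_pos _).le)]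
    · exact (by fun_prop : Measurable fun p : ℝ × ℝ =>
        ENNReal.ofReal (p.2 * Real.exp (-(p.1 * p.2)))).aemeasurable
  -- On `(δ/(2u), δ/u)`, which lies in `(0, 1)` because `δ ≤ ρ ≤ u`, the integrand is at least
  -- `(δ/(2u)) e^{-δ}`. The length is `δ/(2u)`, and the product is `κ u⁻²`.
  set δ := min 1 ρ with hδ
  have hδ0 : 0 < δ := lt_min one_pos h.pos
  set κ : ℝ := (δ / 2) ^ 2 * Real.exp (-δ) with hκ
  have hκ0 : 0 < κ := by positivity
  have hlow : ∀ᵐ u ∂μ, ENNReal.ofReal (κ * u⁻¹ ^ 2) ≤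
      ∫⁻ x in Ioo (0 : ℝ) 1, ENNReal.ofReal (x * Real.exp (-(u * x))) := by
    filter_upwards [h.ae_le] with u hu
    have hu0 : 0 < u := h.pos.trans_le hu
    have hδu : δ / u ≤ 1 := by rw [div_le_one hu0]; exact (min_le_right _ _).trans hu
    have hsub : Ioo (δ / (2 * u)) (δ / u) ⊆ Ioo 0 1 := fun x hx =>
      ⟨(by positivity : 0 < δ / (2 * u)).trans hx.1, hx.2.trans_le hδu⟩
    refine le_trans ?_ (lintegral_mono_set hsub)
    calc ENNReal.ofReal (κ * u⁻¹ ^ 2)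
        = ∫⁻ x in Ioo (δ / (2 * u)) (δ / u), ENNReal.ofReal (δ / (2 * u) * Real.exp (-δ)) := by
          rw [setLIntegral_const, Real.volume_Ioo, ← ENNReal.ofReal_mul (by positivity)]
          congr 1
          rw [hκ]
          field_simp
          ring
      _ ≤ _ := by
          refine setLIntegral_mono' measurableSet_Ioo fun x hx => ENNReal.ofReal_le_ofReal ?_
          have h1 : u * x ≤ δ := by
            have := mul_le_mul_of_nonneg_left hx.2.le hu0.le
            rwa [mul_div_cancel₀ _ hu0.ne'] at this
          exact mul_le_mul hx.1.le (Real.exp_le_exp.2 (by linarith)) (Real.exp_pos _).le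
            (hsub hx).1.le
  have h2 : ∫⁻ u, ENNReal.ofReal (κ * u⁻¹ ^ 2) ∂μ < ∞ := by
    refine (lintegral_mono_ae hlow).trans_lt ?_
    rwa [← hswap]
  simp_rw [ENNReal.ofReal_mul hκ0.le] at h2
  rw [lintegral_const_mul _ (by fun_prop)] at h2
  exact ENNReal.lt_top_of_mul_ne_top_right h2.ne (by simpa using hκ0)

lemma ae_powMustar {p : ℝ → Prop} (h : ∀ᵐ u ∂μ, p u⁻¹) (m : ℕ) :
    ∀ᵐ v ∂(powMustar μ m), p v := by
  refine (withDensity_absolutelyContinuous _ _).ae_le ?_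
  exact ((MeasurableEquiv.inv ℝ).measurableEmbedding.ae_map_iff).2 h

/-- The density `v ^ m` is positive where the image of `μ` lives, so no null sets are gained. -/
lemma IsCMOneSided.ae_of_ae_powMustar (h : IsCMOneSided π μ ρ) {p : ℝ → Prop} {m : ℕ}
    (hp : ∀ᵐ v ∂(powMustar μ m), p v) : ∀ᵐ u ∂μ, p u⁻¹ := by
  rw [powMustar, ae_withDensity_iff (by fun_prop)] at hp
  have h1 := ((MeasurableEquiv.inv ℝ).measurableEmbedding.ae_map_iff).1 hp
  filter_upwards [h1, h.ae_le] with u hu hu'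
  refine hu ?_
  have : 0 < u⁻¹ := inv_pos.2 (h.pos.trans_le hu')
  simp only [MeasurableEquiv.inv_apply, ne_eq, ENNReal.ofReal_eq_zero, not_le]
  positivity

lemma IsCMOneSided.ae_powMustar_mem (h : IsCMOneSided π μ ρ) (m : ℕ) :
    ∀ᵐ v ∂(powMustar μ m), v ∈ Ioc 0 ρ⁻¹ := by
  refine ae_powMustar (h.ae_le.mono fun u hu => ?_) m
  exact ⟨inv_pos.2 (h.pos.trans_le hu), inv_anti₀ h.pos hu⟩

lemma IsCMOneSided.integral_powMustar (h : IsCMOneSided π μ ρ) {E : Type*}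
    [NormedAddCommGroup E] [NormedSpace ℝ E] (m : ℕ) (f : ℝ → E) :
    ∫ v, f v ∂(powMustar μ m) = ∫ u, (u⁻¹ ^ m) • f u⁻¹ ∂μ := by
  rw [powMustar, integral_withDensity_eq_integral_toReal_smul (by fun_prop)
    (Eventually.of_forall fun v => ENNReal.ofReal_lt_top)]
  have := (MeasurableEquiv.inv ℝ).measurableEmbedding.integral_map (μ := μ)
    (fun v => (ENNReal.ofReal (v ^ m)).toReal • f v)
  refine Eq.trans this (integral_congr_ae ?_)
  filter_upwards [h.ae_le] with u hu
  have : 0 < u⁻¹ := inv_pos.2 (h.pos.trans_le hu)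
  simp only [MeasurableEquiv.inv_apply]
  rw [ENNReal.toReal_ofReal (by positivity)]

lemma IsCMOneSided.integral_powMustar_succ (h : IsCMOneSided π μ ρ) {E : Type*}
    [NormedAddCommGroup E] [NormedSpace ℝ E] (m : ℕ) (f : ℝ → E) :
    ∫ v, f v ∂(powMustar μ (m + 1)) = ∫ v, v • f v ∂(powMustar μ m) := by
  rw [h.integral_powMustar, h.integral_powMustar]
  simp_rw [smul_smul, pow_succ]

lemma IsCMOneSided.isFiniteMeasure_powMustar (h : IsCMOneSided π μ ρ)
    (hcut : Integrable fun x => |(if |x| < 1 then x else 0) - 0| * π x) (m : ℕ) :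
    IsFiniteMeasure (powMustar μ (2 + m)) := by
  refine isFiniteMeasure_withDensity ?_
  have h1 := lintegral_map_equiv (μ := μ) (fun v => ENNReal.ofReal (v ^ (2 + m)))
    (MeasurableEquiv.inv ℝ)
  refine ne_of_lt (lt_of_eq_of_lt h1 ?_)
  have h2 : ∫⁻ u, ENNReal.ofReal (u⁻¹ ^ (2 + m)) ∂μ ≤
      ∫⁻ u, ENNReal.ofReal (ρ⁻¹ ^ m) * ENNReal.ofReal (u⁻¹ ^ 2) ∂μ := by
    refine lintegral_mono_ae ?_
    filter_upwards [h.ae_le] with u hu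
    have hu0 : 0 < u⁻¹ := inv_pos.2 (h.pos.trans_le hu)
    have hρ := h.pos
    rw [← ENNReal.ofReal_mul (by positivity)]
    refine ENNReal.ofReal_le_ofReal ?_
    rw [pow_add, mul_comm]
    gcongr
  refine lt_of_le_of_lt h2 ?_
  rw [lintegral_const_mul _ (by fun_prop)]
  exact ENNReal.mul_lt_top ENNReal.ofReal_lt_top (h.lintegral_inv_sq_lt_top hcut)

/-- A nonzero polynomial of small degree does not vanish almost everywhere. -/
lemma IsCMOneSided.not_ae_eval_eq_zero (h : IsCMOneSided π μ ρ) {n : ℕ}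
    (hn : (n : ℕ∞) < μ.support.encard) (m : ℕ) (p : Polynomial ℝ) (hp : p ≠ 0)
    (hd : p.natDegree ≤ n) : ¬ ∀ᵐ v ∂(powMustar μ m), p.eval v = 0 := by
  intro h0
  have h1 := h.ae_of_ae_powMustar h0
  classical
  -- The reciprocals of the roots form a closed set of full measure, hence contain the support, but
  -- there are at most `n` of them.
  set F : Finset ℝ := p.roots.toFinset.image fun v => v⁻¹ with hF
  have h2 : (F : Set ℝ) ∈ ae μ := by
    filter_upwards [h1] with u hu
    rw [Finset.mem_coe, hF, Finset.mem_image]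
    exact ⟨u⁻¹, by rw [Multiset.mem_toFinset]; exact (Polynomial.mem_roots hp).2 hu, inv_inv u⟩
  have h3 := Measure.support_subset_of_isClosed F.finite_toSet.isClosed h2
  have h4 : F.card ≤ n := Finset.card_image_le.trans
    ((Multiset.toFinset_card_le _).trans ((Polynomial.card_roots' p).trans hd))
  have h5 := encard_le_encard h3
  rw [encard_coe_eq_coe_finsetCard] at h5
  exact absurd (hn.trans_le h5) (not_lt.2 (by exact_mod_cast h4))

/-- The mean value inequality along `[0, x]`. The factor `x` is what yields a bound of order `u⁻²`
after integration against `e^{-ux}`, and `u⁻²` is `μ`-integrable. -/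
lemma norm_exp_mul_sub_one_le (z : ℂ) {x r : ℝ} (hx : 0 ≤ x) (hr0 : 0 ≤ r) (hr : z.re ≤ r) :
    ‖Complex.exp (z * x) - 1‖ ≤ ‖z‖ * (x * Real.exp (r * x)) := by
  have h1 : ∀ t ∈ Icc (0 : ℝ) x,
      HasDerivWithinAt (fun t : ℝ => Complex.exp (z * t)) (Complex.exp (z * t) * z) (Icc 0 x) t := by
    intro t _
    have h2 : HasDerivAt (fun t : ℝ => z * (t : ℂ)) z t := by
      simpa using (Complex.ofRealCLM.hasDerivAt (x := t)).const_mul z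
    exact h2.cexp.hasDerivWithinAt
  have h3 := (convex_Icc (0 : ℝ) x).norm_image_sub_le_of_norm_hasDerivWithin_le
    (C := Real.exp (r * x) * ‖z‖) h1 (fun t ht => by
      rw [norm_mul, Complex.norm_exp]
      refine mul_le_mul_of_nonneg_right (Real.exp_le_exp.2 ?_) (norm_nonneg _)
      simp only [Complex.mul_re, Complex.ofReal_re, Complex.ofReal_im, mul_zero, sub_zero]
      exact (mul_le_mul_of_nonneg_right hr ht.1).trans (mul_le_mul_of_nonneg_left ht.2 hr0))
    (left_mem_Icc.2 hx) (right_mem_Icc.2 hx)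
  simp only [Complex.ofReal_zero, mul_zero, Complex.exp_zero, sub_zero, Real.norm_eq_abs,
    abs_of_nonneg hx] at h3
  linarith

lemma integrableOn_mul_exp {a : ℝ} (ha : 0 < a) :
    IntegrableOn (fun x : ℝ => x * Real.exp (-(a * x))) (Ioi 0) := by
  have := integrableOn_rpow_mul_exp_neg_mul_rpow (p := 1) (s := 1) (b := a) (by norm_num) one_pos ha
  simpa using this

lemma integral_mul_exp {a : ℝ} (ha : 0 < a) :
    ∫ x in Ioi (0 : ℝ), x * Real.exp (-(a * x)) = a⁻¹ ^ 2 := by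
  have := Real.integral_rpow_mul_exp_neg_mul_Ioi (a := 2) two_pos ha
  have h2 : (2 : ℝ) - 1 = 1 := by norm_num
  simpa [h2, Real.Gamma_two] using this

lemma integrableOn_exp_complex {a : ℂ} (ha : a.re < 0) :
    IntegrableOn (fun x : ℝ => Complex.exp (a * x)) (Ioi 0) :=
  integrableOn_exp_mul_complex_Ioi ha 0

lemma exp_sub_one_mul_exp (z : ℂ) (u x : ℝ) :
    (Complex.exp (z * x) - 1) * (Real.exp (-(u * x)) : ℂ) =
      Complex.exp ((z - u) * x) - Complex.exp ((-u) * x) := by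
  push_cast
  rw [sub_mul, one_mul, ← Complex.exp_add]
  congr 2 <;> ring

lemma integrableOn_exp_sub_one_mul_exp {z : ℂ} {u : ℝ} (hu : 0 < u) (hz : z.re < u) :
    IntegrableOn (fun x : ℝ => (Complex.exp (z * x) - 1) * (Real.exp (-(u * x)) : ℂ)) (Ioi 0) := by
  simp_rw [exp_sub_one_mul_exp]
  exact (integrableOn_exp_complex (by simpa using hz)).sub
    (integrableOn_exp_complex (by simpa using hu))

/-- The value is 1/(u - z) - 1/u = z / (u (u - z)). Written with v = 1/u it is z v² / (1 - zv),
which explains the weight v² in the transformed measure. -/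
lemma integral_exp_sub_one_mul_exp {z : ℂ} {u : ℝ} (hu : 0 < u) (hz : z.re < u) :
    ∫ x in Ioi (0 : ℝ), (Complex.exp (z * x) - 1) * (Real.exp (-(u * x)) : ℂ) =
      z * ((u⁻¹ ^ 2 : ℝ) • (1 / (1 - z * (u⁻¹ : ℝ)))) := by
  simp_rw [exp_sub_one_mul_exp]
  have h1 : (z - u).re < 0 := by simpa using hz
  have h2 : (-(u : ℂ)).re < 0 := by simpa using hu
  rw [integral_sub (integrableOn_exp_complex h1) (integrableOn_exp_complex h2),
    integral_exp_mul_complex_Ioi h1, integral_exp_mul_complex_Ioi h2]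
  have h3 : (u : ℂ) ≠ 0 := by exact_mod_cast hu.ne'
  have h4 : z - u ≠ 0 := fun h0 => by rw [h0] at h1; simp at h1
  have h5 : (u : ℂ) - z ≠ 0 := fun h0 => h4 (by linear_combination -h0)
  have h6 : 1 - z * (u : ℂ)⁻¹ ≠ 0 := by
    intro h0
    apply h5
    field_simp at h0
    simpa using h0
  simp only [Complex.ofReal_zero, mul_zero, Complex.exp_zero, Complex.real_smul,
    Complex.ofReal_pow, Complex.ofReal_inv]
  field_simp
  ring

lemma IsCMOneSided.subordinatorExponent_eq (h : IsCMOneSided π μ ρ)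
    (hcut : Integrable fun x => |(if |x| < 1 then x else 0) - 0| * π x) {z : ℂ}
    (hz : z.re < ρ) :
    subordinatorExponent π z = z * stieltjes (powMustar μ 2) z := by
  have hsf := h.sigmaFinite
  have hρ := h.pos
  -- The mean value bound needs a nonnegative exponent; `r < ρ` still holds.
  set r := max z.re 0 with hr
  have hrρ : r < ρ := max_lt hz h.pos
  have hr0 : 0 ≤ r := le_max_right _ _
  set f : ℝ → ℝ → ℂ := fun x u => (Complex.exp (z * x) - 1) * (Real.exp (-(u * x)) : ℂ) with hf
  have hfm : Continuous (Function.uncurry f) := by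
    simp only [hf, Function.uncurry_def]; fun_prop
  have hsq : Integrable (fun u => u⁻¹ ^ 2) μ := by
    refine ⟨(by fun_prop : Measurable fun u : ℝ => u⁻¹ ^ 2).aestronglyMeasurable, ?_⟩
    rw [hasFiniteIntegral_iff_ofReal (Eventually.of_forall fun u => sq_nonneg _)]
    exact h.lintegral_inv_sq_lt_top hcut
  have hbound : ∀ u, ρ ≤ u → ∀ x ∈ Ioi (0 : ℝ), ‖f x u‖ ≤
      ‖z‖ * (x * Real.exp (-((u - r) * x))) := fun u hu x hx => by
    rw [hf, norm_mul, Complex.norm_real, Real.norm_of_nonneg (Real.exp_pos _).le]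
    have h1 := norm_exp_mul_sub_one_le z (le_of_lt hx) hr0 (le_max_left z.re 0)
    refine (mul_le_mul_of_nonneg_right h1 (Real.exp_pos _).le).trans (le_of_eq ?_)
    rw [mul_assoc, mul_assoc, ← Real.exp_add]
    congr 3
    ring
  have hprod : Integrable (Function.uncurry f) ((volume.restrict (Ioi 0)).prod μ) := by
    rw [integrable_prod_iff' hfm.aestronglyMeasurable]
    refine ⟨h.ae_le.mono fun u hu => integrableOn_exp_sub_one_mul_exp (h.pos.trans_le hu)
      (hz.trans_le hu), ?_⟩
    refine Integrable.mono' (hsq.const_mul (‖z‖ * (ρ / (ρ - r)) ^ 2)) ?_ ?_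
    · exact (hfm.norm.aestronglyMeasurable (μ := (volume.restrict (Ioi 0)).prod μ)).prod_swap.integral_prod_right'
    · filter_upwards [h.ae_le] with u hu
      have hur : 0 < u - r := by linarith
      have hu0 : 0 < u := hρ.trans_le hu
      rw [Real.norm_of_nonneg (integral_nonneg fun x => norm_nonneg _)]
      calc ∫ x in Ioi (0 : ℝ), ‖f x u‖
          ≤ ∫ x in Ioi (0 : ℝ), ‖z‖ * (x * Real.exp (-((u - r) * x))) := by
            refine setIntegral_mono_on (integrableOn_exp_sub_one_mul_exp hu0
              (hz.trans_le hu)).norm ((integrableOn_mul_exp hur).const_mul _)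
              measurableSet_Ioi (hbound u hu)
        _ = ‖z‖ * (u - r)⁻¹ ^ 2 := by rw [integral_const_mul, integral_mul_exp hur]
        _ ≤ ‖z‖ * (ρ / (ρ - r)) ^ 2 * u⁻¹ ^ 2 := by
            rw [mul_assoc, ← mul_pow]
            -- The quotient `u / (u - r)` decreases in `u`, so its maximum over `u ≥ ρ` is at `ρ`.
            have h2 : (u - r)⁻¹ ≤ ρ / (ρ - r) * u⁻¹ := by
              have h3 : 0 < ρ - r := by linarith
              rw [inv_eq_one_div, div_mul_eq_mul_div, ← div_eq_mul_inv, div_div,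
                div_le_div_iff₀ hur (by positivity)]
              nlinarith
            gcongr
  have h1 : subordinatorExponent π z = ∫ x in Ioi (0 : ℝ), ∫ u, f x u ∂μ := by
    refine setIntegral_congr_fun measurableSet_Ioi fun x hx => ?_
    simp only [hf]
    rw [integral_const_mul, h.eq_integral hx, integral_complex_ofReal]
  rw [h1, integral_integral_swap hprod, stieltjes, h.integral_powMustar, ← integral_const_mul]
  refine integral_congr_ae ?_
  filter_upwards [h.ae_le] with u hu
  exact integral_exp_sub_one_mul_exp (h.pos.trans_le hu) (hz.trans_le hu)

end Mixing

/-! ### Taylor expansion with Stieltjes remainder, Padé formula and rate of convergence -/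

section Expansion

variable {π : ℝ → ℝ} {μ : Measure ℝ} {ρ : ℝ}

/-- Identifies the integral that the quadrature sum `∑ wᵢ / xᵢ` underestimates with a total mass,
hence with `ψ'(0)` or `ψ''(0) / 2`. -/
lemma IsCMOneSided.integral_inv_powMustar_succ (h : IsCMOneSided π μ ρ) (m : ℕ) :
    ∫ v, v⁻¹ ∂(powMustar μ (m + 1)) = (powMustar μ m).real univ := by
  rw [h.integral_powMustar_succ]
  have : ∫ v, v • v⁻¹ ∂(powMustar μ m) = ∫ _, (1 : ℝ) ∂(powMustar μ m) := by
    refine integral_congr_ae ?_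
    filter_upwards [h.ae_powMustar_mem m] with v hv
    exact mul_inv_cancel₀ hv.1.ne'
  rw [this]
  simp

lemma IsCMOneSided.integrable_inv_powMustar_succ (h : IsCMOneSided π μ ρ)
    (hcut : Integrable fun x => |(if |x| < 1 then x else 0) - 0| * π x) (m : ℕ) :
    Integrable (fun v => v⁻¹) (powMustar μ (2 + m + 1)) := by
  have hfin := h.isFiniteMeasure_powMustar hcut m
  refine ⟨measurable_inv.aestronglyMeasurable, ?_⟩
  rw [hasFiniteIntegral_iff_ofReal
    ((h.ae_powMustar_mem _).mono fun v hv => inv_nonneg.2 hv.1.le)]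
  have hm : ∀ᵐ v ∂(mustar μ), 0 < v := by
    refine ((MeasurableEquiv.inv ℝ).measurableEmbedding.ae_map_iff).2 ?_
    filter_upwards [h.ae_le] with u hu
    exact inv_pos.2 (h.pos.trans_le hu)
  rw [powMustar, lintegral_withDensity_eq_lintegral_mul _ (by fun_prop) (by fun_prop)]
  refine lt_of_eq_of_lt ?_ (measure_lt_top (powMustar μ (2 + m)) univ)
  rw [powMustar, withDensity_apply _ MeasurableSet.univ, Measure.restrict_univ]
  refine lintegral_congr_ae ?_
  filter_upwards [hm] with v hv
  rw [Pi.mul_apply, ← ENNReal.ofReal_mul (by positivity), pow_succ, mul_assoc,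
    mul_inv_cancel₀ hv.ne', mul_one]

/-- One Taylor step, from 1/(1 - zv) = 1 + zv/(1 - zv); the new factor `v` moves into the measure.
-/
lemma IsCMOneSided.stieltjes_succ (h : IsCMOneSided π μ ρ)
    (hcut : Integrable fun x => |(if |x| < 1 then x else 0) - 0| * π x) (m : ℕ) {z : ℂ}
    (hz : z ∈ (Complex.ofReal '' Ici ρ)ᶜ) :
    stieltjes (powMustar μ (2 + m)) z =
      ((powMustar μ (2 + m)).real univ : ℂ) + z * stieltjes (powMustar μ (2 + m + 1)) z := by
  have hfin := h.isFiniteMeasure_powMustar hcut m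
  have hb := h.ae_powMustar_mem (2 + m)
  have hz' : z ∈ (Complex.ofReal '' Ici ρ⁻¹⁻¹)ᶜ := by rwa [inv_inv]
  rw [stieltjes, stieltjes, h.integral_powMustar_succ, ← integral_const_mul]
  have h1 : ((powMustar μ (2 + m)).real univ : ℂ) = ∫ _ : ℝ, (1 : ℂ) ∂(powMustar μ (2 + m)) := by
    simp
  rw [h1, ← integral_add (integrable_const _)]
  · refine integral_congr_ae ?_
    filter_upwards [hb] with v hv
    have := one_sub_mul_ne_zero hz' (Ioc_subset_Icc_self hv)
    rw [Complex.real_smul]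
    field_simp
    ring
  · refine integrable_of_continuousOn_Icc hb ?_
    refine continuousOn_const.mul (ContinuousOn.smul (f := fun v : ℝ => v) (by fun_prop) ?_)
    exact ContinuousOn.div (by fun_prop) (by fun_prop) fun v hv => one_sub_mul_ne_zero hz' hv

lemma stieltjes_zero (ν : Measure ℝ) : stieltjes ν 0 = (ν.real univ : ℂ) := by
  simp [stieltjes]

lemma IsCMOneSided.zero_mem (h : IsCMOneSided π μ ρ) : (0 : ℂ) ∈ (Complex.ofReal '' Ici ρ)ᶜ := by
  rintro ⟨y, hy, hy0⟩
  have : y = 0 := by exact_mod_cast hy0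
  rw [this, mem_Ici] at hy
  exact absurd hy (not_le.2 h.pos)

lemma IsCMOneSided.analyticOnNhd_stieltjes (h : IsCMOneSided π μ ρ)
    (hcut : Integrable fun x => |(if |x| < 1 then x else 0) - 0| * π x) (m : ℕ) :
    AnalyticOnNhd ℂ (stieltjes (powMustar μ (2 + m))) (Complex.ofReal '' Ici ρ)ᶜ := by
  have hfin := h.isFiniteMeasure_powMustar hcut m
  have := LevyPade.analyticOnNhd_stieltjes (h.ae_powMustar_mem (2 + m))
  rwa [inv_inv] at this

lemma deriv_id_mul_zero {G : ℂ → ℂ} (hG : DifferentiableAt ℂ G 0) :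
    deriv (fun z => z * G z) 0 = G 0 := by
  have := (hasDerivAt_id (0 : ℂ)).mul hG.hasDerivAt
  have h2 : deriv (fun z => z * G z) 0 = 1 * G 0 + id 0 * deriv G 0 := this.deriv
  simpa using h2

/-- The analytic continuation of the exponent. -/
noncomputable def extendedExponent (μ : Measure ℝ) (z : ℂ) : ℂ := z * stieltjes (powMustar μ 2) z

lemma IsCMOneSided.eventuallyEq_extendedExponent (h : IsCMOneSided π μ ρ)
    (hcut : Integrable fun x => |(if |x| < 1 then x else 0) - 0| * π x) :
    subordinatorExponent π =ᶠ[𝓝 0] extendedExponent μ := by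
  have : ContinuousAt (fun z : ℂ => z.re) 0 := by fun_prop
  filter_upwards [this.eventually_lt continuousAt_const (by simpa using h.pos)] with z hz
  exact h.subordinatorExponent_eq hcut hz

lemma IsCMOneSided.analyticOnNhd_extendedExponent (h : IsCMOneSided π μ ρ)
    (hcut : Integrable fun x => |(if |x| < 1 then x else 0) - 0| * π x) :
    AnalyticOnNhd ℂ (extendedExponent μ) (Complex.ofReal '' Ici ρ)ᶜ :=
  analyticOnNhd_id.mul (h.analyticOnNhd_stieltjes hcut 0)

lemma IsCMOneSided.iteratedDeriv_one_exponent (h : IsCMOneSided π μ ρ)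
    (hcut : Integrable fun x => |(if |x| < 1 then x else 0) - 0| * π x) :
    iteratedDeriv 1 (subordinatorExponent π) 0 = ((powMustar μ 2).real univ : ℂ) := by
  rw [(h.eventuallyEq_extendedExponent hcut).iteratedDeriv_eq, iteratedDeriv_one]
  refine (deriv_id_mul_zero ?_).trans (stieltjes_zero _)
  exact (h.analyticOnNhd_stieltjes hcut 0 0 h.zero_mem).differentiableAt

lemma IsCMOneSided.iteratedDeriv_two_exponent (h : IsCMOneSided π μ ρ)
    (hcut : Integrable fun x => |(if |x| < 1 then x else 0) - 0| * π x) :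
    iteratedDeriv 2 (subordinatorExponent π) 0 = 2 * ((powMustar μ 3).real univ : ℂ) := by
  set F := stieltjes (powMustar μ 3) with hF
  set M : ℂ := ((powMustar μ 2).real univ : ℂ) with hM
  have hA : AnalyticAt ℂ F 0 := h.analyticOnNhd_stieltjes hcut 1 0 h.zero_mem
  rw [(h.eventuallyEq_extendedExponent hcut).iteratedDeriv_eq, iteratedDeriv_succ,
    iteratedDeriv_one]
  have h1 : extendedExponent μ =ᶠ[𝓝 0] fun z => z * (M + z * F z) := by
    filter_upwards [(isOpen_compl_ofReal_Ici ρ).mem_nhds h.zero_mem] with z hz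
    rw [extendedExponent, h.stieltjes_succ hcut 0 hz]
  have h2 : deriv (extendedExponent μ) =ᶠ[𝓝 0] fun z => M + z * (2 * F z + z * deriv F z) := by
    refine h1.deriv.trans ?_
    filter_upwards [hA.eventually_analyticAt] with z hz
    have hd := ((hasDerivAt_id z).mul
      (((hasDerivAt_id z).mul hz.differentiableAt.hasDerivAt).const_add M)).deriv
    refine Eq.trans hd ?_
    simp only [id_eq, Pi.mul_apply]
    ring
  have h3 : DifferentiableAt ℂ (fun z => 2 * F z + z * deriv F z) 0 :=
    (hA.differentiableAt.const_mul 2).add (differentiableAt_id.mul hA.deriv.differentiableAt)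
  rw [h2.deriv_eq, deriv_const_add, deriv_id_mul_zero h3, zero_mul, add_zero, hF, stieltjes_zero]

open Polynomial in
/-- The Taylor polynomial of degree `k` without the constant term. -/
noncomputable def taylorPart (ψ : ℂ → ℂ) (k : ℕ) : ℂ[X] :=
  ∑ j ∈ Finset.Icc 1 k, C (iteratedDeriv j ψ 0 / (j.factorial : ℂ)) * X ^ j

lemma natDegree_taylorPart_le (ψ : ℂ → ℂ) (k : ℕ) : (taylorPart ψ k).natDegree ≤ k := by
  refine Polynomial.natDegree_sum_le_of_forall_le _ _ fun j hj => ?_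
  exact (Polynomial.natDegree_C_mul_X_pow_le _ _).trans (Finset.mem_Icc.1 hj).2

lemma eval_taylorPart (ψ : ℂ → ℂ) (k : ℕ) (z : ℂ) : (taylorPart ψ k).eval z =
    ∑ j ∈ Finset.Icc 1 k, iteratedDeriv j ψ 0 * z ^ j / (j.factorial : ℂ) := by
  rw [taylorPart, Polynomial.eval_finsetSum]
  refine Finset.sum_congr rfl fun j _ => ?_
  simp only [Polynomial.eval_mul, Polynomial.eval_C, Polynomial.eval_pow, Polynomial.eval_X]
  ring

lemma quadratureFormula_eq (ψ : ℂ → ℂ) (k n : ℕ) (x w : Fin n → ℝ) (z : ℂ) :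
    quadratureFormula ψ k n x w z =
      (taylorPart ψ k).eval z + z ^ (k + 1) * ∑ i, (w i : ℂ) / (1 - z * x i) := by
  rw [quadratureFormula, eval_taylorPart]

lemma IsCMOneSided.extendedExponent_eq (h : IsCMOneSided π μ ρ)
    (hcut : Integrable fun x => |(if |x| < 1 then x else 0) - 0| * π x) {k : ℕ} (hk : k ≤ 2)
    {z : ℂ} (hz : z ∈ (Complex.ofReal '' Ici ρ)ᶜ) :
    extendedExponent μ z = (taylorPart (subordinatorExponent π) k).eval z +
      z ^ (k + 1) * stieltjes (powMustar μ (2 + k)) z := by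
  have e0 := h.stieltjes_succ hcut 0 hz
  have e1 := h.stieltjes_succ hcut 1 hz
  simp only [Nat.add_zero, Nat.reduceAdd] at e0 e1
  rw [eval_taylorPart, extendedExponent]
  interval_cases k
  · simp
  · simp [h.iteratedDeriv_one_exponent hcut, e0]
    ring
  · have : Finset.Icc 1 2 = {1, 2} := rfl
    simp [this, h.iteratedDeriv_one_exponent hcut, h.iteratedDeriv_two_exponent hcut, e0, e1]
    ring

variable {k n : ℕ} {x w : Fin n → ℝ}

/-- The Taylor parts cancel, and z^{k+1} times the quadrature error O(z^{2n}) has exactly the Padé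
order for numerator degree `n + k` and denominator degree `n`. -/
lemma IsCMOneSided.isBigO_formula_sub (h : IsCMOneSided π μ ρ)
    (hcut : Integrable fun x => |(if |x| < 1 then x else 0) - 0| * π x) (hk : k ≤ 2)
    (hn1 : 1 ≤ n) (hn : (n : ℕ∞) < μ.support.encard)
    (hq : IsGaussianQuadrature (powMustar μ (2 + k)) n x w) :
    (fun z => (taylorPart (subordinatorExponent π) k).eval z +
      z ^ (k + 1) * ∑ i, (w i : ℂ) / (1 - z * x i) - subordinatorExponent π z) =O[𝓝 0]
      fun z : ℂ => z ^ (n + k + n + 1) := by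
  have hfin := h.isFiniteMeasure_powMustar hcut k
  have hb := h.ae_powMustar_mem (2 + k)
  have hp := h.not_ae_eval_eq_zero hn (2 + k)
  have h1 := hq.isBigO_stieltjes_sub hb (inv_pos.2 h.pos) hn1
    (fun i => (hq.weight_pos hb hp i).le)
    fun i => ⟨(hq.node_pos hb hp i).le, hq.node_le hb hp i⟩
  refine ((Asymptotics.isBigO_refl (fun z : ℂ => z ^ (k + 1)) (𝓝 0)).mul h1).congr' ?_ ?_
  · filter_upwards [h.eventuallyEq_extendedExponent hcut,
      (isOpen_compl_ofReal_Ici ρ).mem_nhds h.zero_mem] with z hz hz'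
    rw [hz, h.extendedExponent_eq hcut hk hz']
    ring
  · refine Eventually.of_forall fun z => ?_
    simp only
    rw [← pow_add]
    congr 1
    omega

lemma IsCMOneSided.analyticAt_exponent (h : IsCMOneSided π μ ρ)
    (hcut : Integrable fun x => |(if |x| < 1 then x else 0) - 0| * π x) :
    AnalyticAt ℂ (subordinatorExponent π) 0 :=
  (h.analyticOnNhd_extendedExponent hcut 0 h.zero_mem).congr
    (h.eventuallyEq_extendedExponent hcut).symm

/-- The poles are the points `1 / xᵢ`, and `0 < xᵢ ≤ 1 / ρ` puts them on `[ρ, ∞)`. -/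
lemma IsCMOneSided.pade_eq_formula (h : IsCMOneSided π μ ρ)
    (hcut : Integrable fun x => |(if |x| < 1 then x else 0) - 0| * π x) (hk : k ≤ 2)
    (hn1 : 1 ≤ n) (hn : (n : ℕ∞) < μ.support.encard)
    (hq : IsGaussianQuadrature (powMustar μ (2 + k)) n x w) {R S : Polynomial ℂ}
    (hRS : IsPade (subordinatorExponent π) 0 (n + k) n R S) :
    (∀ z, z ∈ (Complex.ofReal '' Ici ρ)ᶜ → S.eval z ≠ 0) ∧
    ∀ z, S.eval z ≠ 0 →
      R.eval z / S.eval z = quadratureFormula (subordinatorExponent π) k n x w z := by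
  have hfin := h.isFiniteMeasure_powMustar hcut k
  have hb := h.ae_powMustar_mem (2 + k)
  have hp := h.not_ae_eval_eq_zero hn (2 + k)
  obtain ⟨h1, h2⟩ := hRS.eq_formula hq.injective (fun i => (hq.node_pos hb hp i).ne')
    (fun i => (hq.weight_pos hb hp i).ne') (natDegree_taylorPart_le _ _)
    (h.isBigO_formula_sub hcut hk hn1 hn hq)
  refine ⟨fun z hz h0 => ?_, fun z hz => ?_⟩
  · obtain ⟨i, hi⟩ := (h1 z).1 h0
    refine hz ⟨(x i)⁻¹, ?_, by rw [hi]; push_cast; rfl⟩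
    have := inv_anti₀ (hq.node_pos hb hp i) (hq.node_le hb hp i)
    rwa [inv_inv] at this
  · rw [h2 z hz, quadratureFormula_eq]

lemma IsCMOneSided.exists_pade (h : IsCMOneSided π μ ρ)
    (hcut : Integrable fun x => |(if |x| < 1 then x else 0) - 0| * π x) (hk : k ≤ 2)
    (hn1 : 1 ≤ n) (hn : (n : ℕ∞) < μ.support.encard)
    (hq : IsGaussianQuadrature (powMustar μ (2 + k)) n x w) :
    ∃ R S : Polynomial ℂ, IsPade (subordinatorExponent π) 0 (n + k) n R S :=
  ⟨_, _, isPade_padeNum (h.analyticAt_exponent hcut) (natDegree_taylorPart_le _ _)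
    (h.isBigO_formula_sub hcut hk hn1 hn hq)⟩

lemma IsCMOneSided.exists_quadrature (h : IsCMOneSided π μ ρ)
    (hcut : Integrable fun x => |(if |x| < 1 then x else 0) - 0| * π x) (k : ℕ)
    (hn : (n : ℕ∞) < μ.support.encard) :
    ∃ x w : Fin n → ℝ, IsGaussianQuadrature (powMustar μ (2 + k)) n x w := by
  have hfin := h.isFiniteMeasure_powMustar hcut k
  exact exists_gaussianQuadrature (h.ae_powMustar_mem (2 + k)) (h.not_ae_eval_eq_zero hn (2 + k))

/-- The Padé approximants converge locally uniformly at a geometric rate. -/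
lemma IsCMOneSided.exists_rate (h : IsCMOneSided π μ ρ)
    (hcut : Integrable fun x => |(if |x| < 1 then x else 0) - 0| * π x) (hk : k ≤ 2)
    {A : Set ℂ} (hA : IsCompact A) (hsub : A ⊆ (Complex.ofReal '' Ici ρ)ᶜ) :
    ∃ c₁ c₂ : ℝ, 0 < c₁ ∧ 0 < c₂ ∧
      ∀ n : ℕ, 1 ≤ n → (n : ℕ∞) < μ.support.encard →
      ∀ R S : Polynomial ℂ, IsPade (subordinatorExponent π) 0 (n + k) n R S →
      ∀ z ∈ A, S.eval z ≠ 0 ∧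
        ‖R.eval z / S.eval z - extendedExponent μ z‖ < c₁ * Real.exp (-(c₂ * n)) := by
  have hfin := h.isFiniteMeasure_powMustar hcut k
  have hb := h.ae_powMustar_mem (2 + k)
  have hsub' : A ⊆ (Complex.ofReal '' Ici ρ⁻¹⁻¹)ᶜ := by rwa [inv_inv]
  obtain ⟨r, hr0, hr1, hr⟩ := exists_uniform_center (inv_pos.2 h.pos) hA hsub'
  obtain ⟨K, hK0, hK⟩ := exists_bound_one_div hA hsub'
  obtain ⟨D, hD⟩ := hA.exists_bound_of_continuousOn (f := fun z : ℂ => z ^ (k + 1)) (by fun_prop)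
  set D' := max D 0 with hD'
  set C := D' * (2 * (powMustar μ (2 + k)).real univ * K) with hC
  have hC0 : 0 ≤ C := by positivity
  -- The rate makes the exponential equal to `r ^ (2 * n)`; the summand 1 gives a positive constant
  -- and a strict inequality.
  refine ⟨C + 1, -2 * Real.log r, by positivity, ?_, ?_⟩
  · have := Real.log_neg hr0 hr1
    linarith
  intro n hn1 hn R S hRS z hz
  obtain ⟨x, w, hq⟩ := h.exists_quadrature hcut k hn
  have hp := h.not_ae_eval_eq_zero hn (2 + k)
  obtain ⟨h1, h2⟩ := h.pade_eq_formula hcut hk hn1 hn hq hRS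
  have hS := h1 z (hsub hz)
  refine ⟨hS, ?_⟩
  have hexp : Real.exp (-(-2 * Real.log r * n)) = r ^ (2 * n) := by
    rw [← Real.rpow_natCast, Real.rpow_def_of_pos hr0]
    congr 1
    push_cast
    ring
  rw [hexp, h2 z hS, quadratureFormula_eq, h.extendedExponent_eq hcut hk (hsub hz),
    add_sub_add_left_eq_sub, ← mul_sub, norm_mul]
  obtain ⟨c, hc, hcv⟩ := hr z hz
  have h3 := hq.norm_stieltjes_sub_le hb hn1 (fun i => (hq.weight_pos hb hp i).le)
    (fun i => ⟨(hq.node_pos hb hp i).le, hq.node_le hb hp i⟩) (hsub' hz) hc (hK z hz) hcv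
  have h4 : ‖z ^ (k + 1)‖ ≤ D' := (hD z hz).trans (le_max_left _ _)
  have h5 := mul_le_mul h4 h3 (norm_nonneg _) (le_max_right _ _)
  have h6 : 0 < r ^ (2 * n) := by positivity
  calc _ ≤ D' * (2 * (powMustar μ (2 + k)).real univ * K * r ^ (2 * n)) := h5
    _ = C * r ^ (2 * n) := by rw [hC]; ring
    _ < _ := by nlinarith

end Expansion

/-! ### Lévy processes through the joint characteristic function of increments -/

section Increments

/-- The joint characteristic function of the increments of `X` is that of a Lévy process with
exponent `η`. -/
def HasIncrementExponent {Ω : Type*} [MeasurableSpace Ω] (X : ℝ≥0 → Ω → ℝ) (P : Measure Ω)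
    (η : ℝ → ℂ) : Prop :=
  ∀ (n : ℕ) (t : Fin (n + 1) → ℝ≥0), Monotone t → ∀ θ : Fin n → ℝ,
    ∫ ω, Complex.exp (((∑ i, θ i * (X (t i.succ) ω - X (t i.castSucc) ω) : ℝ) : ℂ) * Complex.I) ∂P =
      Complex.exp (∑ i, (((t i.succ : ℝ) - (t i.castSucc : ℝ) : ℝ) : ℂ) * η (θ i))

variable {Ω : Type*} [MeasurableSpace Ω] {X : ℝ≥0 → Ω → ℝ} {P : Measure Ω} {η : ℝ → ℂ}

lemma HasIncrementExponent.charFun_sub (h : HasIncrementExponent X P η) (hm : ∀ t, Measurable (X t))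
    {s t : ℝ≥0} (hst : s ≤ t) (θ : ℝ) :
    charFun (P.map fun ω => X t ω - X s ω) θ =
      Complex.exp ((((t : ℝ) - (s : ℝ) : ℝ) : ℂ) * η θ) := by
  have h1 := h 1 ![s, t] (by
    intro i j hij
    fin_cases i <;> fin_cases j <;> simp_all) (fun _ => θ)
  simp only [Finset.univ_unique, Finset.sum_singleton] at h1
  rw [charFun_apply_real, integral_map ((hm t).fun_sub (hm s)).aemeasurable (by fun_prop)]
  refine Eq.trans ?_ h1
  congr 1
  ext ω
  simp

/-- The joint characteristic function of the increments is the product of the marginal ones, which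
characterises independence. -/
lemma HasIncrementExponent.hasIndepIncrements [IsProbabilityMeasure P]
    (h : HasIncrementExponent X P η) (hm : ∀ t, Measurable (X t)) : HasIndepIncrements X P := by
  intro n t ht
  rw [iIndepFun_iff_charFun_pi fun i => ((hm _).fun_sub (hm _)).aemeasurable]
  intro θ
  have h2 : ∀ i : Fin n, charFun (P.map fun ω => X (t i.succ) ω - X (t i.castSucc) ω) (θ i) =
      Complex.exp ((((t i.succ : ℝ) - (t i.castSucc : ℝ) : ℝ) : ℂ) * η (θ i)) := fun i =>
    h.charFun_sub hm (ht (Fin.castSucc_le_succ i)) (θ i)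
  simp_rw [h2]
  rw [← Complex.exp_sum, ← h n t ht θ, charFun_apply, integral_map]
  · refine integral_congr_ae (Eventually.of_forall fun ω => ?_)
    simp only [PiLp.inner_apply, RCLike.inner_apply, conj_trivial]
  · exact ((WithLp.measurable_toLp 2 _).comp
      (measurable_pi_lambda _ fun i => (hm _).fun_sub (hm _))).aemeasurable
  · exact (by fun_prop : Continuous _).aestronglyMeasurable

lemma HasIncrementExponent.identDistrib [IsProbabilityMeasure P] (h : HasIncrementExponent X P η)
    (hm : ∀ t, Measurable (X t)) (h0 : ∀ᵐ ω ∂P, X 0 ω = 0) (s t : ℝ≥0) :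
    IdentDistrib (fun ω => X (s + t) ω - X s ω) (X t) P P where
  aemeasurable_fst := ((hm _).fun_sub (hm _)).aemeasurable
  aemeasurable_snd := (hm _).aemeasurable
  map_eq := by
    have e : P.map (X t) = P.map (fun ω => X t ω - X 0 ω) := by
      refine Measure.map_congr ?_
      filter_upwards [h0] with ω hω
      rw [hω, sub_zero]
    rw [e]
    have := Measure.isProbabilityMeasure_map (μ := P) ((hm (s + t)).fun_sub (hm s)).aemeasurable
    have := Measure.isProbabilityMeasure_map (μ := P) ((hm t).fun_sub (hm 0)).aemeasurable
    refine Measure.ext_of_charFun (funext fun θ => ?_)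
    have e1 := h.charFun_sub hm (le_self_add : s ≤ s + t) θ
    have e2 := h.charFun_sub hm (zero_le (a := t)) θ
    refine e1.trans (Eq.trans ?_ e2.symm)
    simp

lemma HasIncrementExponent.integral_exp [IsProbabilityMeasure P] (h : HasIncrementExponent X P η)
    (hm : ∀ t, Measurable (X t)) (h0 : ∀ᵐ ω ∂P, X 0 ω = 0) (θ : ℝ) :
    ∫ ω, Complex.exp ((θ : ℂ) * Complex.I * (X 1 ω : ℂ)) ∂P = Complex.exp (η θ) := by
  have h1 := h.charFun_sub hm (zero_le (a := (1 : ℝ≥0))) θ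
  rw [charFun_apply_real, integral_map ((hm _).fun_sub (hm _)).aemeasurable (by fun_prop)] at h1
  simp only [NNReal.coe_one, NNReal.coe_zero, sub_zero, Complex.ofReal_one, one_mul] at h1
  rw [← h1]
  refine integral_congr_ae ?_
  filter_upwards [h0] with ω hω
  rw [hω, sub_zero]
  congr 1
  ring

lemma HasIncrementExponent.add_const_mul (h : HasIncrementExponent X P η) (a : ℝ) :
    HasIncrementExponent (fun t ω => X t ω + a * t) P
      (fun θ => η θ + (a : ℂ) * θ * Complex.I) := by
  intro n t ht θ
  have h1 := h n t ht θ
  have e : ∀ ω, Complex.exp (((∑ i, θ i * ((X (t i.succ) ω + a * t i.succ) -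
      (X (t i.castSucc) ω + a * t i.castSucc)) : ℝ) : ℂ) * Complex.I) =
      Complex.exp (((∑ i, θ i * (X (t i.succ) ω - X (t i.castSucc) ω) : ℝ) : ℂ) * Complex.I) *
      Complex.exp (∑ i, (((t i.succ : ℝ) - (t i.castSucc : ℝ) : ℝ) : ℂ) *
        ((a : ℂ) * θ i * Complex.I)) := fun ω => by
    rw [← Complex.exp_add]
    congr 1
    push_cast
    rw [Finset.sum_mul, Finset.sum_mul, ← Finset.sum_add_distrib]
    refine Finset.sum_congr rfl fun i _ => ?_
    ring
  simp_rw [e]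
  rw [integral_mul_const, h1, ← Complex.exp_add, ← Finset.sum_add_distrib]
  simp_rw [mul_add]

lemma HasIncrementExponent.const_mul (h : HasIncrementExponent X P η) (c : ℝ) :
    HasIncrementExponent (fun t ω => c * X t ω) P (fun θ => η (θ * c)) := by
  intro n t ht θ
  have h1 := h n t ht (fun i => θ i * c)
  rw [← h1]
  refine integral_congr_ae (Eventually.of_forall fun ω => ?_)
  have e : ∑ i, θ i * (c * X (t i.succ) ω - c * X (t i.castSucc) ω) =
      ∑ i, θ i * c * (X (t i.succ) ω - X (t i.castSucc) ω) :=
    Finset.sum_congr rfl fun i _ => by ring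
  simp only [e]

lemma HasIncrementExponent.add_prod {Ω' : Type*} [MeasurableSpace Ω'] {Y : ℝ≥0 → Ω' → ℝ}
    {P' : Measure Ω'} [SFinite P] [SFinite P'] {η' : ℝ → ℂ}
    (h : HasIncrementExponent X P η) (h' : HasIncrementExponent Y P' η') :
    HasIncrementExponent (fun t (ω : Ω × Ω') => X t ω.1 + Y t ω.2) (P.prod P')
      (fun θ => η θ + η' θ) := by
  intro n t ht θ
  have e : ∀ ω : Ω × Ω', Complex.exp (((∑ i, θ i * ((X (t i.succ) ω.1 + Y (t i.succ) ω.2) -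
      (X (t i.castSucc) ω.1 + Y (t i.castSucc) ω.2)) : ℝ) : ℂ) * Complex.I) =
      Complex.exp (((∑ i, θ i * (X (t i.succ) ω.1 - X (t i.castSucc) ω.1) : ℝ) : ℂ) * Complex.I) *
      Complex.exp (((∑ i, θ i * (Y (t i.succ) ω.2 - Y (t i.castSucc) ω.2) : ℝ) : ℂ) *
        Complex.I) := fun ω => by
    have e1 : ∑ i, θ i * ((X (t i.succ) ω.1 + Y (t i.succ) ω.2) -
        (X (t i.castSucc) ω.1 + Y (t i.castSucc) ω.2)) =
        ∑ i, θ i * (X (t i.succ) ω.1 - X (t i.castSucc) ω.1) +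
        ∑ i, θ i * (Y (t i.succ) ω.2 - Y (t i.castSucc) ω.2) := by
      rw [← Finset.sum_add_distrib]
      exact Finset.sum_congr rfl fun i _ => by ring
    rw [← Complex.exp_add, ← add_mul, ← Complex.ofReal_add, e1]
  simp_rw [e]
  rw [integral_prod_mul (fun ω => Complex.exp (((∑ i, θ i * (X (t i.succ) ω - X (t i.castSucc) ω) : ℝ) : ℂ) * Complex.I))
    (fun ω => Complex.exp (((∑ i, θ i * (Y (t i.succ) ω - Y (t i.castSucc) ω) : ℝ) : ℂ) * Complex.I)),
    h n t ht θ, h' n t ht θ, ← Complex.exp_add, ← Finset.sum_add_distrib]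
  simp_rw [mul_add]

end Increments

/-- Expectation of a product of functions of independent coordinates. -/
lemma integral_infinitePi_prod {ι : Type*} {E : ι → Type*} [∀ i, MeasurableSpace (E i)]
    (μ : ∀ i, Measure (E i)) [∀ i, IsProbabilityMeasure (μ i)] (s : Finset ι)
    {f : ∀ i, E i → ℂ} (hf : ∀ i, Measurable (f i)) :
    ∫ ω, ∏ i ∈ s, f i (ω i) ∂(Measure.infinitePi μ) = ∏ i ∈ s, ∫ y, f i y ∂(μ i) := by
  have h1 := integral_restrict_infinitePi (μ := μ) (s := s)
    (f := fun y : (∀ i : s, E i) => ∏ i : s, f i (y i))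
    (Measurable.aestronglyMeasurable (by fun_prop))
  rw [integral_fintype_prod_eq_prod (μ := fun i : s => μ i) (fun i : s => f i)] at h1
  rw [← Finset.prod_coe_sort s fun i => ∫ y, f i y ∂(μ i), ← h1]
  congr 1
  ext ω
  rw [← Finset.prod_coe_sort s]
  rfl

/-! ### Brownian motion from a Schauder series -/

section Schauder

/-- The tent function on `[0, 1]`. -/
noncomputable def tent (x : ℝ) : ℝ := max 0 (1 / 2 - |x - 1 / 2|)

/-- The covariance of the Brownian bridge, with arguments clamped to `[0, 1]`. -/
noncomputable def bridgeCov (x y : ℝ) : ℝ :=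
  min (max 0 (min 1 x)) (max 0 (min 1 y)) - max 0 (min 1 x) * max 0 (min 1 y)

lemma continuous_tent : Continuous tent := by unfold tent; fun_prop

lemma abs_tent_le (x : ℝ) : |tent x| ≤ if 0 ≤ x ∧ x < 1 then 1 else 0 := by
  have h0 : 0 ≤ tent x := le_max_left _ _
  rw [abs_of_nonneg h0, tent]
  split_ifs with h
  · exact max_le zero_le_one (by linarith [abs_nonneg (x - 1 / 2)])
  · rw [max_le_iff]
    refine ⟨le_rfl, ?_⟩
    by_contra! hlt
    have := abs_lt.1 (by linarith : |x - 1 / 2| < 1 / 2)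
    exact h ⟨by linarith, by linarith⟩

lemma clamp_cases (x : ℝ) : (x ≤ 0 ∧ max 0 (min 1 x) = 0) ∨
    (0 ≤ x ∧ x ≤ 1 ∧ max 0 (min 1 x) = x) ∨ (1 ≤ x ∧ max 0 (min 1 x) = 1) := by
  rcases le_total x 0 with h | h
  · exact Or.inl ⟨h, by simp [h]⟩
  · rcases le_total x 1 with h1 | h1
    · exact Or.inr (Or.inl ⟨h, h1, by simp [h, h1]⟩)
    · exact Or.inr (Or.inr ⟨h1, by simp [h1]⟩)

lemma abs_bridgeCov_le (x y : ℝ) : |bridgeCov x y| ≤ if 0 ≤ x ∧ x < 1 then 1 else 0 := by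
  unfold bridgeCov
  have hy0 : 0 ≤ max 0 (min 1 y) := le_max_left _ _
  have hy1 : max 0 (min 1 y) ≤ 1 := max_le zero_le_one (min_le_left _ _)
  set y' := max 0 (min 1 y)
  split_ifs with h
  · have hx0 : 0 ≤ max 0 (min 1 x) := le_max_left _ _
    have hx1 : max 0 (min 1 x) ≤ 1 := max_le zero_le_one (min_le_left _ _)
    set x' := max 0 (min 1 x)
    have h1 : x' * y' ≤ 1 := mul_le_one₀ hx1 hy0 hy1
    have h2 := mul_nonneg hx0 hy0
    have h3 : 0 ≤ min x' y' := le_min hx0 hy0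
    have h4 : min x' y' ≤ 1 := (min_le_left _ _).trans hx1
    rw [abs_le]
    constructor <;> linarith
  · rcases clamp_cases x with ⟨-, h2⟩ | ⟨h1, h2, h3⟩ | ⟨-, h2⟩
    · rw [h2]; simp [hy0]
    · have : x = 1 := le_antisymm h2 (by by_contra! hlt; exact h ⟨h1, hlt⟩)
      rw [h3, this]; simp [hy1]
    · rw [h2]; simp [hy1]

lemma bridgeCov_comm (x y : ℝ) : bridgeCov x y = bridgeCov y x := by
  rw [bridgeCov, bridgeCov, min_comm, mul_comm]

lemma bridgeCov_of_le {x y : ℝ} (h : x ≤ y) :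
    bridgeCov x y = max 0 (min 1 x) * (1 - max 0 (min 1 y)) := by
  rw [bridgeCov, min_eq_left (by gcongr)]
  ring

lemma clamp_tent_cases (z : ℝ) :
    (z < 0 ∧ max 0 (min 1 z) = 0 ∧ tent z = 0 ∧ max 0 (min 1 (2 * z)) = 0 ∧
      max 0 (min 1 (2 * z - 1)) = 0) ∨
    ((0 ≤ z ∧ z < 1 / 2) ∧ max 0 (min 1 z) = z ∧ tent z = z ∧ max 0 (min 1 (2 * z)) = 2 * z ∧
      max 0 (min 1 (2 * z - 1)) = 0) ∨
    ((1 / 2 ≤ z ∧ z < 1) ∧ max 0 (min 1 z) = z ∧ tent z = 1 - z ∧ max 0 (min 1 (2 * z)) = 1 ∧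
      max 0 (min 1 (2 * z - 1)) = 2 * z - 1) ∨
    (1 ≤ z ∧ max 0 (min 1 z) = 1 ∧ tent z = 0 ∧ max 0 (min 1 (2 * z)) = 1 ∧
      max 0 (min 1 (2 * z - 1)) = 1) := by
  have c0 : ∀ z : ℝ, z ≤ 0 → max 0 (min 1 z) = 0 := fun z hz => by simp [hz]
  have c1 : ∀ z : ℝ, 1 ≤ z → max 0 (min 1 z) = 1 := fun z hz => by simp [hz]
  have cm : ∀ z : ℝ, 0 ≤ z → z ≤ 1 → max 0 (min 1 z) = z := fun z h0 h1 => by simp [h0, h1]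
  rcases lt_or_ge z 0 with h | h
  · refine Or.inl ⟨h, c0 _ h.le, ?_, c0 _ (by linarith), c0 _ (by linarith)⟩
    rw [tent, max_eq_left]
    rw [abs_of_nonpos (by linarith)]; linarith
  rcases lt_or_ge z (1 / 2) with h1 | h1
  · refine Or.inr (Or.inl ⟨⟨h, h1⟩, cm _ h (by linarith), ?_,
      cm _ (by linarith) (by linarith), c0 _ (by linarith)⟩)
    rw [tent, abs_of_nonpos (by linarith), max_eq_right] <;> linarith
  rcases lt_or_ge z 1 with h2 | h2
  · refine Or.inr (Or.inr (Or.inl ⟨⟨h1, h2⟩, cm _ h h2.le, ?_, c1 _ (by linarith),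
      cm _ (by linarith) (by linarith)⟩))
    rw [tent, abs_of_nonneg (by linarith), max_eq_right] <;> linarith
  · refine Or.inr (Or.inr (Or.inr ⟨h2, c1 _ h2, ?_, c1 _ (by linarith), c1 _ (by linarith)⟩))
    rw [tent, max_eq_left]
    rw [abs_of_nonneg (by linarith)]; linarith

/-- Lévy's midpoint construction: a bridge is its linear interpolation through the midpoint, with
variance `1/4 = tent(1/2)²` there, plus two independent half-size bridges. Clamping makes each small
bridge vanish off its own half. -/
lemma bridgeCov_eq (x y : ℝ) : bridgeCov x y = tent x * tent y +
    1 / 2 * (bridgeCov (2 * x) (2 * y) + bridgeCov (2 * x - 1) (2 * y - 1)) := by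
  wlog hxy : x ≤ y generalizing x y
  · rw [bridgeCov_comm, this y x (le_of_not_ge hxy), bridgeCov_comm (2 * y),
      bridgeCov_comm (2 * y - 1), mul_comm (tent y)]
  rw [bridgeCov_of_le hxy, bridgeCov_of_le (by linarith), bridgeCov_of_le (by linarith)]
  rcases clamp_tent_cases x with ⟨hx, a1, a2, a3, a4⟩ | ⟨hx, a1, a2, a3, a4⟩ |
      ⟨hx, a1, a2, a3, a4⟩ | ⟨hx, a1, a2, a3, a4⟩ <;>
    rcases clamp_tent_cases y with ⟨hy, b1, b2, b3, b4⟩ | ⟨hy, b1, b2, b3, b4⟩ |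
      ⟨hy, b1, b2, b3, b4⟩ | ⟨hy, b1, b2, b3, b4⟩ <;>
    rw [a1, a2, a3, a4, b1, b2, b3, b4] <;>
    first | (exfalso; linarith) | ring

/-- The integer translates of `[0, 1)` are disjoint; the indicator is written as a difference of two
half-line indicators, and the sum telescopes. -/
lemma sum_abs_translates_le_one {f : ℝ → ℝ} (hf : ∀ y, |f y| ≤ if 0 ≤ y ∧ y < 1 then 1 else 0)
    (x : ℝ) (N : ℕ) : ∑ i ∈ Finset.range N, |f (x - i)| ≤ 1 := by
  have h1 : ∀ i : ℕ, |f (x - i)| ≤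
      (if (0 : ℝ) ≤ x - i then (1 : ℝ) else 0) - if (0 : ℝ) ≤ x - (i + 1 : ℕ) then 1 else 0 := by
    intro i
    refine (hf _).trans ?_
    push_cast
    split_ifs <;> grind
  refine (Finset.sum_le_sum fun i _ => h1 i).trans ?_
  rw [Finset.sum_range_sub' (fun i : ℕ => if (0 : ℝ) ≤ x - i then (1 : ℝ) else 0)]
  split_ifs <;> norm_num

lemma sum_range_two_mul {M : Type*} [AddCommMonoid M] (f : ℕ → M) (m : ℕ) :
    ∑ i ∈ Finset.range (2 * m), f i = ∑ i ∈ Finset.range m, (f (2 * i) + f (2 * i + 1)) := by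
  induction m with
  | zero => simp
  | succ m ih =>
    rw [show 2 * (m + 1) = 2 * m + 1 + 1 by ring, Finset.sum_range_succ, Finset.sum_range_succ, ih,
      Finset.sum_range_succ, add_assoc]

lemma sum_tent_mul_tent (s t : ℝ) (N : ℕ) :
    ∑ j ∈ Finset.range N, (1 / 2 : ℝ) ^ j *
      ∑ i ∈ Finset.range (2 ^ j), tent (2 ^ j * s - i) * tent (2 ^ j * t - i) =
    bridgeCov s t - (1 / 2) ^ N *
      ∑ i ∈ Finset.range (2 ^ N), bridgeCov (2 ^ N * s - i) (2 ^ N * t - i) := by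
  induction N with
  | zero => simp
  | succ N ih =>
    rw [Finset.sum_range_succ, ih]
    have h1 : ∑ i ∈ Finset.range (2 ^ N), bridgeCov (2 ^ N * s - i) (2 ^ N * t - i) =
        ∑ i ∈ Finset.range (2 ^ N), tent (2 ^ N * s - i) * tent (2 ^ N * t - i) + 1 / 2 *
        ∑ i ∈ Finset.range (2 ^ (N + 1)), bridgeCov (2 ^ (N + 1) * s - i) (2 ^ (N + 1) * t - i) := by
      rw [pow_succ' 2 N, sum_range_two_mul, Finset.mul_sum, ← Finset.sum_add_distrib]
      refine Finset.sum_congr rfl fun i _ => ?_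
      rw [bridgeCov_eq]
      congr 3
      · congr 1 <;> push_cast <;> ring
      · congr 1 <;> push_cast <;> ring
    rw [h1, pow_succ]
    ring

lemma tendsto_sum_tent_mul_tent (s t : ℝ) :
    Tendsto (fun N => ∑ j ∈ Finset.range N, (1 / 2 : ℝ) ^ j *
      ∑ i ∈ Finset.range (2 ^ j), tent (2 ^ j * s - i) * tent (2 ^ j * t - i)) atTop
      (𝓝 (bridgeCov s t)) := by
  simp_rw [sum_tent_mul_tent]
  have h1 : Tendsto (fun N : ℕ => (1 / 2 : ℝ) ^ N *
      ∑ i ∈ Finset.range (2 ^ N), bridgeCov (2 ^ N * s - i) (2 ^ N * t - i)) atTop (𝓝 0) := by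
    refine squeeze_zero_norm (fun N => ?_)
      (tendsto_pow_atTop_nhds_zero_of_lt_one (r := (1 / 2 : ℝ)) (by norm_num) (by norm_num))
    rw [norm_mul, norm_pow, Real.norm_of_nonneg (by norm_num : (0 : ℝ) ≤ 1 / 2)]
    refine mul_le_of_le_one_right (by positivity) ?_
    rw [Real.norm_eq_abs]
    refine (Finset.abs_sum_le_sum_abs _ _).trans ?_
    -- Both arguments are shifted together, so their difference is constant and the kernel is a
    -- function of one variable supported in `[0, 1)`.
    have h2 := sum_abs_translates_le_one (f := fun u => bridgeCov u (u + (2 ^ N * t - 2 ^ N * s)))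
      (fun u => abs_bridgeCov_le _ _) (2 ^ N * s) (2 ^ N)
    refine le_trans (le_of_eq (Finset.sum_congr rfl fun i _ => ?_)) h2
    congr 2
    ring
  simpa using h1.const_sub (bridgeCov s t)

end Schauder

/-! ### Convergence, continuity and law of the Schauder series -/

section Brownian

/-- The sample space of the Schauder coefficients. -/
abbrev SchauderSpace : Type := ((_ : ℕ) × ℕ) → ℝ

/-- Independent standard Gaussian Schauder coefficients. -/
noncomputable def schauderMeasure : Measure SchauderSpace :=
  Measure.infinitePi fun _ => gaussianReal 0 1

instance : IsProbabilityMeasure schauderMeasure := by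
  unfold schauderMeasure; infer_instance

/-- The indices of the first `N` levels. -/
def schauderIndices (N : ℕ) : Finset ((_ : ℕ) × ℕ) :=
  (Finset.range N).sigma fun j => Finset.range (2 ^ j)

/-- The coefficient functions `(1 + t) 2^{-j/2} tent (2^j t / (1 + t) - i)`. -/
noncomputable def schauderCoeff (p : (_ : ℕ) × ℕ) (t : ℝ≥0) : ℝ :=
  (1 + t) * ((√2)⁻¹ ^ p.1 * tent (2 ^ p.1 * (t / (1 + t)) - p.2))

/-- One level of the Schauder series. -/
noncomputable def schauderLevel (ω : SchauderSpace) (j : ℕ) (t : ℝ≥0) : ℝ :=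
  ∑ i ∈ Finset.range (2 ^ j), schauderCoeff ⟨j, i⟩ t * ω ⟨j, i⟩

/-- A bound of one level of the Schauder series, up to the factor `1 + t`. -/
noncomputable def schauderBound (ω : SchauderSpace) (j : ℕ) : ℝ :=
  (√2)⁻¹ ^ j * ((13 / 10) ^ j +
    ((13 / 10) ^ 3)⁻¹ ^ j * ∑ i ∈ Finset.range (2 ^ j), ω ⟨j, i⟩ ^ 4)

lemma schauderBound_nonneg (ω : SchauderSpace) (j : ℕ) : 0 ≤ schauderBound ω j := by
  unfold schauderBound
  have : 0 ≤ ∑ i ∈ Finset.range (2 ^ j), ω ⟨j, i⟩ ^ 4 :=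
    Finset.sum_nonneg fun i _ => by positivity
  positivity

/-- Either `|x| ≤ c` or `|x| ≤ x⁴ / c³`. This bounds the largest of `2 ^ j` Gaussians by a sum of
fourth powers, whose mean is easy. -/
lemma abs_le_add_inv_mul_pow_four {c : ℝ} (hc : 0 < c) (x : ℝ) :
    |x| ≤ c + (c ^ 3)⁻¹ * x ^ 4 := by
  have h4 : x ^ 4 = |x| ^ 4 := by rw [← abs_pow, abs_of_nonneg (by positivity)]
  rcases le_or_gt |x| c with h | h
  · have : 0 ≤ (c ^ 3)⁻¹ * x ^ 4 := by positivity
    linarith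
  · have h1 : c ^ 3 ≤ |x| ^ 3 := pow_le_pow_left₀ hc.le h.le 3
    have h2 : |x| ≤ (c ^ 3)⁻¹ * x ^ 4 := by
      rw [h4, inv_mul_eq_div, le_div_iff₀ (by positivity)]
      nlinarith [abs_nonneg x]
    linarith

/-- At each time at most one tent of a level is nonzero, so the level is controlled by its largest
coefficient, truncated at `c = 1.3 ^ j`. -/
lemma abs_schauderLevel_le (ω : SchauderSpace) (j : ℕ) (t : ℝ≥0) :
    |schauderLevel ω j t| ≤ (1 + t) * schauderBound ω j := by
  have h1 := sum_abs_translates_le_one abs_tent_le (2 ^ j * (t / (1 + t))) (2 ^ j)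
  set B : ℝ := (13 / 10) ^ j + ((13 / 10) ^ 3)⁻¹ ^ j * ∑ i ∈ Finset.range (2 ^ j), ω ⟨j, i⟩ ^ 4
    with hB
  have hω : ∀ i ∈ Finset.range (2 ^ j), |ω ⟨j, i⟩| ≤ B := fun i hi => by
    refine (abs_le_add_inv_mul_pow_four (c := (13 / 10) ^ j) (by positivity) _).trans ?_
    rw [hB, ← pow_mul, mul_comm j 3, pow_mul, ← inv_pow]
    have : ω ⟨j, i⟩ ^ 4 ≤ ∑ i ∈ Finset.range (2 ^ j), ω ⟨j, i⟩ ^ 4 :=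
      Finset.single_le_sum (f := fun i => ω ⟨j, i⟩ ^ 4) (fun i _ => by positivity) hi
    gcongr
  have hB0 : 0 ≤ B := by
    have : 0 ≤ ∑ i ∈ Finset.range (2 ^ j), ω ⟨j, i⟩ ^ 4 :=
      Finset.sum_nonneg fun i _ => by positivity
    positivity
  calc |schauderLevel ω j t|
      ≤ ∑ i ∈ Finset.range (2 ^ j), |schauderCoeff ⟨j, i⟩ t * ω ⟨j, i⟩| :=
        Finset.abs_sum_le_sum_abs _ _
    _ ≤ ∑ i ∈ Finset.range (2 ^ j),
        (1 + (t : ℝ)) * (√2)⁻¹ ^ j * B * |tent (2 ^ j * (t / (1 + t)) - i)| := by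
        refine Finset.sum_le_sum fun i hi => ?_
        have h2 : (0 : ℝ) ≤ 1 + t := by positivity
        have h3 : (0 : ℝ) ≤ (√2)⁻¹ ^ j := by positivity
        simp only [schauderCoeff]
        rw [abs_mul, abs_mul, abs_mul, abs_of_nonneg h2, abs_of_nonneg h3]
        have h4 := mul_le_mul_of_nonneg_left (hω i hi)
          (show 0 ≤ (1 + (t : ℝ)) * (√2)⁻¹ ^ j * |tent (2 ^ j * (t / (1 + t)) - i)| by positivity)
        linarith
    _ ≤ (1 + (t : ℝ)) * (√2)⁻¹ ^ j * B * 1 := by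
        rw [← Finset.mul_sum]
        gcongr
    _ = _ := by rw [schauderBound]; ring

/-- The coefficients for which the Schauder series converges. -/
def schauderGood : Set SchauderSpace := {ω | ∑' j, ENNReal.ofReal (schauderBound ω j) ≠ ∞}

lemma measurable_schauderBound (j : ℕ) : Measurable fun ω => schauderBound ω j := by
  unfold schauderBound; fun_prop

lemma measurableSet_schauderGood : MeasurableSet schauderGood := by
  have : Measurable fun ω => ∑' j, ENNReal.ofReal (schauderBound ω j) :=
    Measurable.tsum fun j => (measurable_schauderBound j).ennreal_ofReal
  exact (this (measurableSet_singleton ∞)).compl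

lemma summable_schauderBound {ω : SchauderSpace} (h : ω ∈ schauderGood) :
    Summable (schauderBound ω) := by
  have := ENNReal.summable_toReal h
  simpa [ENNReal.toReal_ofReal (schauderBound_nonneg ω _)] using this

/-- The expected bounds are geometric with ratios `1.3 / √2` and `√2 / 1.3³`. Both are below 1,
since 1.3 lies strictly between `2^{1/6}` and `2^{1/2}`; so the sum of the bounds has finite mean.
-/
lemma ae_schauderGood : ∀ᵐ ω ∂schauderMeasure, ω ∈ schauderGood := by
  set m : ℝ := ∫ x, x ^ 4 ∂(gaussianReal 0 1) with hm
  have hi : Integrable (fun x : ℝ => x ^ 4) (gaussianReal 0 1) := by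
    have := (memLp_id_gaussianReal (μ := 0) (v := 1) 4).integrable_norm_pow (by norm_num)
    refine this.congr (Eventually.of_forall fun x => ?_)
    simp only [id_eq, Real.norm_eq_abs]
    rw [← abs_pow, abs_of_nonneg (by positivity)]
  have hmp : ∀ p : (_ : ℕ) × ℕ, MeasurePreserving (Function.eval p) schauderMeasure
      (gaussianReal 0 1) := fun p => measurePreserving_eval_infinitePi _ p
  have hiω : ∀ p : (_ : ℕ) × ℕ, Integrable (fun ω : SchauderSpace => ω p ^ 4) schauderMeasure :=
    fun p => (hmp p).integrable_comp_of_integrable hi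
  have hmω : ∀ p : (_ : ℕ) × ℕ, ∫ ω : SchauderSpace, ω p ^ 4 ∂schauderMeasure = m := fun p => by
    have := (hmp p).map_eq
    rw [hm, ← this, integral_map (hmp p).aemeasurable (by fun_prop)]
  have hm0 : 0 ≤ m := integral_nonneg fun x => by positivity
  have hib : ∀ j, Integrable (fun ω => schauderBound ω j) schauderMeasure := fun j => by
    unfold schauderBound
    exact ((integrable_const _).add
      ((integrable_finsetSum _ fun i _ => hiω ⟨j, i⟩).const_mul _)).const_mul _
  have hval : ∀ j, ∫ ω, schauderBound ω j ∂schauderMeasure =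
      ((√2)⁻¹ * (13 / 10)) ^ j + m * ((√2)⁻¹ * ((13 / 10) ^ 3)⁻¹ * 2) ^ j := fun j => by
    unfold schauderBound
    rw [integral_const_mul, integral_add (integrable_const _)
      ((integrable_finsetSum _ fun i _ => hiω ⟨j, i⟩).const_mul _), integral_const_mul,
      integral_finsetSum _ fun i _ => hiω ⟨j, i⟩]
    simp only [hmω, integral_const, probReal_univ, smul_eq_mul, one_mul, Finset.sum_const,
      Finset.card_range, nsmul_eq_mul]
    push_cast
    rw [mul_pow, mul_pow, mul_pow]
    ring
  have hsqrt : (1.4 : ℝ) < √2 := Real.lt_sqrt_of_sq_lt (by norm_num)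
  have hsum : Summable fun j => ∫ ω, schauderBound ω j ∂schauderMeasure := by
    simp_rw [hval]
    have hs0 : 0 < √2 := by positivity
    refine (summable_geometric_of_lt_one (by positivity) ?_).add
      ((summable_geometric_of_lt_one (by positivity) ?_).mul_left m)
    · rw [inv_mul_lt_iff₀ hs0]; linarith
    · rw [mul_assoc, inv_mul_lt_iff₀ hs0]
      norm_num
      linarith
  have hlint : ∫⁻ ω, ∑' j, ENNReal.ofReal (schauderBound ω j) ∂schauderMeasure ≠ ∞ := by
    rw [lintegral_tsum fun j => (measurable_schauderBound j).ennreal_ofReal.aemeasurable]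
    simp_rw [← ofReal_integral_eq_lintegral_ofReal (hib _)
      (Eventually.of_forall fun ω => schauderBound_nonneg ω _)]
    rw [← ENNReal.ofReal_tsum_of_nonneg
      (fun j => integral_nonneg fun ω => schauderBound_nonneg ω j) hsum]
    exact ENNReal.ofReal_ne_top
  filter_upwards [ae_lt_top (Measurable.tsum fun j =>
    (measurable_schauderBound j).ennreal_ofReal) hlint] with ω hω
  exact hω.ne

/-- Brownian motion as the sum of a Schauder series, on the set where the series converges. -/
noncomputable def brownian (t : ℝ≥0) (ω : SchauderSpace) : ℝ :=
  schauderGood.indicator (fun ω => ∑' j, schauderLevel ω j t) ω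

lemma summable_schauderLevel {ω : SchauderSpace} (h : ω ∈ schauderGood) (t : ℝ≥0) :
    Summable fun j => schauderLevel ω j t :=
  Summable.of_norm_bounded ((summable_schauderBound h).mul_left (1 + (t : ℝ)))
    fun j => abs_schauderLevel_le ω j t

lemma tendsto_brownian {ω : SchauderSpace} (h : ω ∈ schauderGood) (t : ℝ≥0) :
    Tendsto (fun N => ∑ p ∈ schauderIndices N, schauderCoeff p t * ω p) atTop
      (𝓝 (brownian t ω)) := by
  rw [brownian, indicator_of_mem h]
  have := (summable_schauderLevel h t).hasSum.tendsto_sum_nat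
  refine this.congr fun N => ?_
  rw [schauderIndices, Finset.sum_sigma]
  rfl

lemma continuous_schauderLevel (ω : SchauderSpace) (j : ℕ) :
    Continuous (schauderLevel ω j) := by
  unfold schauderLevel schauderCoeff
  refine continuous_finsetSum _ fun i _ => ?_
  have h1 : Continuous fun t : ℝ≥0 => (t : ℝ) / (1 + t) :=
    Continuous.div₀ (by fun_prop) (by fun_prop) fun t => by positivity
  have := continuous_tent
  fun_prop

lemma continuous_brownian (ω : SchauderSpace) : Continuous fun t => brownian t ω := by
  by_cases h : ω ∈ schauderGood
  · have e : (fun t => brownian t ω) =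
        fun t : ℝ≥0 => ∑' j, schauderLevel ω j t := by
      ext t; rw [brownian, indicator_of_mem h]
    rw [e, continuous_iff_continuousAt]
    intro t
    have h1 : ContinuousOn (fun t : ℝ≥0 => ∑' j, schauderLevel ω j t) (Iio (t + 1)) := by
      refine continuousOn_tsum (u := fun j => (1 + ((t : ℝ) + 1)) * schauderBound ω j)
        (fun j => (continuous_schauderLevel ω j).continuousOn)
        ((summable_schauderBound h).mul_left _) fun j s hs => ?_
      refine (abs_schauderLevel_le ω j s).trans ?_
      have h2 : (s : ℝ) ≤ t + 1 := by exact_mod_cast (le_of_lt hs)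
      have := schauderBound_nonneg ω j
      gcongr
    exact h1.continuousAt (Iio_mem_nhds (lt_add_of_pos_right t one_pos))
  · simp only [brownian, indicator_of_notMem h]
    exact continuous_const

lemma measurable_brownian (t : ℝ≥0) : Measurable (brownian t) := by
  refine measurable_of_tendsto_metrizable (f := fun N => schauderGood.indicator
    (fun ω => ∑ p ∈ schauderIndices N, schauderCoeff p t * ω p)) (fun N => ?_) ?_
  · exact Measurable.indicator (by fun_prop) measurableSet_schauderGood
  · rw [tendsto_pi_nhds]
    intro ω
    by_cases h : ω ∈ schauderGood
    · simpa only [indicator_of_mem h] using tendsto_brownian h t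
    · simp only [indicator_of_notMem h, brownian]
      exact tendsto_const_nhds

lemma brownian_zero (ω : SchauderSpace) : brownian 0 ω = 0 := by
  by_cases h : ω ∈ schauderGood
  · refine tendsto_nhds_unique (tendsto_brownian h 0) (tendsto_const_nhds.congr fun N => ?_)
    refine (Finset.sum_eq_zero fun p _ => ?_).symm
    have : tent (-(p.2 : ℝ)) = 0 := by
      have h0 : (0 : ℝ) ≤ p.2 := Nat.cast_nonneg _
      rw [tent, max_eq_left]
      rw [abs_of_nonpos (by linarith)]; linarith
    simp [schauderCoeff, this]
  · rw [brownian, indicator_of_notMem h]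

/-- If `b` is a Brownian bridge on `[0, 1]`, then `(1 + t) b(t / (1 + t))` has the covariance `min s
t`. This time change gives the whole half-line from one series. -/
lemma tendsto_sum_schauderCoeff (s t : ℝ≥0) :
    Tendsto (fun N => ∑ p ∈ schauderIndices N, schauderCoeff p s * schauderCoeff p t) atTop
      (𝓝 (min (s : ℝ) t)) := by
  have h1 := (tendsto_sum_tent_mul_tent ((s : ℝ) / (1 + s)) ((t : ℝ) / (1 + t))).const_mul
    ((1 + (s : ℝ)) * (1 + t))
  have hs0 : (0 : ℝ) < 1 + s := by positivity
  have ht0 : (0 : ℝ) < 1 + t := by positivity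
  have hlim : (1 + (s : ℝ)) * (1 + t) * bridgeCov ((s : ℝ) / (1 + s)) ((t : ℝ) / (1 + t)) =
      min (s : ℝ) t := by
    have key : ∀ s t : ℝ, 0 ≤ s → s ≤ t →
        (1 + s) * (1 + t) * bridgeCov (s / (1 + s)) (t / (1 + t)) = s := by
      intro s t hs hst
      have hs0 : 0 < 1 + s := by linarith
      have ht0 : 0 < 1 + t := by linarith
      have h1 : s / (1 + s) ≤ t / (1 + t) := by
        rw [div_le_div_iff₀ hs0 ht0]; nlinarith
      have e : ∀ r : ℝ, 0 ≤ r → max 0 (min 1 (r / (1 + r))) = r / (1 + r) := fun r hr => by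
        rw [min_eq_right, max_eq_right (by positivity)]
        rw [div_le_one (by linarith)]; linarith
      rw [bridgeCov_of_le h1, e s hs, e t (hs.trans hst)]
      field_simp
      ring
    rcases le_total (s : ℝ) t with h | h
    · rw [key (s : ℝ) (t : ℝ) (NNReal.coe_nonneg s) h, min_eq_left h]
    · rw [bridgeCov_comm, mul_comm (1 + (s : ℝ)),
        key (t : ℝ) (s : ℝ) (NNReal.coe_nonneg t) h, min_eq_right h]
  rw [hlim] at h1
  refine h1.congr fun N => ?_
  rw [schauderIndices, Finset.sum_sigma, Finset.mul_sum]
  refine Finset.sum_congr rfl fun j _ => ?_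
  rw [Finset.mul_sum, Finset.mul_sum]
  refine Finset.sum_congr rfl fun i _ => ?_
  have h2 : (1 / 2 : ℝ) ^ j = (√2)⁻¹ ^ j * (√2)⁻¹ ^ j := by
    rw [← mul_pow, ← mul_inv, Real.mul_self_sqrt two_pos.le, one_div]
  rw [h2]
  simp only [schauderCoeff]
  ring

lemma integral_exp_sum_gaussian (s : Finset ((_ : ℕ) × ℕ)) (A : ((_ : ℕ) × ℕ) → ℝ) :
    ∫ ω, Complex.exp (((∑ p ∈ s, A p * ω p : ℝ) : ℂ) * Complex.I) ∂schauderMeasure =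
      Complex.exp ((-(∑ p ∈ s, A p * A p) / 2 : ℝ) : ℂ) := by
  have e : ∀ ω : SchauderSpace, Complex.exp (((∑ p ∈ s, A p * ω p : ℝ) : ℂ) * Complex.I) =
      ∏ p ∈ s, Complex.exp ((A p : ℂ) * (ω p : ℂ) * Complex.I) := fun ω => by
    rw [← Complex.exp_sum]
    push_cast
    rw [Finset.sum_mul]
  simp_rw [e]
  rw [schauderMeasure, integral_infinitePi_prod (fun _ : (_ : ℕ) × ℕ => gaussianReal 0 1) s
    (f := fun p y => Complex.exp ((A p : ℂ) * (y : ℂ) * Complex.I)) (fun p => by fun_prop)]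
  have h1 : ∀ p, ∫ y, Complex.exp ((A p : ℂ) * (y : ℂ) * Complex.I) ∂(gaussianReal 0 1) =
      Complex.exp ((-(A p * A p) / 2 : ℝ) : ℂ) := fun p => by
    rw [← charFun_apply_real, charFun_gaussianReal]
    congr 1
    push_cast
    ring
  simp_rw [h1]
  rw [← Complex.exp_sum, ← Complex.ofReal_sum, ← Finset.sum_div, Finset.sum_neg_distrib]

/-- Increments over different intervals are uncorrelated: each minimum then picks the endpoint of
the earlier interval, and the four terms cancel. -/
lemma sum_min_increments {n : ℕ} {t : Fin (n + 1) → ℝ≥0} (ht : Monotone t) (θ : Fin n → ℝ) :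
    ∑ l, ∑ m, θ l * θ m * (min (t l.succ : ℝ) (t m.succ) - min (t l.succ : ℝ) (t m.castSucc) -
      min (t l.castSucc : ℝ) (t m.succ) + min (t l.castSucc : ℝ) (t m.castSucc)) =
      ∑ l, θ l ^ 2 * ((t l.succ : ℝ) - t l.castSucc) := by
  have hmono : ∀ {i j : Fin (n + 1)}, i ≤ j → (t i : ℝ) ≤ t j := fun h => by exact_mod_cast ht h
  refine Finset.sum_congr rfl fun l _ => ?_
  rw [Finset.sum_eq_single l]
  · have h := hmono (Fin.castSucc_le_succ l)
    rw [min_self, min_self, min_eq_right h, min_eq_left h]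
    ring
  · intro m _ hm
    have hl := hmono (Fin.castSucc_le_succ l)
    have hm' := hmono (Fin.castSucc_le_succ m)
    rcases lt_or_gt_of_ne hm with h | h
    · have h1 : (t m.succ : ℝ) ≤ t l.castSucc := hmono (Fin.succ_le_castSucc_iff.2 h)
      rw [min_eq_right (h1.trans hl), min_eq_right (hm'.trans (h1.trans hl)), min_eq_right h1,
        min_eq_right (hm'.trans h1)]
      ring
    · have h1 : (t l.succ : ℝ) ≤ t m.castSucc := hmono (Fin.succ_le_castSucc_iff.2 h)
      rw [min_eq_left (h1.trans hm'), min_eq_left h1, min_eq_left (hl.trans (h1.trans hm')),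
        min_eq_left (hl.trans h1)]
      ring
  · exact fun h => absurd (Finset.mem_univ l) h

/-- For a partial sum the combination of increments is centred Gaussian with variance `∑ A p ^ 2`.
The characteristic functions converge by dominated convergence, the variances by convergence of the
covariances. -/
lemma hasIncrementExponent_brownian :
    HasIncrementExponent brownian schauderMeasure fun θ => ((-(θ ^ 2) / 2 : ℝ) : ℂ) := by
  intro n t ht θ
  set A : ((_ : ℕ) × ℕ) → ℝ := fun p =>
    ∑ l, θ l * (schauderCoeff p (t l.succ) - schauderCoeff p (t l.castSucc)) with hA
  have hsum : ∀ (N : ℕ) (ω : SchauderSpace), ∑ p ∈ schauderIndices N, A p * ω p =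
      ∑ l, θ l * (∑ p ∈ schauderIndices N, schauderCoeff p (t l.succ) * ω p -
        ∑ p ∈ schauderIndices N, schauderCoeff p (t l.castSucc) * ω p) := fun N ω => by
    simp_rw [hA, Finset.sum_mul, ← Finset.sum_sub_distrib, Finset.mul_sum]
    rw [Finset.sum_comm]
    refine Finset.sum_congr rfl fun l _ => Finset.sum_congr rfl fun p _ => ?_
    ring
  have hL : Tendsto (fun N => ∫ ω, Complex.exp (((∑ p ∈ schauderIndices N, A p * ω p : ℝ) : ℂ) *
      Complex.I) ∂schauderMeasure) atTop (𝓝 (∫ ω, Complex.exp (((∑ l, θ l *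
        (brownian (t l.succ) ω - brownian (t l.castSucc) ω) : ℝ) : ℂ) * Complex.I)
        ∂schauderMeasure)) := by
    refine tendsto_integral_of_dominated_convergence (fun _ => 1) (fun N => ?_)
      (integrable_const _) (fun N => Eventually.of_forall fun ω => ?_) ?_
    · exact Measurable.aestronglyMeasurable (by fun_prop)
    · rw [Complex.norm_exp_ofReal_mul_I]
    · filter_upwards [ae_schauderGood] with ω hω
      simp_rw [hsum]
      refine ((Complex.continuous_exp.comp (by fun_prop :
        Continuous fun x : ℝ => (x : ℂ) * Complex.I)).tendsto _).comp ?_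
      exact tendsto_finsetSum _ fun l _ =>
        ((tendsto_brownian hω _).sub (tendsto_brownian hω _)).const_mul _
  have hAA : Tendsto (fun N => ∑ p ∈ schauderIndices N, A p * A p) atTop
      (𝓝 (∑ l, θ l ^ 2 * ((t l.succ : ℝ) - t l.castSucc))) := by
    rw [← sum_min_increments ht θ]
    have hc := tendsto_sum_schauderCoeff
    have h1 : Tendsto (fun N => ∑ l, ∑ m, θ l * θ m *
        (∑ p ∈ schauderIndices N, schauderCoeff p (t l.succ) * schauderCoeff p (t m.succ) -
          ∑ p ∈ schauderIndices N, schauderCoeff p (t l.succ) * schauderCoeff p (t m.castSucc) -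
          ∑ p ∈ schauderIndices N, schauderCoeff p (t l.castSucc) * schauderCoeff p (t m.succ) +
          ∑ p ∈ schauderIndices N,
            schauderCoeff p (t l.castSucc) * schauderCoeff p (t m.castSucc))) atTop
        (𝓝 (∑ l, ∑ m, θ l * θ m *
          (min (t l.succ : ℝ) (t m.succ) - min (t l.succ : ℝ) (t m.castSucc) -
            min (t l.castSucc : ℝ) (t m.succ) + min (t l.castSucc : ℝ) (t m.castSucc)))) :=
      tendsto_finsetSum _ fun l _ => tendsto_finsetSum _ fun m _ =>
        ((((hc (t l.succ) (t m.succ)).sub (hc (t l.succ) (t m.castSucc))).sub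
          (hc (t l.castSucc) (t m.succ))).add (hc (t l.castSucc) (t m.castSucc))).const_mul _
    refine h1.congr fun N => ?_
    simp_rw [← Finset.sum_sub_distrib, ← Finset.sum_add_distrib, Finset.mul_sum]
    have e : ∀ p, A p * A p = ∑ l, ∑ m, θ l * θ m *
        (schauderCoeff p (t l.succ) * schauderCoeff p (t m.succ) -
          schauderCoeff p (t l.succ) * schauderCoeff p (t m.castSucc) -
          schauderCoeff p (t l.castSucc) * schauderCoeff p (t m.succ) +
          schauderCoeff p (t l.castSucc) * schauderCoeff p (t m.castSucc)) := fun p => by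
      rw [hA, Finset.sum_mul_sum]
      refine Finset.sum_congr rfl fun l _ => Finset.sum_congr rfl fun m _ => ?_
      ring
    symm
    simp_rw [e]
    rw [Finset.sum_comm]
    refine Finset.sum_congr rfl fun l _ => ?_
    rw [Finset.sum_comm]
  simp_rw [integral_exp_sum_gaussian] at hL
  refine tendsto_nhds_unique hL ?_
  have h2 := ((Complex.continuous_exp.comp Complex.continuous_ofReal).tendsto _).comp
    ((hAA.neg).div_const 2)
  refine Eq.subst (motive := fun z => Tendsto _ atTop (𝓝 z)) ?_ h2
  simp only [Function.comp_apply]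
  congr 1
  push_cast
  rw [← Finset.sum_neg_distrib, Finset.sum_div]
  refine Finset.sum_congr rfl fun l _ => ?_
  ring

end Brownian

/-! ### The compound Poisson process from independent blocks of unit length -/

section CompoundPoisson

/-- The number of jumps in a time interval of unit length, their relative times and their sizes. -/
abbrev JumpBlock : Type := ℕ × (ℕ → unitInterval × ℝ)

/-- The law of a block of jumps with intensity `r` and jump law `F`. -/
noncomputable def jumpBlockMeasure (r : ℝ≥0) (F : Measure ℝ) [IsProbabilityMeasure F] :
    Measure JumpBlock :=
  (poissonMeasure r).prod (Measure.infinitePi fun _ => (volume : Measure unitInterval).prod F)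

instance (r : ℝ≥0) (F : Measure ℝ) [IsProbabilityMeasure F] :
    IsProbabilityMeasure (jumpBlockMeasure r F) := by
  unfold jumpBlockMeasure; infer_instance

/-- Independent blocks of jumps. -/
noncomputable def jumpMeasure (r : ℝ≥0) (F : Measure ℝ) [IsProbabilityMeasure F] :
    Measure (ℕ → JumpBlock) :=
  Measure.infinitePi fun _ => jumpBlockMeasure r F

instance (r : ℝ≥0) (F : Measure ℝ) [IsProbabilityMeasure F] :
    IsProbabilityMeasure (jumpMeasure r F) := by
  unfold jumpMeasure; infer_instance

/-- A step of height `c` at time `τ`. -/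
noncomputable def jumpStep (τ c : ℝ) (t : ℝ≥0) : ℝ := if τ ≤ t then c else 0

/-- The sum of the jumps of the `m`-th block up to time `t`. -/
noncomputable def blockJumps (m : ℕ) (t : ℝ≥0) (b : JumpBlock) : ℝ :=
  ∑ j ∈ Finset.range b.1, jumpStep (m + (b.2 j).1) (b.2 j).2 t

/-- The compound Poisson process. -/
noncomputable def compoundPoisson (t : ℝ≥0) (ω : ℕ → JumpBlock) : ℝ :=
  ∑ m ∈ Finset.range (⌊t⌋₊ + 1), blockJumps m t (ω m)

/-- Block `m` only jumps at times in `[m, m + 1]`. Any `M` beyond `t` may be used, so on a bounded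
time range the number of summands can be taken constant. -/
lemma compoundPoisson_eq_sum {t : ℝ≥0} {M : ℕ} (h : t < M) (ω : ℕ → JumpBlock) :
    compoundPoisson t ω = ∑ m ∈ Finset.range M, blockJumps m t (ω m) := by
  refine Finset.sum_subset ?_ fun m _ hm => Finset.sum_eq_zero fun j _ => ?_
  · exact Finset.range_subset_range.2 ((Nat.floor_lt zero_le).2 h)
  · rw [Finset.mem_range, not_lt, Nat.succ_le_iff] at hm
    have h1 : t < m := (Nat.floor_lt zero_le).1 hm
    have h2 : (t : ℝ) < m := by exact_mod_cast h1
    refine if_neg ?_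
    have := ((ω m).2 j).1.2.1
    linarith

lemma measurable_blockJumps (m : ℕ) (t : ℝ≥0) : Measurable (blockJumps m t) := by
  refine measurable_from_prod_countable_right fun N => ?_
  refine Finset.measurable_sum (Finset.range N)
    (f := fun j (y : ℕ → unitInterval × ℝ) => jumpStep (m + (y j).1) (y j).2 t) fun j _ => ?_
  have h : Measurable fun y : ℕ → unitInterval × ℝ => (m : ℝ) + ((y j).1 : ℝ) := by fun_prop
  exact Measurable.ite (measurableSet_le h measurable_const) (by fun_prop) measurable_const

lemma measurable_compoundPoisson (t : ℝ≥0) : Measurable (compoundPoisson t) :=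
  Finset.measurable_sum _ fun m _ => (measurable_blockJumps m t).comp (measurable_pi_apply m)

lemma compoundPoisson_zero {r : ℝ≥0} {F : Measure ℝ} [IsProbabilityMeasure F] :
    ∀ᵐ ω ∂jumpMeasure r F, compoundPoisson 0 ω = 0 := by
  -- A jump of block 0 at relative time exactly 0 would count at time 0; this has probability zero.
  have h1 : ∀ᵐ u ∂(volume : Measure unitInterval), u ≠ 0 := by
    simp [ae_iff]
  have h2 : ∀ᵐ b ∂jumpBlockMeasure r F, ∀ j, (b.2 j).1 ≠ 0 := by
    rw [ae_all_iff]
    intro j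
    have hq : MeasurePreserving (fun b : JumpBlock => (b.2 j).1) (jumpBlockMeasure r F) volume :=
      measurePreserving_fst.comp ((measurePreserving_eval_infinitePi _ j).comp
        measurePreserving_snd)
    exact hq.quasiMeasurePreserving.ae h1
  have h3 : ∀ᵐ ω ∂jumpMeasure r F, ∀ j, ((ω 0).2 j).1 ≠ 0 :=
    (measurePreserving_eval_infinitePi (fun _ : ℕ => jumpBlockMeasure r F) 0).quasiMeasurePreserving.ae h2
  filter_upwards [h3] with ω hω
  rw [compoundPoisson_eq_sum (M := 1) (by simp)]
  simp only [Finset.range_one, Finset.sum_singleton]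
  refine Finset.sum_eq_zero fun j _ => if_neg ?_
  have := unitInterval.pos_iff_ne_zero.2 (hω j)
  simpa using this

lemma jumpStep_rightContinuous (τ c : ℝ) (t : ℝ≥0) :
    ContinuousWithinAt (jumpStep τ c) (Ici t) t := by
  by_cases h : τ ≤ t
  · refine (continuousWithinAt_const (b := c)).congr (fun s hs => if_pos ?_) (if_pos h)
    exact h.trans (by exact_mod_cast hs)
  · rw [not_le] at h
    have : ContinuousAt (jumpStep τ c) t := by
      refine (continuousAt_const (y := (0 : ℝ))).congr ?_
      filter_upwards [NNReal.continuous_coe.continuousAt.eventually_lt continuousAt_const h]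
        with s hs
      exact (if_neg hs.not_ge).symm
    exact this.continuousWithinAt

lemma jumpStep_leftLimit (τ c : ℝ) (t : ℝ≥0) : ∃ l, Tendsto (jumpStep τ c) (𝓝[<] t) (𝓝 l) := by
  by_cases h : τ < t
  · refine ⟨c, tendsto_const_nhds.congr' ?_⟩
    filter_upwards [mem_nhdsWithin_of_mem_nhds
      (continuousAt_const.eventually_lt NNReal.continuous_coe.continuousAt h)] with s hs
    exact (if_pos (le_of_lt hs)).symm
  · refine ⟨0, tendsto_const_nhds.congr' ?_⟩
    filter_upwards [self_mem_nhdsWithin] with s hs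
    refine (if_neg ?_).symm
    have : (s : ℝ) < t := by exact_mod_cast hs
    linarith

lemma compoundPoisson_eventuallyEq (ω : ℕ → JumpBlock) (t : ℝ≥0) : ∃ M : ℕ, t < M ∧
    (fun s => compoundPoisson s ω) =ᶠ[𝓝 t]
      fun s => ∑ m ∈ Finset.range M, blockJumps m s (ω m) := by
  obtain ⟨M, hM⟩ := exists_nat_gt t
  exact ⟨M, hM, by filter_upwards [Iio_mem_nhds hM] with s hs using compoundPoisson_eq_sum hs ω⟩

lemma compoundPoisson_cadlag (ω : ℕ → JumpBlock) (t : ℝ≥0) :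
    ContinuousWithinAt (fun s => compoundPoisson s ω) (Ici t) t ∧
      ∃ l, Tendsto (fun s => compoundPoisson s ω) (𝓝[<] t) (𝓝 l) := by
  obtain ⟨M, hM, he⟩ := compoundPoisson_eventuallyEq ω t
  constructor
  · refine ContinuousWithinAt.congr_of_eventuallyEq ?_ (he.filter_mono nhdsWithin_le_nhds)
      he.eq_of_nhds
    refine tendsto_finsetSum _ fun m _ => tendsto_finsetSum _ fun j _ => ?_
    exact jumpStep_rightContinuous _ _ t
  · choose l hl using fun m j => jumpStep_leftLimit (m + ((ω m).2 j).1) ((ω m).2 j).2 t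
    refine ⟨∑ m ∈ Finset.range M, ∑ j ∈ Finset.range (ω m).1, l m j, ?_⟩
    refine Tendsto.congr' (he.filter_mono nhdsWithin_le_nhds).symm ?_
    exact tendsto_finsetSum _ fun m _ => tendsto_finsetSum _ fun j _ => hl m j

lemma compoundPoisson_monotone {r : ℝ≥0} {F : Measure ℝ} [IsProbabilityMeasure F]
    (hF : ∀ᵐ y ∂F, 0 ≤ y) :
    ∀ᵐ ω ∂jumpMeasure r F, Monotone fun t => compoundPoisson t ω := by
  have h2 : ∀ᵐ b ∂jumpBlockMeasure r F, ∀ j, 0 ≤ (b.2 j).2 := by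
    rw [ae_all_iff]
    intro j
    have hq : MeasurePreserving (fun b : JumpBlock => (b.2 j).2) (jumpBlockMeasure r F) F :=
      measurePreserving_snd.comp ((measurePreserving_eval_infinitePi _ j).comp
        measurePreserving_snd)
    exact hq.quasiMeasurePreserving.ae hF
  have h3 : ∀ᵐ ω ∂jumpMeasure r F, ∀ m j, 0 ≤ ((ω m).2 j).2 :=
    ae_all_iff.2 fun m => (measurePreserving_eval_infinitePi
      (fun _ : ℕ => jumpBlockMeasure r F) m).quasiMeasurePreserving.ae h2
  filter_upwards [h3] with ω hω s t hst
  obtain ⟨M, hM⟩ := exists_nat_gt t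
  simp only [compoundPoisson_eq_sum hM, compoundPoisson_eq_sum (hst.trans_lt hM)]
  refine Finset.sum_le_sum fun m _ => Finset.sum_le_sum fun j _ => ?_
  have h : (s : ℝ) ≤ t := by exact_mod_cast hst
  simp only [jumpStep]
  split_ifs with h1 h2
  · exact le_rfl
  · exact absurd (h1.trans h) h2
  · exact hω m j
  · exact le_rfl

/-- Conditionally on `N` jumps the expectation is `E ^ N`, and the Poisson generating function sums
these. -/
lemma integral_prod_jumpBlock (r : ℝ≥0) (F : Measure ℝ) [IsProbabilityMeasure F]
    {f : unitInterval × ℝ → ℂ} (hf : Measurable f) (hb : ∀ y, ‖f y‖ ≤ 1) :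
    ∫ b, ∏ j ∈ Finset.range b.1, f (b.2 j) ∂jumpBlockMeasure r F =
      Complex.exp (r * (∫ y, f y ∂(volume : Measure unitInterval).prod F - 1)) := by
  set E := ∫ y, f y ∂(volume : Measure unitInterval).prod F with hE
  have hm : Measurable fun b : JumpBlock => ∏ j ∈ Finset.range b.1, f (b.2 j) :=
    measurable_from_prod_countable_right fun N =>
      Finset.measurable_prod (Finset.range N)
        (f := fun j (y : ℕ → unitInterval × ℝ) => f (y j)) fun j _ => by fun_prop
  rw [jumpBlockMeasure, integral_prod]
  · have h1 : ∀ N, ∫ ξ, ∏ j ∈ Finset.range N, f (ξ j)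
        ∂(Measure.infinitePi fun _ : ℕ => (volume : Measure unitInterval).prod F) = E ^ N :=
      fun N => by
        rw [integral_infinitePi_prod (fun _ : ℕ => (volume : Measure unitInterval).prod F) _
          (f := fun _ => f) fun _ => hf]
        simp [hE]
    simp only [h1]
    rw [integral_poissonMeasure]
    have h2 : ∀ N : ℕ, (Real.exp (-r) * r ^ N / (N.factorial : ℝ)) • E ^ N =
        Complex.exp (-r) * ((r * E) ^ N / (N.factorial : ℂ)) := fun N => by
      rw [Complex.real_smul]
      push_cast
      rw [mul_pow]
      ring
    simp_rw [h2]
    rw [tsum_mul_left, mul_sub, mul_one, sub_eq_neg_add, Complex.exp_add,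
      Complex.exp_eq_exp_ℂ, NormedSpace.exp_eq_tsum_div]
  · refine Integrable.of_bound hm.aestronglyMeasurable 1 (Eventually.of_forall fun b => ?_)
    rw [norm_prod]
    exact Finset.prod_le_one (fun _ _ => norm_nonneg _) fun _ _ => hb _

/-- The part of the `m`-th unit time interval that lies before `t`. -/
lemma integral_indicator_unitInterval (m : ℕ) (t : ℝ≥0) :
    ∫ u : unitInterval, (jumpStep (m + u) 1 t) = max 0 (min 1 ((t : ℝ) - m)) := by
  have e : (fun u : unitInterval => jumpStep (m + u) 1 t) =
      {u : unitInterval | (u : ℝ) ≤ t - m}.indicator 1 := by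
    ext u
    simp only [jumpStep, indicator, mem_ofPred_eq, Pi.one_apply]
    congr 1
    rw [le_sub_iff_add_le, add_comm]
  rw [e, integral_indicator_one (measurableSet_le (by fun_prop) measurable_const), measureReal_def,
    unitInterval.volume_apply]
  have e2 : Subtype.val '' {u : unitInterval | (u : ℝ) ≤ t - m} =
      Icc 0 (min 1 ((t : ℝ) - m)) := by
    ext x
    simp only [mem_image, mem_ofPred_eq, Subtype.exists, exists_and_left, exists_prop, mem_Icc,
      le_min_iff, exists_eq_right_right, unitInterval]
    tauto
  rw [e2, Real.volume_Icc, sub_zero, ENNReal.toReal_ofReal', max_comm]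

/-- The terms are the lengths of `[0, t] ∩ [m, m + 1]`. -/
lemma sum_range_unit (t : ℝ) (ht : 0 ≤ t) (M : ℕ) :
    ∑ m ∈ Finset.range M, max 0 (min 1 (t - m)) = min t M := by
  induction M with
  | zero => simp [ht]
  | succ M ih =>
    rw [Finset.sum_range_succ, ih]
    push_cast
    rcases le_total t M with h | h
    · rw [min_eq_left h, min_eq_right (by linarith), max_eq_left (by linarith),
        min_eq_left (by linarith), add_zero]
    · rcases le_total (t - M) 1 with h1 | h1
      · rw [min_eq_right h, min_eq_right h1, max_eq_right (by linarith),
          min_eq_left (by linarith)]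
        ring
      · rw [min_eq_right h, min_eq_left h1, max_eq_right zero_le_one, min_eq_right (by linarith)]

/-- A jump time lies in at most one interval of the partition, so the inner sum is a single `θ l` or
zero. Hence a nonlinear `G` with `G 0 = 0` acts termwise. -/
lemma apply_sum_increments_jumpStep {n : ℕ} {t : Fin (n + 1) → ℝ≥0} (ht : Monotone t)
    (θ : Fin n → ℝ) (τ : ℝ) {G : ℝ → ℂ} (hG : G 0 = 0) :
    G (∑ l, θ l * (jumpStep τ 1 (t l.succ) - jumpStep τ 1 (t l.castSucc))) =
      ∑ l, ((jumpStep τ 1 (t l.succ) - jumpStep τ 1 (t l.castSucc) : ℝ) : ℂ) * G (θ l) := by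
  have hmono : ∀ {i j : Fin (n + 1)}, i ≤ j → (t i : ℝ) ≤ t j := fun h => by exact_mod_cast ht h
  by_cases h : ∃ l : Fin n, (t l.castSucc : ℝ) < τ ∧ τ ≤ t l.succ
  · obtain ⟨l, h1, h2⟩ := h
    have h3 : ∀ m, m ≠ l → jumpStep τ 1 (t m.succ) - jumpStep τ 1 (t m.castSucc) = 0 := by
      intro m hm
      rcases lt_or_gt_of_ne hm with h | h
      · have h4 : (t m.succ : ℝ) ≤ t l.castSucc := hmono (Fin.succ_le_castSucc_iff.2 h)
        have h5 := hmono (Fin.castSucc_le_succ m)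
        rw [jumpStep, jumpStep, if_neg (by linarith), if_neg (by linarith), sub_zero]
      · have h4 : (t l.succ : ℝ) ≤ t m.castSucc := hmono (Fin.succ_le_castSucc_iff.2 h)
        have h5 := hmono (Fin.castSucc_le_succ m)
        rw [jumpStep, jumpStep, if_pos (by linarith), if_pos (by linarith), sub_self]
    rw [Finset.sum_eq_single l (fun m _ hm => by rw [h3 m hm, mul_zero]) (by simp),
      Finset.sum_eq_single l (fun m _ hm => by rw [h3 m hm, Complex.ofReal_zero, zero_mul])
        (by simp), jumpStep, jumpStep, if_pos h2, if_neg (by linarith)]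
    simp
  · have h3 : ∀ m : Fin n, jumpStep τ 1 (t m.succ) - jumpStep τ 1 (t m.castSucc) = 0 := by
      intro m
      have h5 := hmono (Fin.castSucc_le_succ m)
      rcases lt_or_ge (t m.castSucc : ℝ) τ with h1 | h1
      · have h2 : ¬ τ ≤ t m.succ := fun h2 => h ⟨m, h1, h2⟩
        rw [jumpStep, jumpStep, if_neg h2, if_neg (by linarith), sub_zero]
      · rw [jumpStep, jumpStep, if_pos h1, if_pos (by linarith), sub_self]
    simp [h3, hG]

lemma jumpStep_eq_mul (τ c : ℝ) (t : ℝ≥0) : jumpStep τ c t = c * jumpStep τ 1 t := by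
  simp [jumpStep]

lemma measurable_jumpStep_add (m : ℕ) (t : ℝ≥0) :
    Measurable fun u : unitInterval => jumpStep (m + u) 1 t :=
  Measurable.ite (measurableSet_le (by fun_prop) measurable_const) measurable_const
    measurable_const

lemma integrable_jumpStep_add (m : ℕ) (t : ℝ≥0) :
    Integrable fun u : unitInterval => jumpStep (m + u) 1 t := by
  refine Integrable.of_bound (measurable_jumpStep_add m t).aestronglyMeasurable 1
    (Eventually.of_forall fun u => ?_)
  simp only [jumpStep]
  split_ifs <;> simp

/-- Independent blocks multiply. Each contributes a Poisson exponent linear in the overlaps of its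
unit interval with the partition intervals, and the overlaps add up over the blocks to the interval
lengths. -/
lemma hasIncrementExponent_compoundPoisson (r : ℝ≥0) (F : Measure ℝ) [IsProbabilityMeasure F] :
    HasIncrementExponent compoundPoisson (jumpMeasure r F)
      fun θ => r * ∫ y, (Complex.exp ((θ : ℂ) * Complex.I * y) - 1) ∂F := by
  intro n t ht θ
  set G : ℝ → ℂ := fun c => ∫ y, (Complex.exp ((c : ℂ) * Complex.I * y) - 1) ∂F with hG
  obtain ⟨M, hM⟩ := exists_nat_gt (t (Fin.last n))
  have hM' : ∀ i, t i < M := fun i => (ht (Fin.le_last i)).trans_lt hM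
  set c : ℕ → unitInterval → ℝ := fun m u =>
    ∑ l, θ l * (jumpStep (m + u) 1 (t l.succ) - jumpStep (m + u) 1 (t l.castSucc)) with hc
  have hcm : ∀ m, Measurable (c m) := fun m =>
    Finset.measurable_sum _ fun l _ => ((measurable_jumpStep_add m _).sub
      (measurable_jumpStep_add m _)).const_mul _
  set f : ℕ → unitInterval × ℝ → ℂ := fun m y =>
    Complex.exp ((c m y.1 : ℂ) * Complex.I * y.2) with hf
  have hfm : ∀ m, Measurable (f m) := fun m => by
    have : Measurable fun y : unitInterval × ℝ => c m y.1 := (hcm m).comp measurable_fst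
    simp only [hf]
    fun_prop
  have hexp : ∀ a b : ℝ, ‖Complex.exp ((a : ℂ) * Complex.I * b)‖ = 1 := fun a b => by
    rw [show (a : ℂ) * Complex.I * b = ((a * b : ℝ) : ℂ) * Complex.I by push_cast; ring,
      Complex.norm_exp_ofReal_mul_I]
  have hprod : ∀ ω : ℕ → JumpBlock, Complex.exp (((∑ l, θ l *
      (compoundPoisson (t l.succ) ω - compoundPoisson (t l.castSucc) ω) : ℝ) : ℂ) * Complex.I) =
      ∏ m ∈ Finset.range M, ∏ j ∈ Finset.range (ω m).1, f m ((ω m).2 j) := fun ω => by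
    simp only [hf, ← Complex.exp_sum]
    congr 1
    have e : ∑ l, θ l * (compoundPoisson (t l.succ) ω - compoundPoisson (t l.castSucc) ω) =
        ∑ m ∈ Finset.range M, ∑ j ∈ Finset.range (ω m).1,
          c m ((ω m).2 j).1 * ((ω m).2 j).2 := by
      simp only [compoundPoisson_eq_sum (hM' _), ← Finset.sum_sub_distrib, blockJumps, hc,
        Finset.mul_sum, Finset.sum_mul]
      rw [Finset.sum_comm]
      refine Finset.sum_congr rfl fun m _ => ?_
      rw [Finset.sum_comm]
      refine Finset.sum_congr rfl fun j _ => Finset.sum_congr rfl fun l _ => ?_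
      rw [jumpStep_eq_mul _ ((ω m).2 j).2, jumpStep_eq_mul _ ((ω m).2 j).2]
      ring
    rw [e]
    push_cast
    simp only [Finset.sum_mul]
    refine Finset.sum_congr rfl fun m _ => Finset.sum_congr rfl fun j _ => ?_
    ring
  have hEf : ∀ m, ∫ y, f m y ∂(volume : Measure unitInterval).prod F - 1 =
      ∑ l, ((max 0 (min 1 ((t l.succ : ℝ) - m)) - max 0 (min 1 ((t l.castSucc : ℝ) - m)) : ℝ) :
        ℂ) * G (θ l) := fun m => by
    have hfi : Integrable (f m) ((volume : Measure unitInterval).prod F) :=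
      Integrable.of_bound (hfm m).aestronglyMeasurable 1
        (Eventually.of_forall fun y => (hexp _ _).le)
    have h1 : ∫ y, f m y ∂(volume : Measure unitInterval).prod F - 1 =
        ∫ y, (f m y - 1) ∂(volume : Measure unitInterval).prod F := by
      rw [integral_sub hfi (integrable_const _)]
      simp
    rw [h1, integral_prod (fun y => f m y - 1) (hfi.sub (integrable_const _))]
    have h2 : ∀ u : unitInterval, ∫ y, (f m (u, y) - 1) ∂F = ∑ l, ((jumpStep (m + u) 1 (t l.succ) -
        jumpStep (m + u) 1 (t l.castSucc) : ℝ) : ℂ) * G (θ l) := fun u =>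
      apply_sum_increments_jumpStep (G := G) ht θ (m + u) (by simp [hG])
    simp only [h2]
    rw [integral_finsetSum _ fun l _ => (((integrable_jumpStep_add m _).sub
      (integrable_jumpStep_add m _)).ofReal).mul_const _]
    refine Finset.sum_congr rfl fun l _ => ?_
    rw [integral_mul_const, integral_complex_ofReal, integral_sub (integrable_jumpStep_add m _)
      (integrable_jumpStep_add m _), integral_indicator_unitInterval,
      integral_indicator_unitInterval]
  simp_rw [hprod]
  rw [jumpMeasure, integral_infinitePi_prod (fun _ : ℕ => jumpBlockMeasure r F) (Finset.range M)
    (f := fun m b => ∏ j ∈ Finset.range b.1, f m (b.2 j))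
    (fun m => measurable_from_prod_countable_right fun N =>
      Finset.measurable_prod (Finset.range N)
        (f := fun j (y : ℕ → unitInterval × ℝ) => f m (y j))
        fun j _ => (hfm m).comp (measurable_pi_apply j))]
  simp only [integral_prod_jumpBlock r F (hfm _) fun y => (hexp _ _).le]
  rw [← Complex.exp_sum]
  congr 1
  simp only [hEf, Finset.mul_sum]
  rw [Finset.sum_comm]
  refine Finset.sum_congr rfl fun l _ => ?_
  have h3 : ∑ m ∈ Finset.range M, (max 0 (min 1 ((t l.succ : ℝ) - m)) -
      max 0 (min 1 ((t l.castSucc : ℝ) - m))) = (t l.succ : ℝ) - t l.castSucc := by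
    have hM1 : ∀ i, (t i : ℝ) ≤ M := fun i => by exact_mod_cast (hM' i).le
    rw [Finset.sum_sub_distrib, sum_range_unit _ (NNReal.coe_nonneg _),
      sum_range_unit _ (NNReal.coe_nonneg _), min_eq_left (hM1 _), min_eq_left (hM1 _)]
  rw [← h3, Complex.ofReal_sum, Finset.sum_mul]
  refine Finset.sum_congr rfl fun m _ => ?_
  ring

end CompoundPoisson

/-! ### Brownian motion, compound Poisson process and drift combined -/

section JumpDiffusion

/-- The sum of a Brownian motion, a compound Poisson process and a linear drift. -/
noncomputable def jumpDiffusion (a c : ℝ) (t : ℝ≥0) (ω : SchauderSpace × (ℕ → JumpBlock)) : ℝ :=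
  c * brownian t ω.1 + compoundPoisson t ω.2 + a * t

/-- Independent Brownian motion and compound Poisson process. -/
noncomputable def jumpDiffusionMeasure (r : ℝ≥0) (F : Measure ℝ) [IsProbabilityMeasure F] :
    Measure (SchauderSpace × (ℕ → JumpBlock)) :=
  schauderMeasure.prod (jumpMeasure r F)

variable {r : ℝ≥0} {F : Measure ℝ} [IsProbabilityMeasure F]

instance : IsProbabilityMeasure (jumpDiffusionMeasure r F) := by
  unfold jumpDiffusionMeasure; infer_instance

lemma measurable_jumpDiffusion (a c : ℝ) (t : ℝ≥0) : Measurable (jumpDiffusion a c t) :=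
  ((((measurable_brownian t).comp measurable_fst).const_mul c).add
    ((measurable_compoundPoisson t).comp measurable_snd)).add_const _

lemma jumpDiffusion_zero (a c : ℝ) : ∀ᵐ ω ∂jumpDiffusionMeasure r F, jumpDiffusion a c 0 ω = 0 := by
  have h : ∀ᵐ ω ∂jumpDiffusionMeasure r F, compoundPoisson 0 ω.2 = 0 :=
    measurePreserving_snd.quasiMeasurePreserving.ae compoundPoisson_zero
  filter_upwards [h] with ω hω
  simp [jumpDiffusion, hω, brownian_zero]

lemma hasIncrementExponent_jumpDiffusion (a c : ℝ) :
    HasIncrementExponent (jumpDiffusion a c) (jumpDiffusionMeasure r F) fun θ =>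
      ((-((θ * c) ^ 2) / 2 : ℝ) : ℂ) +
        r * ∫ y, (Complex.exp ((θ : ℂ) * Complex.I * y) - 1) ∂F + (a : ℂ) * θ * Complex.I :=
  ((hasIncrementExponent_brownian.const_mul c).add_prod
    (hasIncrementExponent_compoundPoisson r F)).add_const_mul a

lemma isLevyProcess_jumpDiffusion (a c : ℝ) :
    IsLevyProcess (jumpDiffusion a c) (jumpDiffusionMeasure r F) where
  measurable := measurable_jumpDiffusion a c
  zero := jumpDiffusion_zero a c
  indep := (hasIncrementExponent_jumpDiffusion a c).hasIndepIncrements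
    (measurable_jumpDiffusion a c)
  stationary := (hasIncrementExponent_jumpDiffusion a c).identDistrib
    (measurable_jumpDiffusion a c) (jumpDiffusion_zero a c)
  cadlag := Eventually.of_forall fun ω t => by
    have hB : Continuous fun s : ℝ≥0 => c * brownian s ω.1 :=
      (continuous_brownian ω.1).const_mul c
    have hL : Continuous fun s : ℝ≥0 => a * (s : ℝ) := by fun_prop
    obtain ⟨h1, l, h2⟩ := compoundPoisson_cadlag ω.2 t
    exact ⟨(hB.continuousWithinAt.add h1).add hL.continuousWithinAt, _,
      ((hB.continuousWithinAt.tendsto).add h2).add hL.continuousWithinAt.tendsto⟩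

lemma isSubordinator_jumpDiffusion (hF : ∀ᵐ y ∂F, 0 ≤ y) {a : ℝ} (ha : 0 ≤ a) :
    IsSubordinator (jumpDiffusion a 0) (jumpDiffusionMeasure r F) where
  levy := isLevyProcess_jumpDiffusion a 0
  monotone := by
    have h : ∀ᵐ ω ∂jumpDiffusionMeasure r F, Monotone fun t => compoundPoisson t ω.2 :=
      measurePreserving_snd.quasiMeasurePreserving.ae (compoundPoisson_monotone hF)
    filter_upwards [h] with ω hω s t hst
    have h1 : (s : ℝ) ≤ t := by exact_mod_cast hst
    have h2 := hω hst
    have h3 := mul_le_mul_of_nonneg_left h1 ha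
    simp only [jumpDiffusion, zero_mul, zero_add]
    exact add_le_add h2 h3

lemma jumpDiffusion_leftLimit_le (hF : ∀ᵐ y ∂F, 0 ≤ y) (a c : ℝ) :
    ∀ᵐ ω ∂jumpDiffusionMeasure r F, ∀ t, 0 < t → ∀ l,
      Tendsto (fun s => jumpDiffusion a c s ω) (𝓝[<] t) (𝓝 l) → l ≤ jumpDiffusion a c t ω := by
  have h : ∀ᵐ ω ∂jumpDiffusionMeasure r F, Monotone fun t => compoundPoisson t ω.2 :=
    measurePreserving_snd.quasiMeasurePreserving.ae (compoundPoisson_monotone hF)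
  filter_upwards [h] with ω hω t ht l hl
  have hC : Continuous fun s : ℝ≥0 => c * brownian s ω.1 + a * (s : ℝ) :=
    ((continuous_brownian ω.1).const_mul c).add (by fun_prop)
  have h1 := hC.continuousWithinAt (s := Iio t) (x := t)
  have : (𝓝[<] t).NeBot := nhdsLT_neBot_of_exists_lt ⟨0, ht⟩
  have h2 := (h1.tendsto.add_const (compoundPoisson t ω.2))
  have h3 := le_of_tendsto_of_tendsto hl h2 (by
    filter_upwards [self_mem_nhdsWithin] with s hs
    have := hω (le_of_lt hs)
    simp only [jumpDiffusion]
    simp only at this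
    linarith)
  simp only [jumpDiffusion]
  linarith

lemma map_brownian_one : schauderMeasure.map (brownian 1) = gaussianReal 0 1 := by
  have := Measure.isProbabilityMeasure_map (μ := schauderMeasure)
    (measurable_brownian 1).aemeasurable
  refine Measure.ext_of_charFun (funext fun θ => ?_)
  rw [charFun_gaussianReal, charFun_apply_real,
    integral_map (measurable_brownian 1).aemeasurable (by fun_prop)]
  have h := hasIncrementExponent_brownian.integral_exp measurable_brownian
    (Eventually.of_forall brownian_zero) θ
  refine Eq.trans ?_ (h.trans ?_)
  · congr 1
    ext ω
    congr 1
    ring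
  · congr 1
    push_cast
    ring

/-- With positive probability the jump part at time 1 is at most some `K`, and independently the
Gaussian part, having full support, lies below `-(K + a)`. Then the process is negative at time 1.
-/
lemma not_isSubordinator_jumpDiffusion (a : ℝ) {c : ℝ} (hc : c ≠ 0) :
    ¬ IsSubordinator (jumpDiffusion a c) (jumpDiffusionMeasure r F) := by
  intro h
  have h1 : ∀ᵐ ω ∂jumpDiffusionMeasure r F, 0 ≤ jumpDiffusion a c 1 ω := by
    filter_upwards [h.monotone, h.levy.zero] with ω hω hω0
    have := hω (zero_le_one : (0 : ℝ≥0) ≤ 1)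
    simpa [hω0] using this
  obtain ⟨K, hK⟩ : ∃ K : ℕ, jumpMeasure r F {ω | compoundPoisson 1 ω ≤ K} ≠ 0 := by
    by_contra! hcon
    have h2 : ∀ᵐ ω ∂jumpMeasure r F, ∀ K : ℕ, ¬ compoundPoisson 1 ω ≤ K :=
      ae_all_iff.2 fun K => by
        rw [ae_iff]
        simpa using hcon K
    obtain ⟨ω, hω⟩ := h2.exists
    obtain ⟨K, hK⟩ := exists_nat_ge (compoundPoisson 1 ω)
    exact hω K hK
  have hB : schauderMeasure {ω | c * brownian 1 ω + K + a < 0} ≠ 0 := by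
    have hopen : IsOpen {y : ℝ | c * y + K + a < 0} :=
      isOpen_lt (by fun_prop) continuous_const
    have hne : {y : ℝ | c * y + K + a < 0}.Nonempty := by
      refine ⟨(-1 - K - a) / c, ?_⟩
      rw [mem_ofPred_eq, mul_div_cancel₀ _ hc]
      linarith
    have h3 : gaussianReal 0 1 {y : ℝ | c * y + K + a < 0} ≠ 0 := fun h0 =>
      (hopen.measure_pos volume hne).ne'
        (gaussianReal_absolutelyContinuous' 0 one_ne_zero h0)
    rwa [← map_brownian_one, Measure.map_apply (measurable_brownian 1) hopen.measurableSet] at h3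
  have h4 : jumpDiffusionMeasure r F ({ω | c * brownian 1 ω + K + a < 0} ×ˢ
      {ω | compoundPoisson 1 ω ≤ K}) ≠ 0 := by
    rw [jumpDiffusionMeasure, Measure.prod_prod]
    exact mul_ne_zero hB hK
  refine h4 (measure_mono_null ?_ (ae_iff.1 h1))
  rintro ω ⟨h5, h6⟩
  simp only [mem_ofPred_eq] at h5 h6
  simp only [mem_ofPred_eq, jumpDiffusion, not_le, NNReal.coe_one]
  linarith

lemma isSpectrallyPositive_jumpDiffusion (hF : ∀ᵐ y ∂F, 0 ≤ y) (a : ℝ) {c : ℝ} (hc : c ≠ 0) :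
    IsSpectrallyPositive (jumpDiffusion a c) (jumpDiffusionMeasure r F) where
  levy := isLevyProcess_jumpDiffusion a c
  no_negative_jumps := jumpDiffusion_leftLimit_le hF a c
  not_subordinator := not_isSubordinator_jumpDiffusion a hc

end JumpDiffusion

/-- The jump law and the jump intensity of an integrable Lévy density on `(0,∞)`. -/
lemma exists_jumpLaw {π : ℝ → ℝ} (hm : Measurable π) (h0 : ∀ y, 0 ≤ π y) (hi : Integrable π)
    (hpos : 0 < ∫ y, π y) (hneg : ∀ y < 0, π y = 0) :
    ∃ (r : ℝ≥0) (F : Measure ℝ), IsProbabilityMeasure F ∧ (∀ᵐ y ∂F, 0 ≤ y) ∧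
      ∀ g : ℝ → ℂ, r * ∫ y, g y ∂F = ∫ y, g y * (π y : ℂ) := by
  set D : Measure ℝ := volume.withDensity fun y => ENNReal.ofReal (π y) with hD
  have hmass : D univ = ENNReal.ofReal (∫ y, π y) := by
    rw [hD, withDensity_apply _ MeasurableSet.univ, setLIntegral_univ,
      ofReal_integral_eq_lintegral_ofReal hi (Eventually.of_forall h0)]
  have hm0 : D univ ≠ 0 := by rw [hmass]; simpa using hpos
  have hmt : D univ ≠ ∞ := by rw [hmass]; exact ENNReal.ofReal_ne_top
  have hfin : IsFiniteMeasure D := ⟨hmt.lt_top⟩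
  have hne : NeZero D := ⟨fun h => hm0 (by simp [h])⟩
  refine ⟨(∫ y, π y).toNNReal, (D univ)⁻¹ • D, isProbabilityMeasureSMul, ?_, fun g => ?_⟩
  · refine Measure.ae_smul_measure ?_ _
    rw [hD, ae_withDensity_iff hm.ennreal_ofReal]
    refine Eventually.of_forall fun y hy => ?_
    by_contra hlt
    exact hy (by rw [hneg y (not_le.1 hlt), ENNReal.ofReal_zero])
  · rw [integral_smul_measure, hD, integral_withDensity_eq_integral_toReal_smul
      hm.ennreal_ofReal (Eventually.of_forall fun y => ENNReal.ofReal_lt_top), ← hD, hmass]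
    simp only [ENNReal.toReal_ofReal (h0 _), Complex.real_smul]
    rw [ENNReal.toReal_inv, ENNReal.toReal_ofReal hpos.le, Real.coe_toNNReal _ hpos.le,
      ← mul_assoc, ← Complex.ofReal_mul, mul_inv_cancel₀ hpos.ne', Complex.ofReal_one, one_mul]
    refine integral_congr_ae (Eventually.of_forall fun y => ?_)
    ring

/-- Existence of Lévy processes with an integrable Lévy density on `(0,∞)`. -/
lemma exists_levyProcess {π : ℝ → ℝ} (hm : Measurable π) (h0 : ∀ y, 0 ≤ π y) (hi : Integrable π)
    (hpos : 0 < ∫ y, π y) (hneg : ∀ y < 0, π y = 0) (a : ℝ) {s : ℝ} (hs : 0 ≤ s) :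
    ∃ (Ω' : Type) (_ : MeasurableSpace Ω') (P' : Measure Ω') (Y : ℝ≥0 → Ω' → ℝ),
      IsProbabilityMeasure P' ∧ IsLevyProcess Y P' ∧
      (∀ z : ℂ, z.re = 0 → ∫ ω, Complex.exp (z * (Y 1 ω : ℂ)) ∂P' =
        Complex.exp (levyExponent a s π (fun _ => 0) z)) ∧
      (0 ≤ a → s = 0 → IsSubordinator Y P') ∧ (0 < s → IsSpectrallyPositive Y P') := by
  obtain ⟨r, F, hF, hF0, hint⟩ := exists_jumpLaw hm h0 hi hpos hneg
  refine ⟨SchauderSpace × (ℕ → JumpBlock), inferInstance, jumpDiffusionMeasure r F,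
    jumpDiffusion a (√s), inferInstance, isLevyProcess_jumpDiffusion _ _, fun z hz => ?_,
    fun ha hs0 => ?_, fun hs => ?_⟩
  · have hz' : z = (z.im : ℂ) * Complex.I := by
      apply Complex.ext <;> simp [hz]
    rw [hz', (hasIncrementExponent_jumpDiffusion a (√s)).integral_exp
      (measurable_jumpDiffusion _ _) (jumpDiffusion_zero _ _) z.im, hint, levyExponent]
    congr 1
    have e1 : (((-((z.im * √s) ^ 2) / 2 : ℝ)) : ℂ) =
        (s : ℂ) * ((z.im : ℂ) * Complex.I) ^ 2 / 2 := by
      rw [mul_pow, Real.sq_sqrt hs, mul_pow, Complex.I_sq]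
      push_cast
      ring
    rw [e1]
    simp only [Complex.ofReal_zero, mul_zero, sub_zero]
    ring
  · rw [hs0, Real.sqrt_zero]
    exact isSubordinator_jumpDiffusion hF0 ha
  · exact isSpectrallyPositive_jumpDiffusion hF0 a (Real.sqrt_pos.2 hs).ne'

/-! ### The hyperexponential density of the approximant -/

section QuadratureDensity

variable {k n : ℕ} {x w : Fin n → ℝ}

lemma quadratureDensity_eq_indicator (k n : ℕ) (x w : Fin n → ℝ) :
    quadratureDensity k n x w = (Ioi 0).indicator fun y =>
      ∑ i, w i / x i ^ (2 + k) * Real.exp (-((x i)⁻¹ * y)) := by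
  ext y
  simp only [quadratureDensity, indicator, mem_Ioi, div_eq_inv_mul y]

lemma measurable_quadratureDensity : Measurable (quadratureDensity k n x w) := by
  rw [quadratureDensity_eq_indicator]
  exact Measurable.indicator (by fun_prop) measurableSet_Ioi

lemma quadratureDensity_nonneg (hx : ∀ i, 0 < x i) (hw : ∀ i, 0 < w i) (y : ℝ) :
    0 ≤ quadratureDensity k n x w y := by
  rw [quadratureDensity_eq_indicator]
  refine indicator_nonneg (fun y _ => Finset.sum_nonneg fun i _ => ?_) y
  have := hx i
  have := hw i
  positivity

lemma quadratureDensity_of_nonpos {y : ℝ} (hy : y ≤ 0) : quadratureDensity k n x w y = 0 :=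
  if_neg (not_lt.2 hy)

lemma integral_mul_quadratureDensity {g : ℝ → ℂ} {c : Fin n → ℂ}
    (hi : ∀ i, IntegrableOn (fun y => g y * (Real.exp (-((x i)⁻¹ * y)) : ℂ)) (Ioi 0))
    (hc : ∀ i, ∫ y in Ioi (0 : ℝ), g y * (Real.exp (-((x i)⁻¹ * y)) : ℂ) = c i) :
    Integrable (fun y => g y * (quadratureDensity k n x w y : ℂ)) ∧
      ∫ y, g y * (quadratureDensity k n x w y : ℂ) =
        ∑ i, ((w i / x i ^ (2 + k) : ℝ) : ℂ) * c i := by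
  have e : (fun y => g y * (quadratureDensity k n x w y : ℂ)) = (Ioi 0).indicator fun y =>
      ∑ i, ((w i / x i ^ (2 + k) : ℝ) : ℂ) * (g y * (Real.exp (-((x i)⁻¹ * y)) : ℂ)) := by
    ext y
    rw [quadratureDensity_eq_indicator]
    by_cases hy : y ∈ Ioi (0 : ℝ)
    · rw [indicator_of_mem hy, indicator_of_mem hy, Complex.ofReal_sum, Finset.mul_sum]
      refine Finset.sum_congr rfl fun i _ => ?_
      rw [Complex.ofReal_mul]
      ring
    · rw [indicator_of_notMem hy, indicator_of_notMem hy, Complex.ofReal_zero, mul_zero]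
  rw [e, integrable_indicator_iff measurableSet_Ioi, integral_indicator measurableSet_Ioi,
    integral_finsetSum _ fun i _ => (hi i).const_mul _]
  refine ⟨integrable_finsetSum _ fun i _ => (hi i).const_mul _, ?_⟩
  simp_rw [integral_const_mul, hc]

lemma integrableOn_exp_neg_inv {a : ℝ} (ha : 0 < a) :
    IntegrableOn (fun y : ℝ => (1 : ℂ) * (Real.exp (-(a⁻¹ * y)) : ℂ)) (Ioi 0) := by
  have := integrableOn_exp_complex (a := (-(a⁻¹ : ℝ) : ℂ)) (by simpa using ha)
  refine this.congr_fun (fun y _ => ?_) measurableSet_Ioi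
  push_cast
  rw [one_mul, neg_mul]

lemma integral_exp_neg_inv {a : ℝ} (ha : 0 < a) :
    ∫ y in Ioi (0 : ℝ), (1 : ℂ) * (Real.exp (-(a⁻¹ * y)) : ℂ) = a := by
  have h : ∀ y : ℝ, (1 : ℂ) * (Real.exp (-(a⁻¹ * y)) : ℂ) =
      Complex.exp ((-(a⁻¹ : ℝ) : ℂ) * y) := fun y => by
    push_cast
    rw [one_mul, neg_mul]
  simp_rw [h]
  rw [integral_exp_mul_complex_Ioi (by simpa using ha)]
  simp

lemma integrable_quadratureDensity (hx : ∀ i, 0 < x i) :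
    Integrable (quadratureDensity k n x w) := by
  have h := (integral_mul_quadratureDensity (k := k) (w := w)
    (fun i => integrableOn_exp_neg_inv (hx i)) fun i => integral_exp_neg_inv (hx i)).1
  simpa using h.re

lemma integral_quadratureDensity_pos (hn : 1 ≤ n) (hx : ∀ i, 0 < x i) (hw : ∀ i, 0 < w i) :
    0 < ∫ y, quadratureDensity k n x w y := by
  have h := (integral_mul_quadratureDensity (k := k) (w := w)
    (fun i => integrableOn_exp_neg_inv (hx i)) fun i => integral_exp_neg_inv (hx i)).2
  have h1 : ∫ y, quadratureDensity k n x w y = ∑ i, w i / x i ^ (2 + k) * x i := by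
    rw [← Complex.ofReal_inj, ← integral_complex_ofReal]
    simpa using h
  rw [h1]
  refine Finset.sum_pos (fun i _ => ?_) ⟨⟨0, hn⟩, Finset.mem_univ _⟩
  have := hx i
  have := hw i
  positivity

lemma integrable_mul_quadratureDensity_of_bound (hx : ∀ i, 0 < x i) {g : ℝ → ℝ}
    (hg : Measurable g) {C : ℝ} (hb : ∀ y, |g y| ≤ C) :
    Integrable fun y => g y * quadratureDensity k n x w y :=
  (integrable_quadratureDensity hx).bdd_mul hg.aestronglyMeasurable (Eventually.of_forall hb)

lemma isLevyDensity_quadratureDensity (hx : ∀ i, 0 < x i) (hw : ∀ i, 0 < w i) :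
    IsLevyDensity (quadratureDensity k n x w) where
  measurable := measurable_quadratureDensity
  nonneg := quadratureDensity_nonneg hx hw
  integrable := integrable_mul_quadratureDensity_of_bound hx (by fun_prop) (C := 1) fun y => by
    rw [abs_of_nonneg (by positivity)]
    exact min_le_left _ _

lemma integral_id_mul_quadratureDensity (hx : ∀ i, 0 < x i) :
    Integrable (fun y : ℝ => (y : ℂ) * (quadratureDensity k n x w y : ℂ)) ∧
      ∫ y : ℝ, (y : ℂ) * (quadratureDensity k n x w y : ℂ) =
        ∑ i, ((w i / x i ^ (2 + k) : ℝ) : ℂ) * ((x i ^ 2 : ℝ) : ℂ) := by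
  refine integral_mul_quadratureDensity (g := fun y => (y : ℂ)) (fun i => ?_) fun i => ?_
  · have := (integrableOn_mul_exp (inv_pos.2 (hx i))).ofReal (𝕜 := ℂ)
    refine this.congr (Eventually.of_forall fun y => ?_)
    exact Complex.ofReal_mul _ _
  · have := integral_mul_exp (inv_pos.2 (hx i))
    rw [inv_inv] at this
    rw [← this, ← integral_complex_ofReal]
    simp only [Complex.ofReal_mul]

lemma integral_exp_sub_one_mul_quadratureDensity (hx : ∀ i, 0 < x i) {z : ℂ} (hz : z.re ≤ 0) :
    Integrable (fun y : ℝ => (Complex.exp (z * y) - 1) * (quadratureDensity k n x w y : ℂ)) ∧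
      ∫ y : ℝ, (Complex.exp (z * y) - 1) * (quadratureDensity k n x w y : ℂ) =
        z * ∑ i, (w i / x i ^ k : ℂ) / (1 - z * x i) := by
  have hz' : ∀ i, z.re < (x i)⁻¹ := fun i => hz.trans_lt (inv_pos.2 (hx i))
  obtain ⟨h1, h2⟩ := integral_mul_quadratureDensity (k := k) (w := w)
    (g := fun y => Complex.exp (z * y) - 1)
    (fun i => integrableOn_exp_sub_one_mul_exp (inv_pos.2 (hx i)) (hz' i))
    fun i => integral_exp_sub_one_mul_exp (inv_pos.2 (hx i)) (hz' i)
  refine ⟨h1, h2.trans ?_⟩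
  rw [Finset.mul_sum]
  refine Finset.sum_congr rfl fun i _ => ?_
  have hxi : (x i : ℂ) ≠ 0 := by exact_mod_cast (hx i).ne'
  rw [inv_inv, Complex.real_smul]
  push_cast
  rw [pow_add]
  field_simp

/-- The mixing measure consists of atoms at `1 / xᵢ` with masses `wᵢ / xᵢ^{2+k}`. -/
lemma isHyperexponential_quadratureDensity (k : ℕ) (hx : ∀ i, 0 < x i) (hw : ∀ i, 0 < w i) :
    IsHyperexponential (quadratureDensity k n x w) := by
  set ν : Measure ℝ := ∑ i, ENNReal.ofReal (w i / x i ^ (2 + k)) • Measure.dirac (x i)⁻¹ with hν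
  have hpos : ∀ᵐ u ∂ν, ∃ i, u = (x i)⁻¹ := by
    have hs : MeasurableSet {u : ℝ | ∃ i, u = (x i)⁻¹} := by
      have : {u : ℝ | ∃ i, u = (x i)⁻¹} = range fun i => (x i)⁻¹ := by
        ext u; simp [eq_comm]
      rw [this]
      exact (finite_range _).measurableSet
    rw [ae_iff, ← compl_ofPred, hν, Measure.finsetSum_apply]
    refine Finset.sum_eq_zero fun i _ => ?_
    rw [Measure.smul_apply, Measure.dirac_apply' _ hs.compl, indicator_of_notMem, smul_zero]
    simp
  have hfin : IsFiniteMeasure ν := by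
    refine ⟨?_⟩
    rw [hν, Measure.finsetSum_apply]
    refine ENNReal.sum_lt_top.2 fun i _ => ?_
    simp
  have hneg : ν (Iic 0) = 0 := by
    refine measure_mono_null ?_ (ae_iff.1 hpos)
    rintro u hu ⟨i, rfl⟩
    exact absurd (inv_pos.2 (hx i)) (not_lt.2 hu)
  have hint : ∀ y, Integrable (fun u => Real.exp (-(u * y))) ν := fun y => by
    rw [hν]
    refine integrable_finsetSum_measure.2 fun i _ => ?_
    exact (integrable_dirac (by simp)).smul_measure ENNReal.ofReal_ne_top
  have hres : ν.restrict (Ioi 0) = ν := by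
    refine Measure.restrict_eq_self_of_ae_mem ?_
    filter_upwards [hpos] with u hu
    obtain ⟨i, rfl⟩ := hu
    exact inv_pos.2 (hx i)
  have hres' : ν.restrict (Iio 0) = 0 :=
    Measure.restrict_eq_zero.2 (measure_mono_null Iio_subset_Iic_self hneg)
  refine ⟨ν, ⟨measure_mono_null (by simp) hneg, fun y _ => (hint y).integrableOn,
    fun y _ => (hint y).integrableOn, fun y hy => ?_, fun y hy => ?_⟩, ?_⟩
  · rw [hres, hν, integral_finsetSum_measure fun i _ =>
      (integrable_dirac (by simp)).smul_measure ENNReal.ofReal_ne_top,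
      quadratureDensity_eq_indicator, indicator_of_mem (mem_Ioi.2 hy)]
    refine Finset.sum_congr rfl fun i _ => ?_
    have := hx i
    have := hw i
    rw [integral_smul_measure, integral_dirac, ENNReal.toReal_ofReal (by positivity), smul_eq_mul]
  · rw [hres', integral_zero_measure, quadratureDensity_of_nonpos hy.le]
  · refine (finite_range fun i => (x i)⁻¹).subset
      (Measure.support_subset_of_isClosed (finite_range _).isClosed ?_)
    filter_upwards [hpos] with u hu
    obtain ⟨i, rfl⟩ := hu
    exact mem_range_self i

end QuadratureDensity

/-! ### Matching the quadrature formula with the Lévy–Khintchine exponent -/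

section QuadratureExponent

variable {k n : ℕ} {x w : Fin n → ℝ}

lemma one_sub_mul_ofReal_ne_zero {z : ℂ} (hz : z.re ≤ 0) {a : ℝ} (ha : 0 < a) :
    1 - z * (a : ℂ) ≠ 0 := by
  intro h
  have := congrArg Complex.re h
  simp at this
  nlinarith

/-- The mean jump intensity `∑ wᵢ / xᵢᵏ`. -/
noncomputable def quadratureMean (k n : ℕ) (x w : Fin n → ℝ) : ℝ := ∑ i, w i / x i ^ k

lemma integral_id_mul_quadratureDensity_eq (hx : ∀ i, 0 < x i) :
    ∫ y : ℝ, (y : ℂ) * (quadratureDensity k n x w y : ℂ) = (quadratureMean k n x w : ℂ) := by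
  rw [(integral_id_mul_quadratureDensity hx).2, quadratureMean, Complex.ofReal_sum]
  refine Finset.sum_congr rfl fun i _ => ?_
  have := (hx i).ne'
  rw [← Complex.ofReal_mul]
  congr 1
  rw [pow_add]
  field_simp

/-- Changing the cutoff from zero to the identity moves the mean of the Lévy measure into the linear
coefficient. -/
lemma levyExponent_id_eq (hx : ∀ i, 0 < x i) (a s : ℝ) {z : ℂ} (hz : z.re ≤ 0) :
    levyExponent (a + quadratureMean k n x w) s (quadratureDensity k n x w) (fun y => y) z =
      levyExponent a s (quadratureDensity k n x w) (fun _ => 0) z := by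
  have h1 := (integral_exp_sub_one_mul_quadratureDensity (k := k) (w := w) hx hz).1
  obtain ⟨h2, -⟩ := integral_id_mul_quadratureDensity (k := k) (w := w) hx
  have e : ∀ y : ℝ, (Complex.exp (z * y) - 1 - z * y) * (quadratureDensity k n x w y : ℂ) =
      (Complex.exp (z * y) - 1) * (quadratureDensity k n x w y : ℂ) -
        z * ((y : ℂ) * (quadratureDensity k n x w y : ℂ)) := fun y => by ring
  simp only [levyExponent, e, Complex.ofReal_zero, mul_zero, sub_zero]
  rw [integral_sub h1 (h2.const_mul z), integral_const_mul,
    integral_id_mul_quadratureDensity_eq hx]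
  push_cast
  ring

lemma levyExponent_quadratureDensity (hx : ∀ i, 0 < x i) (a s : ℝ) {z : ℂ} (hz : z.re ≤ 0) :
    levyExponent a s (quadratureDensity k n x w) (fun _ => 0) z =
      (s : ℂ) * z ^ 2 / 2 + (a : ℂ) * z + z * ∑ i, (w i / x i ^ k : ℂ) / (1 - z * x i) := by
  simp only [levyExponent, Complex.ofReal_zero, mul_zero, sub_zero]
  rw [(integral_exp_sub_one_mul_quadratureDensity hx hz).2]

/-- The discrete counterpart of `IsCMOneSided.stieltjes_succ`, applied at each node. -/
lemma sum_div_pow_succ_div (hx : ∀ i, 0 < x i) (k : ℕ) {z : ℂ} (hz : z.re ≤ 0) :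
    ∑ i, (w i / x i ^ (k + 1) : ℂ) / (1 - z * x i) =
      ∑ i, (w i / x i ^ (k + 1) : ℂ) + z * ∑ i, (w i / x i ^ k : ℂ) / (1 - z * x i) := by
  rw [Finset.mul_sum, ← Finset.sum_add_distrib]
  refine Finset.sum_congr rfl fun i _ => ?_
  have h1 : (x i : ℂ) ≠ 0 := by exact_mod_cast (hx i).ne'
  have h2 := one_sub_mul_ofReal_ne_zero hz (hx i)
  generalize hD : 1 - z * (x i : ℂ) = D at h2 ⊢
  have hz' : z = (1 - D) / x i := by
    rw [eq_div_iff h1]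
    linear_combination -hD
  rw [pow_succ, hz']
  field_simp
  ring

lemma levyExponent_eq_quadratureFormula_zero (hx : ∀ i, 0 < x i) (ψ : ℂ → ℂ) {z : ℂ}
    (hz : z.re ≤ 0) :
    levyExponent 0 0 (quadratureDensity 0 n x w) (fun _ => 0) z =
      quadratureFormula ψ 0 n x w z := by
  rw [levyExponent_quadratureDensity hx _ _ hz, quadratureFormula]
  simp

lemma levyExponent_eq_quadratureFormula_one (hx : ∀ i, 0 < x i) (ψ : ℂ → ℂ) {z : ℂ}
    (hz : z.re ≤ 0) {a : ℝ} (ha : (a : ℂ) = iteratedDeriv 1 ψ 0 - ∑ i, (w i : ℂ) / (x i : ℂ)) :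
    levyExponent a 0 (quadratureDensity 1 n x w) (fun _ => 0) z =
      quadratureFormula ψ 1 n x w z := by
  rw [levyExponent_quadratureDensity hx _ _ hz, quadratureFormula, ha,
    sum_div_pow_succ_div hx 0 hz]
  simp only [zero_add, pow_one, pow_zero, div_one, Finset.Icc_self, Finset.sum_singleton,
    Nat.factorial_one, Nat.cast_one, Complex.ofReal_zero]
  ring

/-- Two Taylor steps in the jump part release `z ∑ wᵢ / xᵢ²`, cancelled by the shift of the drift,
and `z² ∑ wᵢ / xᵢ`, cancelled by the correction in `s`. -/
lemma levyExponent_eq_quadratureFormula_two (hx : ∀ i, 0 < x i) (ψ : ℂ → ℂ) {z : ℂ}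
    (hz : z.re ≤ 0) {a s : ℝ} (ha : (a : ℂ) = iteratedDeriv 1 ψ 0)
    (hs : (s : ℂ) = iteratedDeriv 2 ψ 0 - 2 * ∑ i, (w i : ℂ) / (x i : ℂ)) :
    levyExponent (a - quadratureMean 2 n x w) s (quadratureDensity 2 n x w) (fun _ => 0) z =
      quadratureFormula ψ 2 n x w z := by
  have hI : Finset.Icc 1 2 = {1, 2} := rfl
  rw [levyExponent_quadratureDensity hx _ _ hz, quadratureFormula, Complex.ofReal_sub, ha, hs,
    sum_div_pow_succ_div hx 1 hz, sum_div_pow_succ_div hx 0 hz, quadratureMean, hI,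
    Finset.sum_pair (by norm_num)]
  simp only [zero_add, pow_one, pow_zero, div_one, Nat.factorial_one, Nat.factorial_two,
    Nat.cast_one, Nat.cast_ofNat, Complex.ofReal_sum, Complex.ofReal_div, Complex.ofReal_pow,
    Nat.reduceAdd]
  ring

lemma IsLaplaceExponent.congr {Ω : Type*} [MeasurableSpace Ω] {X : ℝ≥0 → Ω → ℝ} {P : Measure Ω}
    {φ φ' : ℂ → ℂ} (h : IsLaplaceExponent X P φ) (he : ∀ z : ℂ, z.re = 0 → φ' z = φ z) :
    IsLaplaceExponent X P φ' where
  continuousOn := h.continuousOn.congr he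
  zero := (he 0 Complex.zero_re).trans h.zero
  exp_eq z hz := by rw [he z hz, h.exp_eq z hz]

/-- The Lévy processes with Lévy density `quadratureDensity k n x w`. -/
lemma exists_levyProcess_quadratureDensity (k : ℕ) (hn : 1 ≤ n) (hx : ∀ i, 0 < x i)
    (hw : ∀ i, 0 < w i) (a : ℝ) {s : ℝ} (hs : 0 ≤ s) {φ : ℂ → ℂ}
    (hφ : ContinuousOn φ {z | z.re = 0}) (hφe : ∀ z : ℂ, z.re = 0 →
      levyExponent a s (quadratureDensity k n x w) (fun _ => 0) z = φ z) :
    ∃ (Ω' : Type) (_ : MeasurableSpace Ω') (P' : Measure Ω') (Y : ℝ≥0 → Ω' → ℝ),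
      IsProbabilityMeasure P' ∧ IsLevyProcess Y P' ∧ IsLaplaceExponent Y P' φ ∧
      HasTriple Y P' a s (quadratureDensity k n x w) (fun _ => 0) ∧
      HasTriple Y P' (a + quadratureMean k n x w) s (quadratureDensity k n x w) (fun y => y) ∧
      (0 ≤ a → s = 0 → IsSubordinator Y P') ∧ (0 < s → IsSpectrallyPositive Y P') := by
  obtain ⟨Ω', m, P', Y, hP, hY, hexp, hsub, hspec⟩ := exists_levyProcess
    measurable_quadratureDensity (quadratureDensity_nonneg (k := k) hx hw)
    (integrable_quadratureDensity hx) (integral_quadratureDensity_pos hn hx hw)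
    (fun y hy => quadratureDensity_of_nonpos hy.le) a hs
  have hlap : IsLaplaceExponent Y P' φ := by
    refine ⟨hφ, ?_, fun z hz => by rw [hexp z hz, hφe z hz]⟩
    rw [← hφe 0 Complex.zero_re]
    simp [levyExponent]
  refine ⟨Ω', m, P', Y, hP, hY, hlap, ⟨hY, hs, isLevyDensity_quadratureDensity hx hw,
    measurable_const, ?_, hlap.congr hφe⟩, ⟨hY, hs, isLevyDensity_quadratureDensity hx hw,
    measurable_id, ?_, hlap.congr fun z hz => ?_⟩, hsub, hspec⟩
  · refine integrable_mul_quadratureDensity_of_bound hx ?_ (C := 1) fun y => ?_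
    · exact ((Measurable.ite (measurableSet_lt (by fun_prop) measurable_const) measurable_id
        measurable_const).sub_const 0).abs
    · rw [abs_abs, sub_zero]
      split_ifs with h
      · exact h.le
      · simp
  · have hid : Integrable fun y : ℝ => y * quadratureDensity k n x w y := by
      simpa using (integral_id_mul_quadratureDensity (k := k) (w := w) hx).1.re
    have hm : Measurable fun y : ℝ => |(if |y| < 1 then y else 0) - y| :=
      ((Measurable.ite (measurableSet_lt (by fun_prop) measurable_const) measurable_id
        measurable_const).sub measurable_id).abs
    refine hid.mono (hm.mul measurable_quadratureDensity).aestronglyMeasurable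
      (Eventually.of_forall fun y => ?_)
    rw [norm_mul, norm_mul]
    refine mul_le_mul_of_nonneg_right ?_ (norm_nonneg _)
    rw [Real.norm_eq_abs, Real.norm_eq_abs, abs_abs]
    split_ifs <;> simp
  · rw [levyExponent_id_eq hx a s hz.le, hφe z hz]

end QuadratureExponent

/-! ### Positivity of the drift and of the Gaussian coefficient -/

section Positivity

variable {π : ℝ → ℝ} {μ : Measure ℝ} {ρ : ℝ} {k n : ℕ} {x w : Fin n → ℝ}

lemma IsCMOneSided.node_weight_pos (h : IsCMOneSided π μ ρ)
    (hcut : Integrable fun x => |(if |x| < 1 then x else 0) - 0| * π x)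
    (hn : (n : ℕ∞) < μ.support.encard)
    (hq : IsGaussianQuadrature (powMustar μ (2 + k)) n x w) :
    (∀ i, 0 < x i) ∧ ∀ i, 0 < w i := by
  have hfin := h.isFiniteMeasure_powMustar hcut k
  have hb := h.ae_powMustar_mem (2 + k)
  have hne := h.not_ae_eval_eq_zero hn (2 + k)
  exact ⟨hq.node_pos hb hne, hq.weight_pos hb hne⟩

/-- The strict underestimate of the integral of `1 / v`, with that integral evaluated as a mass. -/
lemma IsCMOneSided.sum_div_lt_mass (h : IsCMOneSided π μ ρ)
    (hcut : Integrable fun x => |(if |x| < 1 then x else 0) - 0| * π x)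
    (hn : (n : ℕ∞) < μ.support.encard)
    (hq : IsGaussianQuadrature (powMustar μ (2 + (k + 1))) n x w) :
    ∑ i, w i / x i < (powMustar μ (2 + k)).real univ := by
  have hfin := h.isFiniteMeasure_powMustar hcut (k + 1)
  rw [← h.integral_inv_powMustar_succ]
  exact hq.sum_div_lt (h.ae_powMustar_mem _) (h.not_ae_eval_eq_zero hn _)
    (h.integrable_inv_powMustar_succ hcut k)

end Positivity

end LevyPade

open LevyPade

theorem theorem3 {Ω : Type*} [MeasurableSpace Ω] (P : Measure Ω) [IsProbabilityMeasure P]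
    (X : ℝ≥0 → Ω → ℝ) (π : ℝ → ℝ) (μ : Measure ℝ) (ρ : ℝ) (ψ : ℂ → ℂ)
    (hX : LevyPade.IsSubordinator X P)
    (hT : LevyPade.HasTriple X P 0 0 π (fun _ => 0))
    (hCM : LevyPade.IsCMOneSided π μ ρ)
    (hψ : ψ = LevyPade.subordinatorExponent π)
    (k : ℕ) (hk : k ≤ 2) :
    (∀ n : ℕ, 1 ≤ n → (n : ℕ∞) < μ.support.encard →
      (∃ x w : Fin n → ℝ, LevyPade.IsGaussianQuadrature (LevyPade.powMustar μ (2 + k)) n x w) ∧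
      (∃ R S : Polynomial ℂ, LevyPade.IsPade ψ 0 (n + k) n R S) ∧
      ∀ x w : Fin n → ℝ, LevyPade.IsGaussianQuadrature (LevyPade.powMustar μ (2 + k)) n x w →
      ∀ R S : Polynomial ℂ, LevyPade.IsPade ψ 0 (n + k) n R S →
        (∀ z : ℂ, S.eval z ≠ 0 →
          R.eval z / S.eval z = LevyPade.quadratureFormula ψ k n x w z) ∧
        ∃ (Ω' : Type) (_ : MeasurableSpace Ω') (P' : Measure Ω') (Y : ℝ≥0 → Ω' → ℝ),
          IsProbabilityMeasure P' ∧
          LevyPade.IsLevyProcess Y P' ∧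
          LevyPade.IsLaplaceExponent Y P' (fun z => R.eval z / S.eval z) ∧
          LevyPade.IsHyperexponential (LevyPade.quadratureDensity k n x w) ∧
          (k = 0 →
            LevyPade.HasTriple Y P' 0 0 (LevyPade.quadratureDensity k n x w) (fun _ => 0) ∧
            LevyPade.IsSubordinator Y P') ∧
          (k = 1 → ∃ a : ℝ,
            (a : ℂ) = iteratedDeriv 1 ψ 0 - ∑ i, (w i : ℂ) / (x i : ℂ) ∧
            0 < a ∧
            LevyPade.HasTriple Y P' a 0 (LevyPade.quadratureDensity k n x w) (fun _ => 0) ∧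
            LevyPade.IsSubordinator Y P') ∧
          (k = 2 → ∃ a s : ℝ,
            (a : ℂ) = iteratedDeriv 1 ψ 0 ∧
            (s : ℂ) = iteratedDeriv 2 ψ 0 - 2 * ∑ i, (w i : ℂ) / (x i : ℂ) ∧
            0 < s ∧
            LevyPade.HasTriple Y P' a s (LevyPade.quadratureDensity k n x w) (fun y => y) ∧
            LevyPade.IsSpectrallyPositive Y P')) ∧
    (∃ Ψ : ℂ → ℂ,
      AnalyticOnNhd ℂ Ψ (Complex.ofReal '' Ici ρ)ᶜ ∧
      (∀ z : ℂ, z.re < ρ → Ψ z = ψ z) ∧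
      ∀ A : Set ℂ, IsCompact A → A ⊆ (Complex.ofReal '' Ici ρ)ᶜ →
        ∃ c₁ c₂ : ℝ, 0 < c₁ ∧ 0 < c₂ ∧
          ∀ n : ℕ, 1 ≤ n → (n : ℕ∞) < μ.support.encard →
          ∀ R S : Polynomial ℂ, LevyPade.IsPade ψ 0 (n + k) n R S →
          ∀ z ∈ A, S.eval z ≠ 0 ∧
            ‖R.eval z / S.eval z - Ψ z‖ < c₁ * Real.exp (-(c₂ * n))) := by
  -- With cutoff zero, admissibility is the finite variation of the jumps.
  have hcut := hT.cutoff
  subst hψ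
  refine ⟨fun n hn1 hn => ?_, extendedExponent μ, hCM.analyticOnNhd_extendedExponent hcut,
    fun z hz => (hCM.subordinatorExponent_eq hcut hz).symm,
    fun A hA hsub => hCM.exists_rate hcut hk hA hsub⟩
  obtain ⟨x₀, w₀, hq₀⟩ := hCM.exists_quadrature hcut k hn
  refine ⟨⟨x₀, w₀, hq₀⟩, hCM.exists_pade hcut hk hn1 hn hq₀, fun x w hq R S hRS => ?_⟩
  obtain ⟨hS, hformula⟩ := hCM.pade_eq_formula hcut hk hn1 hn hq hRS
  refine ⟨hformula, ?_⟩
  obtain ⟨hx, hw⟩ := hCM.node_weight_pos hcut hn hq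
  have hS0 : ∀ z : ℂ, z.re = 0 → S.eval z ≠ 0 := by
    refine fun z hz => hS z ?_
    rintro ⟨y, hy, rfl⟩
    exact absurd (hCM.pos.trans_le hy) (by rw [← Complex.ofReal_re y, hz]; exact lt_irrefl 0)
  have hcont : ContinuousOn (fun z => R.eval z / S.eval z) {z : ℂ | z.re = 0} :=
    R.continuous.continuousOn.div S.continuous.continuousOn hS0
  have hhyp := isHyperexponential_quadratureDensity k hx hw
  obtain rfl | rfl | rfl : k = 0 ∨ k = 1 ∨ k = 2 := by omega
  · obtain ⟨Ω', m, P', Y, hP, hY, hL, hT0, -, hsub, -⟩ := exists_levyProcess_quadratureDensity 0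
      hn1 hx hw 0 le_rfl hcont fun z hz => by
        rw [hformula z (hS0 z hz)]
        exact levyExponent_eq_quadratureFormula_zero hx _ hz.le
    exact ⟨Ω', m, P', Y, hP, hY, hL, hhyp, fun _ => ⟨hT0, hsub le_rfl rfl⟩,
      fun h => by omega, fun h => by omega⟩
  · set a : ℝ := (powMustar μ 2).real univ - ∑ i, w i / x i with ha
    have ha0 : 0 < a := sub_pos.2 (hCM.sum_div_lt_mass (k := 0) hcut hn hq)
    have ha1 : (a : ℂ) = iteratedDeriv 1 (subordinatorExponent π) 0 -
        ∑ i, (w i : ℂ) / (x i : ℂ) := by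
      rw [hCM.iteratedDeriv_one_exponent hcut, ha]
      push_cast
      rfl
    obtain ⟨Ω', m, P', Y, hP, hY, hL, hT0, -, hsub, -⟩ := exists_levyProcess_quadratureDensity 1
      hn1 hx hw a le_rfl hcont fun z hz => by
        rw [hformula z (hS0 z hz)]
        exact levyExponent_eq_quadratureFormula_one hx _ hz.le ha1
    exact ⟨Ω', m, P', Y, hP, hY, hL, hhyp, fun h => by omega,
      fun _ => ⟨a, ha1, ha0, hT0, hsub ha0.le rfl⟩, fun h => by omega⟩
  · set s : ℝ := 2 * ((powMustar μ 3).real univ - ∑ i, w i / x i) with hs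
    have hs0 : 0 < s :=
      mul_pos two_pos (sub_pos.2 (hCM.sum_div_lt_mass (k := 1) hcut hn hq))
    have hs1 : (s : ℂ) = iteratedDeriv 2 (subordinatorExponent π) 0 -
        2 * ∑ i, (w i : ℂ) / (x i : ℂ) := by
      rw [hCM.iteratedDeriv_two_exponent hcut, hs]
      push_cast
      ring
    set a : ℝ := (powMustar μ 2).real univ with ha
    have ha1 : (a : ℂ) = iteratedDeriv 1 (subordinatorExponent π) 0 :=
      (hCM.iteratedDeriv_one_exponent hcut).symm
    -- The process is built with cutoff zero, so its drift is lowered by the jump mean; the identity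
    -- cutoff adds it back and leaves `ψ'(0)`.
    obtain ⟨Ω', m, P', Y, hP, hY, hL, -, hT1, -, hspec⟩ := exists_levyProcess_quadratureDensity 2
      hn1 hx hw (a - quadratureMean 2 n x w) hs0.le hcont fun z hz => by
        rw [hformula z (hS0 z hz)]
        exact levyExponent_eq_quadratureFormula_two hx _ hz.le ha1 hs1
    rw [sub_add_cancel] at hT1
    exact ⟨Ω', m, P', Y, hP, hY, hL, hhyp, fun h => by omega, fun h => by omega,
      fun _ => ⟨a, s, ha1, hs1, hs0, hT1, hspec hs0⟩⟩
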